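/- For $m>0$ and $0<p<\infty$ let $\mathcal{F}_{(m,p)}$ be the generalized Fock space of all entire functions $f$ on $\mathbb{C}$ with $$\|f\|_{(m,p)}^p=\int_{\mathbb{C}}|f(z)|^p e^{-p|z|^m}\,dA(z)<\infty ,$$ where $dA$ is Lebesgue area measure. It is a metric space under $\|f-g\|_{(m,p)}^{\min(1,p)}$. Let $Df=f'$. We say that $D:\mathcal{F}_{(m,p)}\to\mathcal{F}_{(m,q)}$ is bounded if $f'\in\mathcal{F}_{(m,q)}$ for all $f\in\mathcal{F}_{(m,p)}$ and $\|f'\|_{(m,q)}\le C\|f\|_{(m,p)}$ with a constant $C$ independent of $f$, and that it is compact if it maps $\mathcal{F}_{(m,p)}$ into $\mathcal{F}_{(m,q)}$ and the image of the unit ball is relatively compact in $\mathcal{F}_{(m,q)}$. Put $\|D\|=\sup\{\|f'\|_{(m,q)}:\|f\|_{(m,p)}\le 1\}\in[0,\infty]$. (i) Let $m>0$ and $0<p\le q<\infty$. Then $D:\mathcal{F}_{(m,p)}\to\mathcal{F}_{(m,q)}$ is (a) bounded if and only if $m\le 2-\dfrac{pq}{pq+q-p}$; (b) compact if and only if $m<2-\dfrac{pq}{pq+q-p}$.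 (c) Moreover, there are constants $c,C>0$, depending only on $m,p,q$, such that $cB\le\|D\|\le CB$, where $B=1$ if $m=1$, and $$B=|m^{2+p}-m^{1+p}|^{1/p}\,\sup_{w\in\mathbb{C}}(1+|w|)^{(m-1)+\frac{(q-p)(m-2)}{qp}}\in(0,\infty]\quad\text{if } m\ne 1 .$$ (ii) Let $m>0$ and $0<q<p<\infty$. Then the following are equivalent: (a) $D:\mathcal{F}_{(m,p)}\to\mathcal{F}_{(m,q)}$ is bounded; (b) $D:\mathcal{F}_{(m,p)}\to\mathcal{F}_{(m,q)}$ is compact; (c) $m<1-2\left(\dfrac1q-\dfrac1p\right)$. -/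

import Mathlib

open MeasureTheory
open scoped ENNReal NNReal

/-- The (quasi-)norm `‖f‖_{(m,p)} = (∫_ℂ |f(z)|^p e^{-p|z|^m} dA(z))^{1/p}`, with values in
`[0, ∞]`, where `dA` is Lebesgue area measure. -/
noncomputable def fockENorm (m p : ℝ) (f : ℂ → ℂ) : ℝ≥0∞ :=
  (∫⁻ z : ℂ, ‖f z‖ₑ ^ p * ENNReal.ofReal (Real.exp (-p * ‖z‖ ^ m))) ^ (1 / p)

theorem fockENorm_eq_eLpNorm (m : ℝ) {p : ℝ} (hp : 0 < p) (f : ℂ → ℂ) :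
    fockENorm m p f =
      eLpNorm (fun z : ℂ => f z * (Real.exp (-‖z‖ ^ m) : ℂ)) (ENNReal.ofReal p) volume := by
  rw [eLpNorm_eq_lintegral_rpow_enorm_toReal (by simpa using hp) (by simp),
    ENNReal.toReal_ofReal hp.le]
  unfold fockENorm
  congr 1
  refine lintegral_congr fun z => ?_
  rw [enorm_mul, ENNReal.mul_rpow_of_nonneg _ _ hp.le]
  congr 1
  rw [← ofReal_norm, Complex.norm_real, Real.norm_of_nonneg (Real.exp_pos _).le,
    ENNReal.ofReal_rpow_of_pos (Real.exp_pos _), ← Real.exp_mul]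
  congr 2
  ring

theorem fock_weighted_aestronglyMeasurable (m : ℝ) {f : ℂ → ℂ} (hf : Differentiable ℂ f) :
    AEStronglyMeasurable (fun z : ℂ => f z * (Real.exp (-‖z‖ ^ m) : ℂ)) volume := by
  have h : Measurable (fun z : ℂ => (Real.exp (-‖z‖ ^ m) : ℂ)) := by fun_prop
  exact (hf.continuous.measurable.mul h).aestronglyMeasurable

theorem fockENorm_zero (m : ℝ) {p : ℝ} (hp : 0 < p) : fockENorm m p 0 = 0 := by
  simp [fockENorm, ENNReal.zero_rpow_of_pos hp, hp]

theorem fockENorm_smul (m : ℝ) {p : ℝ} (hp : 0 < p) (c : ℂ) (f : ℂ → ℂ) :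
    fockENorm m p (c • f) = ‖c‖ₑ * fockENorm m p f := by
  rw [fockENorm_eq_eLpNorm m hp, fockENorm_eq_eLpNorm m hp, ← eLpNorm_const_smul]
  congr 1
  ext z
  simp [mul_assoc]

theorem fockENorm_neg (m p : ℝ) (f : ℂ → ℂ) : fockENorm m p (-f) = fockENorm m p f := by
  simp [fockENorm]

/-- The triangle inequality for `‖·‖^{min(1,p)}`. -/
theorem fockENorm_add_rpow_le (m : ℝ) {p : ℝ} (hp : 0 < p) {f g : ℂ → ℂ}
    (hf : Differentiable ℂ f) (hg : Differentiable ℂ g) :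
    fockENorm m p (f + g) ^ min 1 p ≤ fockENorm m p f ^ min 1 p + fockENorm m p g ^ min 1 p := by
  rcases le_total 1 p with h1 | h1
  · rw [min_eq_left h1]
    simp only [ENNReal.rpow_one, fockENorm_eq_eLpNorm m hp]
    refine le_trans (le_of_eq ?_) (eLpNorm_add_le (fock_weighted_aestronglyMeasurable m hf)
      (fock_weighted_aestronglyMeasurable m hg) (by simpa using h1))
    congr 1
    ext z
    simp [add_mul]
  · rw [min_eq_right h1]
    unfold fockENorm
    simp only [← ENNReal.rpow_mul, one_div, inv_mul_cancel₀ hp.ne', ENNReal.rpow_one]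
    rw [← lintegral_add_left]
    · refine lintegral_mono fun z => ?_
      rw [← add_mul]
      gcongr
      exact (ENNReal.rpow_le_rpow (enorm_add_le _ _) hp.le).trans
        (ENNReal.rpow_add_le_add_rpow _ _ hp.le h1)
    · have := hf.continuous.measurable
      fun_prop

/-- The entire functions `f` with `‖f‖_{(m,p)} < ∞`, as a subspace of the space of functions. -/
def fockSubmodule (m p : ℝ) (hp : 0 < p) : Submodule ℂ (ℂ → ℂ) where
  carrier := {f | Differentiable ℂ f ∧ fockENorm m p f < ∞}
  zero_mem' := ⟨differentiable_const 0, by simp [fockENorm_zero m hp]⟩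
  add_mem' := by
    rintro f g ⟨hf, hf'⟩ ⟨hg, hg'⟩
    have h0 : 0 < min 1 p := lt_min one_pos hp
    refine ⟨hf.add hg, (ENNReal.rpow_lt_top_iff_of_pos h0).1
      ((fockENorm_add_rpow_le m hp hf hg).trans_lt (ENNReal.add_lt_top.2 ⟨?_, ?_⟩))⟩
    · exact (ENNReal.rpow_lt_top_iff_of_pos h0).2 hf'
    · exact (ENNReal.rpow_lt_top_iff_of_pos h0).2 hg'
  smul_mem' := by
    rintro c f ⟨hf, hf'⟩
    refine ⟨hf.const_smul c, ?_⟩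
    rw [fockENorm_smul m hp]
    exact ENNReal.mul_lt_top enorm_lt_top hf'

/-- The generalized Fock space `F_(m,p)`. (A separate type, so that it carries the topology of its
own quasi-norm and not that of pointwise convergence.) -/
def FockSpace (m p : ℝ) (hp : 0 < p) : Type := fockSubmodule m p hp

namespace FockSpace

variable {m p : ℝ} {hp : 0 < p}

noncomputable instance : AddCommGroup (FockSpace m p hp) :=
  inferInstanceAs (AddCommGroup (fockSubmodule m p hp))

noncomputable instance : Module ℂ (FockSpace m p hp) :=
  inferInstanceAs (Module ℂ (fockSubmodule m p hp))

instance : CoeFun (FockSpace m p hp) (fun _ => ℂ → ℂ) := ⟨fun f => f.1⟩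

theorem dist_aux_ne_top (f g : FockSpace m p hp) :
    fockENorm m p (⇑f - ⇑g) ^ min 1 p ≠ ∞ :=
  ((ENNReal.rpow_lt_top_iff_of_pos (lt_min one_pos hp)).2
    ((fockSubmodule m p hp).sub_mem f.2 g.2).2).ne

/-- `F_(m,p)` with the metric `‖f - g‖^{min(1,p)}`, that is `‖f - g‖` for `p ≥ 1` and
`‖f - g‖^p` for `p < 1`. -/
noncomputable instance : MetricSpace (FockSpace m p hp) where
  dist f g := (fockENorm m p (⇑f - ⇑g) ^ min 1 p).toReal
  dist_self f := by simp [fockENorm_zero m hp, lt_min one_pos hp]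
  dist_comm f g := by rw [← neg_sub, fockENorm_neg]
  dist_triangle f g h := by
    rw [← ENNReal.toReal_add (dist_aux_ne_top f g) (dist_aux_ne_top g h)]
    refine ENNReal.toReal_mono
      (ENNReal.add_ne_top.2 ⟨dist_aux_ne_top f g, dist_aux_ne_top g h⟩) ?_
    have := fockENorm_add_rpow_le m hp (f.2.1.sub g.2.1) (g.2.1.sub h.2.1)
    simpa using this
  eq_of_dist_eq_zero := by
    intro f g h
    have h1 : fockENorm m p (⇑f - ⇑g) = 0 := by
      rcases (ENNReal.toReal_eq_zero_iff _).1 h with h | h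
      · have h0 : 0 < min 1 p := lt_min one_pos hp
        exact (ENNReal.rpow_eq_zero_iff_of_pos h0).1 h
      · exact absurd h (dist_aux_ne_top f g)
    have hd : Differentiable ℂ (⇑f - ⇑g) := f.2.1.sub g.2.1
    rw [fockENorm_eq_eLpNorm m hp, eLpNorm_eq_zero_iff
      (fock_weighted_aestronglyMeasurable m hd) (by simpa using hp)] at h1
    have h2 : (⇑f - ⇑g) =ᵐ[volume] (fun _ => (0 : ℂ)) := by
      filter_upwards [h1] with z hz
      have hne : (Real.exp (-‖z‖ ^ m) : ℂ) ≠ 0 := by exact_mod_cast (Real.exp_pos _).ne'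
      exact (mul_eq_zero.1 hz).resolve_right hne
    have h3 := (Continuous.ae_eq_iff_eq volume hd.continuous continuous_const).1 h2
    exact Subtype.ext (sub_eq_zero.1 h3)

end FockSpace

/-- The linear map `T : F_(m,p) → F_(m,q)` is the differential operator `f ↦ f'`. -/
def IsDerivOperator {m p q : ℝ} {hp : 0 < p} {hq : 0 < q}
    (T : FockSpace m p hp →ₗ[ℂ] FockSpace m q hq) : Prop :=
  ∀ (f : FockSpace m p hp) (z : ℂ), T f z = deriv f z

/-- `D : F_(m,p) → F_(m,q)` is well defined and bounded: `‖f'‖_{(m,q)} ≤ C ‖f‖_{(m,p)}`. -/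
def DerivBounded (m p q : ℝ) (hp : 0 < p) (hq : 0 < q) : Prop :=
  ∃ T : FockSpace m p hp →ₗ[ℂ] FockSpace m q hq, IsDerivOperator T ∧
    ∃ C : ℝ≥0, ∀ f : FockSpace m p hp, fockENorm m q (T f) ≤ C * fockENorm m p f

/-- `D : F_(m,p) → F_(m,q)` is well defined and compact. -/
def DerivCompact (m p q : ℝ) (hp : 0 < p) (hq : 0 < q) : Prop :=
  ∃ T : FockSpace m p hp →ₗ[ℂ] FockSpace m q hq, IsDerivOperator T ∧ IsCompactOperator T

/-- The operator norm `sup {‖f'‖_{(m,q)} : f ∈ F_(m,p), ‖f‖_{(m,p)} ≤ 1}` of `D`, with values in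
`[0, ∞]`. -/
noncomputable def derivOpNorm (m p q : ℝ) (hp : 0 < p) : ℝ≥0∞ :=
  ⨆ (f : FockSpace m p hp) (_ : fockENorm m p f ≤ 1), fockENorm m q (deriv f)

/-- The quantity to which the norm of `D` is comparable, with values in `[0, ∞]`. -/
noncomputable def derivNormBound (m p q : ℝ) : ℝ≥0∞ :=
  if m = 1 then 1 else
    ENNReal.ofReal (|m ^ (2 + p) - m ^ (1 + p)| ^ (1 / p)) *
      ⨆ w : ℂ, ENNReal.ofReal ((1 + ‖w‖) ^ ((m - 1) + (q - p) * (m - 2) / (q * p)))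

/-! ### The sub-mean value property of `‖f‖ ^ p` -/

/-! Write `u = |f| e^{-|z|^m}` and let `κ = (m-1) + (q-p)(m-2)/(qp)`. Two length scales govern the
problem. At distance up to a multiple of `(1+|z|)^{1-m/2}` the weight `|w|^m` is the real part of an
affine function up to a bounded error. Dividing `f` by the corresponding exponential turns
subharmonicity of `|f|^p` into a sub-mean value property of `u^p`, hence `u(z) (1+|z|)^{(2-m)/p} ≤ C
‖f‖`. On the smaller scale `(1+|z|)^{1-m}` the weight itself is constant up to a bounded error, so
Cauchy's estimate costs a factor `(1+|z|)^{m-1}`. This bounds `f'` pointwise and, after averaging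
over balls, bounds `(1+|z|)^{1-m} |f'| e^{-|z|^m}` in `L^p` by `‖f‖`.

Sufficiency: for `p ≤ q` these two bounds are interpolated (`derivTailBound_of_le`); for `q < p` the
`L^p` bound is combined with Hölder (`derivTailBound_of_lt`). Either way the mass of `f'` outside a
disc is controlled by a power of its radius. Radius `0` gives boundedness. If the power is negative,
Montel's theorem and Fatou's lemma give compactness (`DerivTailBound.derivCompact`).

Necessity for `p ≤ q`: the polynomials `z^{Lk} (z+R)^k` with `R^m = k/b` have weighted modulus
concentrated near `R` on the first scale (`exists_test_functions`). After normalization their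
derivatives, tested at `R` with the pointwise bound of the target space, have size at least a
multiple of `R^κ`, so boundedness forces `κ ≤ 0`. A fixed element of the target space gives `o(1)`
in the same test (`tendsto_fockDensity_mul_polyWeight`), so compactness forces `κ < 0`.

Necessity for `q < p`: in the coordinate `y = √m |z|^{m/2}` the normalized weighted monomial of
degree `k^2` is dominated by a Gaussian of fixed width centred at `y = k`. Signed sums of these,
with coefficients `k^{-a}`, have weighted modulus `O((1+|z|)^{-am/2})` for all signs. Averaging over
signs, their derivatives are at least as large as the dominant term. As `a` decreases to the
critical value, boundedness would give `1/ε ≲ ε^{-q/p}` unless `m` lies below the threshold.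

The norm comparison needs no further estimate: `‖D‖` and `B` are both positive, and they are finite
for the same `(m,p,q)`. -/

open Real in
theorem log_norm_le_circleAverage {f : ℂ → ℂ} (hf : Differentiable ℂ f) {c : ℂ} (hc : f c ≠ 0)
    {R : ℝ} (hR : 0 < R) : log ‖f c‖ ≤ circleAverage (log ‖f ·‖) c R := by
  have hA : AnalyticOnNhd ℂ f (Metric.closedBall c |R|) := fun z _ => hf.analyticAt z
  rw [hA.circleAverage_log_norm hR.ne' hc]
  refine le_add_of_nonneg_left (finsum_nonneg fun u => ?_)
  by_cases hu : u ∈ Metric.closedBall c |R|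
  · refine mul_nonneg (by exact_mod_cast MeromorphicOn.AnalyticOnNhd.divisor_nonneg hA u) ?_
    rw [Metric.mem_closedBall, dist_comm, dist_eq_norm, abs_of_pos hR] at hu
    -- At `u = c` the logarithm is the default `log 0 = 0`; elsewhere `R / ‖c - u‖ ≥ 1` on the disc.
    rcases eq_or_ne (‖c - u‖) 0 with h | h
    · simp [h]
    · apply log_nonneg
      rw [← div_eq_mul_inv, one_le_div (lt_of_le_of_ne (norm_nonneg _) h.symm)]
      exact hu
  · simp [hu]

-- Jensen's inequality by hand: `|f|^p = exp (p log |f|)` lies above the tangent line of `exp` at `p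
-- log |f c|`, and `log |f|` satisfies the sub-mean value inequality.
open Real in
theorem norm_rpow_le_circleAverage {f : ℂ → ℂ} (hf : Differentiable ℂ f) {p : ℝ} (hp : 0 < p)
    (c : ℂ) {R : ℝ} (hR : 0 < R) : ‖f c‖ ^ p ≤ circleAverage (fun z => ‖f z‖ ^ p) c R := by
  by_cases hc : f c = 0
  · rw [hc, norm_zero, zero_rpow hp.ne']
    exact circleAverage_nonneg_of_nonneg fun x _ => by positivity
  have hint : CircleIntegrable (log ‖f ·‖) c R :=
    MeromorphicOn.circleIntegrable_log_norm fun z _ => (hf.analyticAt z).meromorphicAt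
  have hcont : CircleIntegrable (fun z => ‖f z‖ ^ p) c R :=
    ((hf.continuous.norm.rpow_const fun _ => Or.inr hp.le).continuousOn).circleIntegrable hR.le
  set a := ‖f c‖ with ha
  have ha0 : 0 < a := norm_pos_iff.2 hc
  set g : ℂ → ℝ := fun z => (a ^ p * p) • log ‖f z‖ + a ^ p * (1 - p * log a) with hg
  have hgint : CircleIntegrable g c R :=
    (hint.const_smul (a := a ^ p * p)).add (circleIntegrable_const _ _ _)
  -- At zeros of `f` the default `log 0 = 0` can break the tangent inequality, so these null points
  -- are discarded.
  have hae : ∀ᵐ θ ∂(volume.restrict (Set.uIoc 0 (2 * π))), f (circleMap c R θ) ≠ 0 := by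
    have h1 : f ⁻¹' {0}ᶜ ∈ Filter.codiscrete ℂ :=
      AnalyticOnNhd.preimage_zero_mem_codiscrete (x := c) (fun z _ => hf.analyticAt z) hc
    have h2 := circleMap_preimage_codiscrete (c := c) hR.ne' 
      (Filter.codiscreteWithin_mono (Set.subset_univ _) h1)
    exact ae_restrict_le_codiscreteWithin measurableSet_uIoc
      (Filter.codiscreteWithin_mono (Set.subset_univ _) h2)
  have key : circleAverage g c R ≤ circleAverage (fun z => ‖f z‖ ^ p) c R := by
    unfold circleAverage
    refine mul_le_mul_of_nonneg_left ?_ (by positivity)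
    rw [Set.uIoc_of_le two_pi_pos.le] at hae
    refine intervalIntegral.integral_mono_ae_restrict two_pi_pos.le hgint hcont ?_
    rw [Filter.EventuallyLE, ← restrict_Ioc_eq_restrict_Icc]
    filter_upwards [hae] with θ hθ
    have hb : 0 < ‖f (circleMap c R θ)‖ := norm_pos_iff.2 hθ
    set b := ‖f (circleMap c R θ)‖ with hbdef
    have h3 : p * log b - p * log a + 1 ≤ exp (p * log b - p * log a) := add_one_le_exp _
    have h4 : b ^ p = a ^ p * exp (p * log b - p * log a) := by
      rw [rpow_def_of_pos hb, rpow_def_of_pos ha0, ← exp_add]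
      ring_nf
    rw [h4]
    have : g (circleMap c R θ) = a ^ p * (p * log b - p * log a + 1) := by
      simp only [hg, smul_eq_mul]; ring
    rw [this]
    gcongr
  refine le_trans ?_ key
  have h5 : circleAverage g c R
      = (a ^ p * p) * circleAverage (log ‖f ·‖) c R + a ^ p * (1 - p * log a) := by
    rw [hg, circleAverage_fun_add (f₁ := fun z => (a ^ p * p) • log ‖f z‖)
      (hint.const_smul (a := a ^ p * p)) (circleIntegrable_const _ _ _),
      circleAverage_const, circleAverage_fun_smul, smul_eq_mul]
  rw [h5]
  have h6 := log_norm_le_circleAverage hf hc hR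
  have h7 : a ^ p * p * log a ≤ a ^ p * p * circleAverage (log ‖f ·‖) c R := by gcongr
  linarith

open Real in
theorem lintegral_ball_eq_polar (G : ℂ → ℝ≥0∞) (hG : Measurable G) (c : ℂ) (R : ℝ) :
    ∫⁻ z in Metric.ball c R, G z =
      ∫⁻ r in Set.Ioo 0 R, ENNReal.ofReal r * ∫⁻ θ in Set.Ioo (-π) π, G (circleMap c r θ) := by
  have h1 : ∫⁻ z in Metric.ball c R, G z
      = ∫⁻ z, (Metric.ball (0 : ℂ) R).indicator (fun z => G (c + z)) z := by
    rw [← lintegral_indicator measurableSet_ball, ← lintegral_add_left_eq_self _ c]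
    refine lintegral_congr fun z => ?_
    simp [Set.indicator]
  rw [h1, ← Complex.lintegral_comp_polarCoord_symm]
  have ht : polarCoord.target = Set.Ioi (0 : ℝ) ×ˢ Set.Ioo (-π) π := rfl
  rw [ht, Measure.volume_eq_prod, ← Measure.prod_restrict, lintegral_prod]
  · rw [← lintegral_indicator measurableSet_Ioi, ← lintegral_indicator measurableSet_Ioo]
    refine lintegral_congr fun r => ?_
    by_cases hr : 0 < r
    · have hm : ∀ θ : ℝ, (Complex.polarCoord.symm (r, θ)) ∈ Metric.ball (0 : ℂ) R ↔ r < R := by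
        intro θ
        rw [mem_ball_zero_iff, Complex.norm_polarCoord_symm, abs_of_pos hr]
      by_cases hR : r < R
      · rw [Set.indicator_of_mem (show r ∈ Set.Ioi 0 from hr),
          Set.indicator_of_mem (show r ∈ Set.Ioo 0 R from ⟨hr, hR⟩),
          ← lintegral_const_mul' _ _ ENNReal.ofReal_ne_top]
        refine lintegral_congr fun θ => ?_
        rw [Set.indicator_of_mem ((hm θ).2 hR), smul_eq_mul]
        congr 2
        rw [Complex.polarCoord_symm_apply, circleMap, Complex.exp_mul_I]
        simp
      · rw [Set.indicator_of_mem (show r ∈ Set.Ioi 0 from hr),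
          Set.indicator_of_notMem (fun h => hR h.2)]
        refine (lintegral_congr fun θ => ?_).trans lintegral_zero
        rw [Set.indicator_of_notMem (fun h => hR ((hm θ).1 h)), smul_zero]
    · rw [Set.indicator_of_notMem (show r ∉ Set.Ioi 0 from hr),
          Set.indicator_of_notMem (fun h => hr h.1)]
  · have h2 : Measurable fun p : ℝ × ℝ => Complex.polarCoord.symm p := by
      simp only [Complex.polarCoord_symm_apply]
      fun_prop
    have h3 : Measurable ((Metric.ball (0 : ℂ) R).indicator (fun z => G (c + z))) :=
      (hG.comp (measurable_const_add c)).indicator measurableSet_ball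
    exact ((ENNReal.measurable_ofReal.comp measurable_fst).smul (h3.comp h2)).aemeasurable

-- The inequality on circles is multiplied by `r` and integrated over `0 < r < R`.
open Real in
theorem enorm_rpow_mul_le_lintegral_ball {f : ℂ → ℂ} (hf : Differentiable ℂ f) {p : ℝ} (hp : 0 < p)
    (c : ℂ) {R : ℝ} (hR : 0 < R) :
    ‖f c‖ₑ ^ p * ENNReal.ofReal (π * R ^ 2) ≤ ∫⁻ z in Metric.ball c R, ‖f z‖ₑ ^ p := by
  have hcn : Continuous fun z => ‖f z‖ ^ p := hf.continuous.norm.rpow_const fun _ => Or.inr hp.le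
  have he : ∀ z, ‖f z‖ₑ ^ p = ENNReal.ofReal (‖f z‖ ^ p) := fun z => by
    rw [← ofReal_norm, ENNReal.ofReal_rpow_of_nonneg (norm_nonneg _) hp.le]
  rw [lintegral_ball_eq_polar _ (by have := hf.continuous.measurable; fun_prop)]
  have h1 : ∀ r ∈ Set.Ioo 0 R, ENNReal.ofReal r * ENNReal.ofReal (2 * π * ‖f c‖ ^ p) ≤
      ENNReal.ofReal r * ∫⁻ θ in Set.Ioo (-π) π, ‖f (circleMap c r θ)‖ₑ ^ p := by
    intro r hr
    gcongr
    simp_rw [he]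
    have hci : Continuous fun θ => ‖f (circleMap c r θ)‖ ^ p := hcn.comp (continuous_circleMap c r)
    rw [restrict_Ioo_eq_restrict_Ioc, ← ofReal_integral_eq_lintegral_ofReal]
    · apply ENNReal.ofReal_le_ofReal
      rw [← intervalIntegral.integral_of_le (by linarith [pi_pos])]
      have h2 := norm_rpow_le_circleAverage hf hp c hr.1
      have h3 : Function.Periodic (fun θ => ‖f (circleMap c r θ)‖ ^ p) (2 * π) := fun θ => by
        simp [periodic_circleMap c r θ]
      have h4 := h3.intervalIntegral_add_eq (-π) 0
      rw [show -π + 2 * π = π by ring, zero_add] at h4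
      rw [h4]
      rw [circleAverage, smul_eq_mul, inv_mul_eq_div, le_div_iff₀ two_pi_pos] at h2
      linarith
    · exact (hci.intervalIntegrable _ _).1
    · exact Filter.Eventually.of_forall fun θ => by positivity
  refine le_trans ?_ (setLIntegral_mono' measurableSet_Ioo h1)
  rw [lintegral_mul_const' _ _ ENNReal.ofReal_ne_top, restrict_Ioo_eq_restrict_Ioc,
    ← ofReal_integral_eq_lintegral_ofReal, ← intervalIntegral.integral_of_le hR.le, integral_id, he,
    zero_pow two_ne_zero, sub_zero, ← ENNReal.ofReal_mul (by positivity), ← ENNReal.ofReal_mul (by positivity)]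
  · apply le_of_eq; congr 1; ring
  · exact (continuous_id.intervalIntegrable _ _).1
  · refine (ae_restrict_mem measurableSet_Ioc).mono fun r hr => hr.1.le

/-! ### First order expansion of the weight `‖z‖ ^ m` -/

/-- Taylor's remainder from two mean value inequalities, one for `x^(a-1)` and one for `x^a - a x`.
The interval is the range of `(‖w‖ / ‖z‖)^2` when `‖w - z‖ ≤ ‖z‖ / 2`. -/
theorem exists_abs_rpow_sub_le (a : ℝ) : ∃ C : ℝ, 0 ≤ C ∧ ∀ x ∈ Set.Icc (1 / 4 : ℝ) (9 / 4),
    |x ^ a - 1 - a * (x - 1)| ≤ C * (x - 1) ^ 2 := by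
  set S : Set ℝ := Set.Icc (1 / 4 : ℝ) (9 / 4) with hS
  have hpos : ∀ x ∈ S, 0 < x := fun x hx => lt_of_lt_of_le (by norm_num) hx.1
  obtain ⟨M, hM⟩ : ∃ M, ∀ x ∈ S, ‖(a - 1) * x ^ (a - 1 - 1)‖ ≤ M :=
    isCompact_Icc.exists_bound_of_continuousOn (f := fun x : ℝ => (a - 1) * x ^ (a - 1 - 1))
      (continuousOn_const.mul (continuousOn_id.rpow_const fun x hx => Or.inl (hpos x hx).ne'))
  have h1S : (1 : ℝ) ∈ S := by constructor <;> norm_num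
  have hM0 : 0 ≤ M := (norm_nonneg _).trans (hM 1 h1S)
  have hg : ∀ x ∈ S, |x ^ (a - 1) - 1| ≤ M * |x - 1| := by
    intro x hx
    have := (convex_Icc (1 / 4 : ℝ) (9 / 4)).norm_image_sub_le_of_norm_hasDerivWithin_le
      (f := fun x : ℝ => x ^ (a - 1)) (fun y hy =>
        (Real.hasDerivAt_rpow_const (Or.inl (hpos y hy).ne')).hasDerivWithinAt) hM h1S hx
    simpa using this
  refine ⟨|a| * M, by positivity, fun x hx => ?_⟩
  have hsub : Set.uIcc 1 x ⊆ S := Set.uIcc_subset_Icc h1S hx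
  have hd : ∀ y ∈ Set.uIcc 1 x, HasDerivWithinAt (fun y : ℝ => y ^ a - a * y)
      (a * y ^ (a - 1) - a * 1) (Set.uIcc 1 x) y := fun y hy =>
    ((Real.hasDerivAt_rpow_const (Or.inl (hpos y (hsub hy)).ne')).sub
      ((hasDerivAt_id y).const_mul a)).hasDerivWithinAt
  have hb : ∀ y ∈ Set.uIcc 1 x, ‖a * y ^ (a - 1) - a * 1‖ ≤ |a| * (M * |x - 1|) := by
    intro y hy
    rw [← mul_sub, norm_mul, Real.norm_eq_abs, Real.norm_eq_abs]
    gcongr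
    exact (hg y (hsub hy)).trans
      (mul_le_mul_of_nonneg_left (Set.abs_sub_left_of_mem_uIcc hy) hM0)
  have := (convex_uIcc 1 x).norm_image_sub_le_of_norm_hasDerivWithin_le hd hb
    Set.left_mem_uIcc Set.right_mem_uIcc
  rw [Real.norm_eq_abs, Real.norm_eq_abs, Real.one_rpow] at this
  calc |x ^ a - 1 - a * (x - 1)| = |x ^ a - a * x - (1 - a * 1)| := by ring_nf
    _ ≤ _ := this
    _ = |a| * M * (x - 1) ^ 2 := by rw [← sq_abs (x - 1)]; ring

set_option maxHeartbeats 1000000 in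
/-- Near `z`, on the scale `(1 + ‖z‖) ^ (1 - m / 2)`, the weight `‖w‖ ^ m` is within a bounded
error of an affine function. -/
theorem exists_weight_expansion {m : ℝ} (hm : 0 < m) : ∃ K : ℝ, 0 < K ∧ ∀ z : ℂ, ∃ l : ℂ,
    ‖l‖ ≤ K * (1 + ‖z‖) ^ (m - 1) ∧
    ∀ w : ℂ, ‖w - z‖ ≤ 1 / 4 * (1 + ‖z‖) ^ (1 - m / 2) →
      |‖w‖ ^ m - ‖z‖ ^ m - (l * (w - z)).re| ≤ K := by
  obtain ⟨C, hC0, hC⟩ := exists_abs_rpow_sub_le (m / 2)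
  -- One sum serves every case: `2^m` for `‖z‖ < 1`, `m 2^|m-1|` for the size of `l`, and the rest
  -- exceeds the Taylor error `9C + m/2`.
  refine ⟨2 ^ m + m * 2 + m + C * 100 + m * 2 ^ |m - 1|, by positivity, fun z => ?_⟩
  have h1z : (1 : ℝ) ≤ 1 + ‖z‖ := by linarith [norm_nonneg z]
  have hsc : (1 + ‖z‖) ^ (1 - m / 2) ≤ 1 + ‖z‖ := by
    conv_rhs => rw [← Real.rpow_one (1 + ‖z‖)]
    exact Real.rpow_le_rpow_of_exponent_le h1z (by linarith)
  rcases lt_or_ge ‖z‖ 1 with hz | hz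
  · refine ⟨0, by rw [norm_zero]; positivity, fun w hw => ?_⟩
    have h2 : ‖w‖ ≤ 2 := by
      calc ‖w‖ = ‖(w - z) + z‖ := by simp
        _ ≤ ‖w - z‖ + ‖z‖ := norm_add_le _ _
        _ ≤ 2 := by linarith
    have h3 : ‖w‖ ^ m ≤ 2 ^ m := by gcongr
    have h4 : ‖z‖ ^ m ≤ 2 ^ m := by gcongr; linarith
    have h5 : 0 ≤ ‖w‖ ^ m := by positivity
    have h6 : 0 ≤ ‖z‖ ^ m := by positivity
    have h7 : 0 ≤ m * 2 + m + C * 100 + m * 2 ^ |m - 1| := by positivity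
    simp only [zero_mul, Complex.zero_re, sub_zero]
    rw [abs_le]
    constructor <;> linarith
  · have hz0 : 0 < ‖z‖ := by linarith
    have hcmp : ‖z‖ ^ (m - 1) ≤ 2 ^ |m - 1| * (1 + ‖z‖) ^ (m - 1) := by
      rcases le_total 0 (m - 1) with h | h
      · have a1 : ‖z‖ ^ (m - 1) ≤ (1 + ‖z‖) ^ (m - 1) :=
          Real.rpow_le_rpow hz0.le (by linarith) h
        have a2 : (1 : ℝ) ≤ 2 ^ |m - 1| := Real.one_le_rpow (by norm_num) (abs_nonneg _)
        have a3 : 0 ≤ (1 + ‖z‖) ^ (m - 1) := by positivity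
        nlinarith
      · rw [abs_of_nonpos h, Real.rpow_neg (by norm_num), ← Real.inv_rpow (by norm_num),
          ← Real.mul_rpow (by norm_num) (by positivity)]
        exact Real.rpow_le_rpow_of_nonpos (by positivity) (by linarith) h
    -- The map `h ↦ Re (l h)` is the real differential of `‖·‖^m` at `z`.
    refine ⟨(m * ‖z‖ ^ (m - 2) : ℝ) * (starRingEnd ℂ) z, ?_, fun w hw => ?_⟩
    · rw [norm_mul, RCLike.norm_conj, Complex.norm_real, Real.norm_of_nonneg (by positivity)]
      have : m * ‖z‖ ^ (m - 2) * ‖z‖ = m * ‖z‖ ^ (m - 1) := by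
        rw [mul_assoc, ← Real.rpow_add_one hz0.ne']; ring_nf
      rw [this]
      have a3 : 0 ≤ (1 + ‖z‖) ^ (m - 1) := by positivity
      have a4 : m * ‖z‖ ^ (m - 1) ≤ m * 2 ^ |m - 1| * (1 + ‖z‖) ^ (m - 1) := by
        rw [mul_assoc]; gcongr
      have a5 : 0 ≤ 2 ^ m + m * 2 + m + C * 100 := by positivity
      nlinarith
    · set h := w - z with hh
      have hw' : w = z + h := by rw [hh]; ring
      set s := (starRingEnd ℂ z * h).re with hs
      have hsabs : |s| ≤ ‖z‖ * ‖h‖ := by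
        refine (Complex.abs_re_le_norm _).trans ?_
        rw [norm_mul, RCLike.norm_conj]
      have hhz : ‖h‖ ≤ ‖z‖ / 2 := by linarith
      set δ := ‖h‖ / ‖z‖ with hδ
      have hδ0 : 0 ≤ δ := by positivity
      have hδ2 : δ ≤ 1 / 2 := by rw [hδ, div_le_iff₀ hz0]; linarith
      have hhd : ‖h‖ = δ * ‖z‖ := by rw [hδ, div_mul_cancel₀ _ hz0.ne']
      -- The square makes `x - 1` polynomial in `h`; then `‖w‖^m = ‖z‖^m x^(m/2)` is expanded at `x
      -- = 1`.
      set x := (‖w‖ / ‖z‖) ^ 2 with hx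
      have hwsq : ‖w‖ ^ 2 = ‖z‖ ^ 2 + 2 * s + ‖h‖ ^ 2 := by
        rw [hw', hs]
        simp only [← Complex.normSq_eq_norm_sq, Complex.normSq_apply, Complex.mul_re,
          Complex.conj_re, Complex.conj_im, Complex.add_re, Complex.add_im]
        ring
      have hx1 : x - 1 = 2 * (s / ‖z‖ ^ 2) + δ ^ 2 := by
        rw [hx, hδ, div_pow, hwsq, div_pow]; field_simp; ring
      have hsd : |s / ‖z‖ ^ 2| ≤ δ := by
        rw [abs_div, abs_of_pos (by positivity : 0 < ‖z‖ ^ 2), div_le_iff₀ (by positivity)]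
        calc |s| ≤ ‖z‖ * ‖h‖ := hsabs
          _ = δ * ‖z‖ ^ 2 := by rw [hhd]; ring
      have hw1 : ‖w‖ / ‖z‖ ≤ 3 / 2 := by
        rw [div_le_iff₀ hz0, hw']
        linarith [norm_add_le z h]
      have hw2 : 1 / 2 ≤ ‖w‖ / ‖z‖ := by
        rw [le_div_iff₀ hz0, hw']
        have : ‖z‖ ≤ ‖z + h‖ + ‖h‖ := by simpa using norm_sub_le (z + h) h
        linarith
      have hxm : x ∈ Set.Icc (1 / 4 : ℝ) (9 / 4) := by constructor <;> nlinarith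
      have hxa : x ^ (m / 2) = ‖w‖ ^ m / ‖z‖ ^ m := by
        rw [hx, ← Real.rpow_natCast, ← Real.rpow_mul (by positivity),
          Real.div_rpow (norm_nonneg _) (norm_nonneg _)]
        congr 2 <;> push_cast <;> ring
      have hT := hC x hxm
      rw [hxa, hx1] at hT
      obtain ⟨b1, b2⟩ := abs_le.1 hsd
      have hsq : (2 * (s / ‖z‖ ^ 2) + δ ^ 2) ^ 2 ≤ 9 * δ ^ 2 := by
        have c1 : |2 * (s / ‖z‖ ^ 2) + δ ^ 2| ≤ 3 * δ := by
          rw [abs_le]; constructor <;> nlinarith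
        calc _ = |2 * (s / ‖z‖ ^ 2) + δ ^ 2| ^ 2 := (sq_abs _).symm
          _ ≤ (3 * δ) ^ 2 := by gcongr
          _ = _ := by ring
      have hzm : 0 < ‖z‖ ^ m := by positivity
      have hre : (((m * ‖z‖ ^ (m - 2) : ℝ) : ℂ) * (starRingEnd ℂ) z * h).re
          = ‖z‖ ^ m * (m * (s / ‖z‖ ^ 2)) := by
        rw [mul_assoc, Complex.re_ofReal_mul, ← hs, Real.rpow_sub hz0, Real.rpow_two]
        field_simp
      -- This is what fixes the exponent `1 - m/2`: the second-order error has size `‖z‖^m δ^2`.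
      have hδm : ‖z‖ ^ m * δ ^ 2 ≤ 1 := by
        have d1 : δ ≤ ‖z‖ ^ (-(m / 2)) := by
          rw [hδ, div_le_iff₀ hz0, ← Real.rpow_add_one hz0.ne']
          refine hw.trans ?_
          rcases le_total 0 (1 - m / 2) with h0 | h0
          · have e1 : (1 + ‖z‖) ^ (1 - m / 2) ≤ (2 * ‖z‖) ^ (1 - m / 2) :=
              Real.rpow_le_rpow (by positivity) (by linarith) h0
            rw [Real.mul_rpow (by norm_num) hz0.le] at e1
            have e2 : (2 : ℝ) ^ (1 - m / 2) ≤ 2 := by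
              conv_rhs => rw [← Real.rpow_one 2]
              exact Real.rpow_le_rpow_of_exponent_le (by norm_num) (by linarith)
            have e3 : 0 ≤ ‖z‖ ^ (1 - m / 2) := by positivity
            rw [show -(m / 2) + 1 = 1 - m / 2 by ring]
            nlinarith
          · have e1 : (1 + ‖z‖) ^ (1 - m / 2) ≤ ‖z‖ ^ (1 - m / 2) :=
              Real.rpow_le_rpow_of_nonpos hz0 (by linarith) h0
            have e3 : 0 ≤ ‖z‖ ^ (1 - m / 2) := by positivity
            rw [show -(m / 2) + 1 = 1 - m / 2 by ring]
            linarith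
        calc ‖z‖ ^ m * δ ^ 2 ≤ ‖z‖ ^ m * (‖z‖ ^ (-(m / 2))) ^ 2 := by gcongr
          _ = 1 := by
            rw [← Real.rpow_natCast, ← Real.rpow_mul hz0.le, ← Real.rpow_add hz0]
            norm_num
      rw [hre]
      have hfin : ‖w‖ ^ m - ‖z‖ ^ m - ‖z‖ ^ m * (m * (s / ‖z‖ ^ 2)) = ‖z‖ ^ m *
          ((‖w‖ ^ m / ‖z‖ ^ m - 1 - m / 2 * (2 * (s / ‖z‖ ^ 2) + δ ^ 2)) + m / 2 * δ ^ 2) := by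
        field_simp; ring
      rw [hfin, abs_mul, abs_of_pos hzm]
      calc ‖z‖ ^ m * |(‖w‖ ^ m / ‖z‖ ^ m - 1 - m / 2 * (2 * (s / ‖z‖ ^ 2) + δ ^ 2))
              + m / 2 * δ ^ 2|
          ≤ ‖z‖ ^ m * (C * (9 * δ ^ 2) + m / 2 * δ ^ 2) := by
            gcongr
            refine (abs_add_le _ _).trans (add_le_add (hT.trans ?_) ?_)
            · gcongr
            · rw [abs_of_nonneg (by positivity)]
        _ = (9 * C + m / 2) * (‖z‖ ^ m * δ ^ 2) := by ring
        _ ≤ (9 * C + m / 2) * 1 := by gcongr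
        _ ≤ _ := by
          have a1 : (0:ℝ) ≤ 2 ^ m := by positivity
          have a2 : 0 ≤ m * 2 ^ |m - 1| := by positivity
          linarith

/-! ### Weighted densities and polynomial weights -/

/-- The weighted modulus `|f(z)| e^{-|z|^m}`. -/
noncomputable def fockDensity (m : ℝ) (f : ℂ → ℂ) (z : ℂ) : ℝ≥0∞ :=
  ‖f z‖ₑ * ENNReal.ofReal (Real.exp (-‖z‖ ^ m))

/-- The polynomial weight `(1 + |z|)^a`. -/
noncomputable def polyWeight (a : ℝ) (z : ℂ) : ℝ≥0∞ := ENNReal.ofReal ((1 + ‖z‖) ^ a)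

theorem one_add_norm_pos (z : ℂ) : 0 < 1 + ‖z‖ := by positivity

theorem polyWeight_ne_zero (a : ℝ) (z : ℂ) : polyWeight a z ≠ 0 :=
  (ENNReal.ofReal_pos.2 (Real.rpow_pos_of_pos (one_add_norm_pos z) _)).ne'

theorem polyWeight_ne_top (a : ℝ) (z : ℂ) : polyWeight a z ≠ ∞ := ENNReal.ofReal_ne_top

theorem polyWeight_zero (z : ℂ) : polyWeight 0 z = 1 := by simp [polyWeight]

theorem polyWeight_add (a b : ℝ) (z : ℂ) :
    polyWeight (a + b) z = polyWeight a z * polyWeight b z := by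
  rw [polyWeight, Real.rpow_add (one_add_norm_pos z), ENNReal.ofReal_mul (by positivity)]
  rfl

theorem polyWeight_rpow (a s : ℝ) (z : ℂ) : polyWeight a z ^ s = polyWeight (a * s) z := by
  rw [polyWeight, ENNReal.ofReal_rpow_of_pos (by positivity),
    ← Real.rpow_mul (one_add_norm_pos z).le]
  rfl

theorem polyWeight_mul_neg (a : ℝ) (z : ℂ) : polyWeight a z * polyWeight (-a) z = 1 := by
  rw [← polyWeight_add, add_neg_cancel, polyWeight_zero]

theorem measurable_polyWeight (a : ℝ) : Measurable (polyWeight a) := by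
  unfold polyWeight; fun_prop

theorem polyWeight_le_of_nonpos {a R : ℝ} (ha : a ≤ 0) (hR : 0 ≤ R) {z : ℂ} (hz : R ≤ ‖z‖) :
    polyWeight a z ≤ ENNReal.ofReal ((1 + R) ^ a) :=
  ENNReal.ofReal_le_ofReal (Real.rpow_le_rpow_of_nonpos (by positivity) (by linarith) ha)

theorem rpow_le_rpow_abs_mul {A x y : ℝ} (hA : 0 < A) (hx : 0 < x) (h1 : x ≤ A * y)
    (h2 : y ≤ A * x) (a : ℝ) : x ^ a ≤ A ^ |a| * y ^ a := by
  have hy : 0 < y := pos_of_mul_pos_right (hx.trans_le h1) hA.le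
  rcases le_total 0 a with h | h
  · rw [abs_of_nonneg h, ← Real.mul_rpow hA.le hy.le]
    exact Real.rpow_le_rpow hx.le h1 h
  · rw [abs_of_nonpos h, Real.rpow_neg hA.le, ← Real.inv_rpow hA.le,
      ← Real.mul_rpow (by positivity) hy.le]
    refine Real.rpow_le_rpow_of_nonpos (by positivity) ?_ h
    rwa [inv_mul_le_iff₀ hA]

theorem polyWeight_le_of_near {z w : ℂ} (h : ‖w - z‖ ≤ 1 / 4 * (1 + ‖z‖)) (a : ℝ) :
    polyWeight a w ≤ ENNReal.ofReal (2 ^ |a|) * polyWeight a z ∧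
      polyWeight a z ≤ ENNReal.ofReal (2 ^ |a|) * polyWeight a w := by
  have h1 : ‖w‖ ≤ ‖w - z‖ + ‖z‖ := by simpa using norm_add_le (w - z) z
  have h2 : ‖z‖ ≤ ‖w - z‖ + ‖w‖ := by simpa [add_comm] using norm_sub_le w (w - z)
  have h0 := norm_nonneg z
  have h0' := norm_nonneg w
  unfold polyWeight
  rw [← ENNReal.ofReal_mul (by positivity), ← ENNReal.ofReal_mul (by positivity)]
  exact ⟨ENNReal.ofReal_le_ofReal
      (rpow_le_rpow_abs_mul two_pos (one_add_norm_pos w) (by linarith) (by linarith) a),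
    ENNReal.ofReal_le_ofReal
      (rpow_le_rpow_abs_mul two_pos (one_add_norm_pos z) (by linarith) (by linarith) a)⟩

theorem one_add_norm_rpow_le {a : ℝ} (ha : a ≤ 1) (z : ℂ) : (1 + ‖z‖) ^ a ≤ 1 + ‖z‖ := by
  conv_rhs => rw [← Real.rpow_one (1 + ‖z‖)]
  exact Real.rpow_le_rpow_of_exponent_le (by linarith [norm_nonneg z]) ha

theorem fockDensity_rpow (m : ℝ) {p : ℝ} (hp : 0 ≤ p) (f : ℂ → ℂ) (z : ℂ) :
    fockDensity m f z ^ p = ‖f z‖ₑ ^ p * ENNReal.ofReal (Real.exp (-p * ‖z‖ ^ m)) := by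
  rw [fockDensity, ENNReal.mul_rpow_of_nonneg _ _ hp,
    ENNReal.ofReal_rpow_of_pos (Real.exp_pos _), ← Real.exp_mul]
  ring_nf

theorem fockENorm_rpow (m : ℝ) {p : ℝ} (hp : 0 < p) (f : ℂ → ℂ) :
    fockENorm m p f ^ p = ∫⁻ z, fockDensity m f z ^ p := by
  simp_rw [fockDensity_rpow m hp.le]
  rw [fockENorm, ← ENNReal.rpow_mul, one_div, inv_mul_cancel₀ hp.ne', ENNReal.rpow_one]

theorem measurable_fockDensity (m : ℝ) {f : ℂ → ℂ} (hf : Continuous f) :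
    Measurable (fockDensity m f) := by
  have := hf.measurable
  unfold fockDensity
  fun_prop

theorem differentiable_deriv_of_entire {f : ℂ → ℂ} (hf : Differentiable ℂ f) :
    Differentiable ℂ (deriv f) := fun z =>
  ((hf.analyticAt z).deriv).differentiableAt

theorem fockDensity_sub_le (m : ℝ) (f g : ℂ → ℂ) (z : ℂ) :
    fockDensity m f z ≤ fockDensity m (f - g) z + fockDensity m g z := by
  unfold fockDensity
  rw [← add_mul]
  gcongr
  simpa using enorm_add_le (f z - g z) (g z)

/-! ### Pointwise estimates -/

/-- On this smaller scale the linear term of the expansion is bounded too, since `‖l‖ =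
O((1+‖z‖)^{m-1})`. -/
theorem exists_abs_rpow_norm_sub_le {m : ℝ} (hm : 0 < m) : ∃ K : ℝ, 0 < K ∧ ∀ z w : ℂ,
    ‖w - z‖ ≤ 1 / 4 * (1 + ‖z‖) ^ (1 - m) → |‖w‖ ^ m - ‖z‖ ^ m| ≤ K := by
  obtain ⟨K, hK, h⟩ := exists_weight_expansion hm
  refine ⟨2 * K, by positivity, fun z w hw => ?_⟩
  obtain ⟨l, hl, h'⟩ := h z
  have hle : (1 + ‖z‖) ^ (1 - m) ≤ (1 + ‖z‖) ^ (1 - m / 2) :=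
    Real.rpow_le_rpow_of_exponent_le (by linarith [norm_nonneg z]) (by linarith)
  have h1 := h' w (by linarith)
  have h2 : |(l * (w - z)).re| ≤ K := by
    calc |(l * (w - z)).re| ≤ ‖l‖ * ‖w - z‖ := by
          rw [← norm_mul]; exact Complex.abs_re_le_norm _
      _ ≤ K * (1 + ‖z‖) ^ (m - 1) * (1 / 4 * (1 + ‖z‖) ^ (1 - m)) := by gcongr
      _ = K * (1 / 4) * ((1 + ‖z‖) ^ (m - 1) * (1 + ‖z‖) ^ (1 - m)) := by ring
      _ = K * (1 / 4) := by
        rw [← Real.rpow_add (one_add_norm_pos z)]; simp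
      _ ≤ K := by linarith
  rw [abs_le] at *
  constructor <;> linarith [h1.1, h1.2, h2.1, h2.2]

/-- Sub-mean value property of `(|f| e^{-|z|^m})^p` up to the scale `(1 + |z|)^{1 - m/2}`. -/
theorem exists_fockDensity_rpow_le {m p : ℝ} (hm : 0 < m) (hp : 0 < p) : ∃ C : ℝ≥0, 0 < C ∧
    ∀ f : ℂ → ℂ, Differentiable ℂ f → ∀ (z : ℂ) (d : ℝ), 0 < d →
      d ≤ 1 / 4 * (1 + ‖z‖) ^ (1 - m / 2) →
      fockDensity m f z ^ p * ENNReal.ofReal (d ^ 2) ≤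
        C * ∫⁻ w in Metric.ball z d, fockDensity m f w ^ p := by
  obtain ⟨K, hK, h⟩ := exists_weight_expansion hm
  refine ⟨(Real.exp (K * p)).toNNReal, by simp [Real.exp_pos], fun f hf z d hd hdz => ?_⟩
  obtain ⟨l, -, hl⟩ := h z
  -- The exponential removes the linear part of the weight, so `|g| e^{-|z|^m}` is at most `e^K
  -- |f(w)| e^{-|w|^m}` on the ball, with `g z = f z`.
  set g : ℂ → ℂ := fun w => f w * Complex.exp (-(l * (w - z))) with hg
  have hgd : Differentiable ℂ g := by fun_prop
  have hA := enorm_rpow_mul_le_lintegral_ball hgd hp z hd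
  have hgz : g z = f z := by simp [hg]
  rw [hgz] at hA
  have hpt : ∀ w ∈ Metric.ball z d, ‖g w‖ₑ ^ p * ENNReal.ofReal (Real.exp (-‖z‖ ^ m)) ^ p ≤
      ENNReal.ofReal (Real.exp (K * p)) * fockDensity m f w ^ p := by
    intro w hw
    rw [Metric.mem_ball, dist_eq_norm] at hw
    have h1 := abs_le.1 (hl w (by linarith))
    rw [Real.exp_mul, ← ENNReal.ofReal_rpow_of_pos (Real.exp_pos _),
      ← ENNReal.mul_rpow_of_nonneg _ _ hp.le, ← ENNReal.mul_rpow_of_nonneg _ _ hp.le]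
    refine ENNReal.rpow_le_rpow ?_ hp.le
    rw [hg, enorm_mul, fockDensity, ← ofReal_norm (Complex.exp _), Complex.norm_exp, mul_assoc,
      mul_left_comm (ENNReal.ofReal (Real.exp K)), ← ENNReal.ofReal_mul (Real.exp_pos _).le,
      ← ENNReal.ofReal_mul (Real.exp_pos _).le, ← Real.exp_add, ← Real.exp_add]
    refine mul_le_mul' le_rfl (ENNReal.ofReal_le_ofReal (Real.exp_le_exp.2 ?_))
    rw [Complex.neg_re]
    linarith [h1.1, h1.2]
  calc fockDensity m f z ^ p * ENNReal.ofReal (d ^ 2)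
      ≤ (‖f z‖ₑ ^ p * ENNReal.ofReal (Real.pi * d ^ 2)) *
          ENNReal.ofReal (Real.exp (-‖z‖ ^ m)) ^ p := by
        rw [fockDensity, ENNReal.mul_rpow_of_nonneg _ _ hp.le, mul_right_comm]
        gcongr
        nlinarith [Real.pi_gt_three, sq_nonneg d]
    _ ≤ (∫⁻ w in Metric.ball z d, ‖g w‖ₑ ^ p) * ENNReal.ofReal (Real.exp (-‖z‖ ^ m)) ^ p := by
        gcongr
    _ = ∫⁻ w in Metric.ball z d, ‖g w‖ₑ ^ p * ENNReal.ofReal (Real.exp (-‖z‖ ^ m)) ^ p := by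
        rw [lintegral_mul_const']
        exact ENNReal.rpow_ne_top_of_nonneg hp.le ENNReal.ofReal_ne_top
    _ ≤ ∫⁻ w in Metric.ball z d, ENNReal.ofReal (Real.exp (K * p)) * fockDensity m f w ^ p :=
        setLIntegral_mono' measurableSet_ball hpt
    _ = _ := by rw [lintegral_const_mul' _ _ ENNReal.ofReal_ne_top]; rfl

/-- The largest admissible radius gives `d^2 = (1+‖z‖)^{2-m} / 16`. The integral stays local so
that, for a fixed function, the bound can be shown to tend to zero at infinity. -/
theorem exists_fockDensity_le {m p : ℝ} (hm : 0 < m) (hp : 0 < p) : ∃ C : ℝ≥0, 0 < C ∧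
    ∀ f : ℂ → ℂ, Differentiable ℂ f → ∀ z : ℂ,
      fockDensity m f z * polyWeight ((2 - m) / p) z ≤ C *
        (∫⁻ w in Metric.ball z (1 / 4 * (1 + ‖z‖) ^ (1 - m / 2)), fockDensity m f w ^ p) ^ (1 / p)
    := by
  obtain ⟨C, hC0, hC⟩ := exists_fockDensity_rpow_le hm hp
  refine ⟨(16 * C) ^ (1 / p), by positivity, fun f hf z => ?_⟩
  have hz := one_add_norm_pos z
  have h1 := hC f hf z (1 / 4 * (1 + ‖z‖) ^ (1 - m / 2)) (by positivity) le_rfl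
  have h2 : (1 / 4 * (1 + ‖z‖) ^ (1 - m / 2)) ^ 2 = 1 / 16 * (1 + ‖z‖) ^ (2 - m) := by
    rw [mul_pow, ← Real.rpow_natCast ((1 + ‖z‖) ^ _), ← Real.rpow_mul hz.le]
    norm_num; ring_nf
  rw [h2, ENNReal.ofReal_mul (by norm_num)] at h1
  have h3 : (fockDensity m f z * polyWeight ((2 - m) / p) z) ^ p ≤ (16 * C : ℝ≥0) *
      ∫⁻ w in Metric.ball z (1 / 4 * (1 + ‖z‖) ^ (1 - m / 2)), fockDensity m f w ^ p := by
    rw [ENNReal.mul_rpow_of_nonneg _ _ hp.le, polyWeight_rpow, div_mul_cancel₀ _ hp.ne']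
    have h16 : (16 : ℝ≥0∞) * ENNReal.ofReal (1 / 16) = 1 := by
      rw [show (16 : ℝ≥0∞) = ENNReal.ofReal 16 by simp, ← ENNReal.ofReal_mul (by norm_num)]
      norm_num
    calc fockDensity m f z ^ p * polyWeight (2 - m) z
        = 16 * (fockDensity m f z ^ p * (ENNReal.ofReal (1 / 16) * polyWeight (2 - m) z)) := by
          rw [← mul_assoc, ← mul_assoc, mul_right_comm 16, h16, one_mul]
      _ ≤ 16 * (C * ∫⁻ w in Metric.ball z (1 / 4 * (1 + ‖z‖) ^ (1 - m / 2)),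
          fockDensity m f w ^ p) := mul_le_mul' le_rfl h1
      _ = _ := by push_cast; ring
  have h4 := ENNReal.rpow_le_rpow h3 (by positivity : 0 ≤ 1 / p)
  rw [← ENNReal.rpow_mul, mul_one_div_cancel hp.ne', ENNReal.rpow_one,
    ENNReal.mul_rpow_of_nonneg _ _ (by positivity)] at h4
  rwa [ENNReal.coe_rpow_of_nonneg _ (by positivity)]

theorem exists_fockDensity_le_fockENorm {m p : ℝ} (hm : 0 < m) (hp : 0 < p) : ∃ C : ℝ≥0, 0 < C ∧
    ∀ f : ℂ → ℂ, Differentiable ℂ f → ∀ z : ℂ,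
      fockDensity m f z * polyWeight ((2 - m) / p) z ≤ C * fockENorm m p f := by
  obtain ⟨C, hC0, hC⟩ := exists_fockDensity_le hm hp
  refine ⟨C, hC0, fun f hf z => (hC f hf z).trans ?_⟩
  gcongr
  have : fockENorm m p f = (∫⁻ z, fockDensity m f z ^ p) ^ (1 / p) := by
    rw [← fockENorm_rpow m hp, ← ENNReal.rpow_mul, mul_one_div_cancel hp.ne', ENNReal.rpow_one]
  rw [this]
  gcongr
  exact Measure.restrict_le_self

theorem enorm_deriv_mul_le {f : ℂ → ℂ} (hf : Differentiable ℂ f) {z : ℂ} {R : ℝ} (hR : 0 < R)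
    {M : ℝ≥0∞} (hM : ∀ w ∈ Metric.sphere z R, ‖f w‖ₑ ≤ M) :
    ‖deriv f z‖ₑ * ENNReal.ofReal R ≤ M := by
  rcases eq_or_ne M ∞ with rfl | hMt
  · exact le_top
  have h1 := Complex.norm_deriv_le_of_forall_mem_sphere_norm_le (C := M.toReal) hR
    hf.diffContOnCl (fun w hw => by
      have := ENNReal.toReal_mono hMt (hM w hw)
      simpa using this)
  rw [le_div_iff₀ hR] at h1
  rw [← ofReal_norm, ← ENNReal.ofReal_mul (norm_nonneg _), ← ENNReal.ofReal_toReal hMt]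
  exact ENNReal.ofReal_le_ofReal h1

/-- With `r = (1+‖z‖)^{1-m}`: Cauchy's estimate on the circle of radius `r/8`, and the sub-mean
value inequality on discs of radius `r/8` about its points, all inside `B(z, r/4)`, where the weight
is nearly constant. The power `2(m-1)` is the reciprocal of the area, up to a constant. -/
theorem exists_fockDensity_deriv_rpow_le {m p : ℝ} (hm : 0 < m) (hp : 0 < p) : ∃ C : ℝ≥0,
    ∀ f : ℂ → ℂ, Differentiable ℂ f → ∀ z : ℂ,
      (fockDensity m (deriv f) z * polyWeight (1 - m) z) ^ p ≤ C * (polyWeight (2 * (m - 1)) z *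
        ∫⁻ w in Metric.ball z (1 / 4 * (1 + ‖z‖) ^ (1 - m)), fockDensity m f w ^ p) := by
  obtain ⟨K, hK, h⟩ := exists_abs_rpow_norm_sub_le hm
  refine ⟨(8 ^ p * 64 * Real.exp (K * p)).toNNReal, fun f hf z => ?_⟩
  have hz := one_add_norm_pos z
  set r := (1 + ‖z‖) ^ (1 - m) with hr
  have hr0 : 0 < r := by positivity
  set I := ∫⁻ w in Metric.ball z (1 / 4 * r), ‖f w‖ₑ ^ p with hI
  have h1 : ∀ w ∈ Metric.sphere z (r / 8), ‖f w‖ₑ ≤ (I / ENNReal.ofReal ((r / 8) ^ 2)) ^ (1 / p) := by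
    intro w hw
    have h2 := enorm_rpow_mul_le_lintegral_ball hf hp w (by positivity : 0 < r / 8)
    have h3 : ∫⁻ v in Metric.ball w (r / 8), ‖f v‖ₑ ^ p ≤ I := by
      refine lintegral_mono_set (Metric.ball_subset_ball' ?_)
      rw [Metric.mem_sphere.1 hw]; linarith
    rw [one_div, ENNReal.le_rpow_inv_iff hp, ENNReal.le_div_iff_mul_le (by left; positivity)
      (by left; exact ENNReal.ofReal_ne_top)]
    refine le_trans ?_ (h2.trans h3)
    gcongr
    nlinarith [Real.pi_gt_three, sq_nonneg (r / 8)]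
  have h2 := enorm_deriv_mul_le hf (by positivity) h1
  rw [one_div, ENNReal.le_rpow_inv_iff hp, ENNReal.le_div_iff_mul_le (by left; positivity)
      (by left; exact ENNReal.ofReal_ne_top)] at h2
  have h3 : I * ENNReal.ofReal (Real.exp (-‖z‖ ^ m)) ^ p ≤ ENNReal.ofReal (Real.exp (K * p)) *
      ∫⁻ w in Metric.ball z (1 / 4 * r), fockDensity m f w ^ p := by
    rw [hI, ← lintegral_mul_const' _ _
      (ENNReal.rpow_ne_top_of_nonneg hp.le ENNReal.ofReal_ne_top),
      ← lintegral_const_mul' _ _ ENNReal.ofReal_ne_top]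
    refine setLIntegral_mono' measurableSet_ball fun w hw => ?_
    rw [Metric.mem_ball, dist_eq_norm] at hw
    have h1 := abs_le.1 (h z w hw.le)
    rw [Real.exp_mul, ← ENNReal.ofReal_rpow_of_pos (Real.exp_pos _),
      ← ENNReal.mul_rpow_of_nonneg _ _ hp.le, ← ENNReal.mul_rpow_of_nonneg _ _ hp.le]
    refine ENNReal.rpow_le_rpow ?_ hp.le
    rw [fockDensity, mul_left_comm, ← ENNReal.ofReal_mul (Real.exp_pos _).le, ← Real.exp_add]
    gcongr
    linarith [h1.1, h1.2]
  have e1 : polyWeight (1 - m) z = 8 * ENNReal.ofReal (r / 8) := by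
    rw [show (8 : ℝ≥0∞) = ENNReal.ofReal 8 by simp, ← ENNReal.ofReal_mul (by norm_num),
      mul_div_cancel₀ _ (by norm_num)]
    rfl
  have e2 : 64 * polyWeight (2 * (m - 1)) z * ENNReal.ofReal ((r / 8) ^ 2) = 1 := by
    rw [show (64 : ℝ≥0∞) = ENNReal.ofReal 64 by simp, polyWeight,
      ← ENNReal.ofReal_mul (by norm_num), ← ENNReal.ofReal_mul (by positivity),
      div_pow, hr, ← Real.rpow_natCast ((1 + ‖z‖) ^ _), ← Real.rpow_mul hz.le]
    rw [show 64 * (1 + ‖z‖) ^ (2 * (m - 1)) * ((1 + ‖z‖) ^ ((1 - m) * (2 : ℕ)) / 8 ^ 2)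
      = (1 + ‖z‖) ^ (2 * (m - 1)) * (1 + ‖z‖) ^ ((1 - m) * (2 : ℕ)) by ring,
      ← Real.rpow_add hz]
    norm_num; ring_nf; simp
  have e3 : (((8 ^ p * 64 * Real.exp (K * p)).toNNReal : ℝ≥0) : ℝ≥0∞) =
      8 ^ p * 64 * ENNReal.ofReal (Real.exp (K * p)) := by
    change ENNReal.ofReal _ = _
    rw [ENNReal.ofReal_mul (by positivity), ENNReal.ofReal_mul (by positivity),
      ← ENNReal.ofReal_rpow_of_pos (by norm_num)]
    simp
  rw [e1, e3]
  set E := ENNReal.ofReal (Real.exp (-‖z‖ ^ m)) with hE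
  set P := polyWeight (2 * (m - 1)) z
  calc (fockDensity m (deriv f) z * (8 * ENNReal.ofReal (r / 8))) ^ p
      = (fockDensity m (deriv f) z * (8 * ENNReal.ofReal (r / 8))) ^ p *
        (64 * P * ENNReal.ofReal ((r / 8) ^ 2)) := by rw [e2, mul_one]
    _ = 8 ^ p * 64 * P * (((‖deriv f z‖ₑ * ENNReal.ofReal (r / 8)) ^ p *
          ENNReal.ofReal ((r / 8) ^ 2)) * E ^ p) := by
        rw [fockDensity]
        simp only [ENNReal.mul_rpow_of_nonneg _ _ hp.le]
        ring
    _ ≤ 8 ^ p * 64 * P * (I * E ^ p) := by gcongr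
    _ ≤ 8 ^ p * 64 * P * (ENNReal.ofReal (Real.exp (K * p)) *
      ∫⁻ w in Metric.ball z (1 / 4 * r), fockDensity m f w ^ p) := by gcongr
    _ = _ := by ring

/-- Cauchy's estimate at radius `(1+‖z‖)^{1-m} / 4`, with the pointwise bound for `f` on the circle;
both weights vary there by bounded factors. -/
theorem exists_fockDensity_deriv_le {m p : ℝ} (hm : 0 < m) (hp : 0 < p) : ∃ C : ℝ≥0,
    ∀ f : ℂ → ℂ, Differentiable ℂ f → ∀ z : ℂ,
      fockDensity m (deriv f) z ≤
        C * polyWeight ((m - 1) + (m - 2) / p) z * fockENorm m p f := by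
  obtain ⟨K, hK, h⟩ := exists_abs_rpow_norm_sub_le hm
  obtain ⟨C, hC0, hC⟩ := exists_fockDensity_le_fockENorm hm hp
  refine ⟨4 * C * (Real.exp K).toNNReal * ((2 : ℝ) ^ |(m - 2) / p|).toNNReal, fun f hf z => ?_⟩
  have hz := one_add_norm_pos z
  set r := (1 + ‖z‖) ^ (1 - m) with hr
  have hr0 : 0 < r := by positivity
  set E := ENNReal.ofReal (Real.exp (-‖z‖ ^ m)) with hE
  have hE0 : E ≠ 0 := (ENNReal.ofReal_pos.2 (Real.exp_pos _)).ne'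
  have hEt : E ≠ ∞ := ENNReal.ofReal_ne_top
  set N := fockENorm m p f
  set B : ℝ≥0∞ := C * ENNReal.ofReal (Real.exp K) * ENNReal.ofReal (2 ^ |(m - 2) / p|) *
    polyWeight ((m - 2) / p) z * N with hB
  have h1 : ∀ w ∈ Metric.sphere z (1 / 4 * r), ‖f w‖ₑ ≤ B / E := by
    intro w hw
    rw [Metric.mem_sphere, dist_eq_norm] at hw
    rw [ENNReal.le_div_iff_mul_le (Or.inl hE0) (Or.inl hEt)]
    have h2 := abs_le.1 (h z w hw.le)
    have h3 : E ≤ ENNReal.ofReal (Real.exp K) * ENNReal.ofReal (Real.exp (-‖w‖ ^ m)) := by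
      rw [hE, ← ENNReal.ofReal_mul (Real.exp_pos _).le, ← Real.exp_add]
      gcongr
      linarith [h2.1, h2.2]
    have h4 : fockDensity m f w ≤ C * N * polyWeight ((m - 2) / p) w := by
      have h5 := hC f hf w
      calc fockDensity m f w = fockDensity m f w * polyWeight ((2 - m) / p) w *
            polyWeight (-((2 - m) / p)) w := by rw [mul_assoc, polyWeight_mul_neg, mul_one]
        _ ≤ C * N * polyWeight (-((2 - m) / p)) w := by gcongr
        _ = _ := by rw [← neg_div, neg_sub]
    have h6 := (polyWeight_le_of_near (z := z) (w := w)
      (by rw [hw]; gcongr; exact one_add_norm_rpow_le (by linarith) z) ((m - 2) / p)).1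
    calc ‖f w‖ₑ * E ≤ ‖f w‖ₑ * (ENNReal.ofReal (Real.exp K) *
          ENNReal.ofReal (Real.exp (-‖w‖ ^ m))) := by gcongr
      _ = ENNReal.ofReal (Real.exp K) * fockDensity m f w := by rw [fockDensity]; ring
      _ ≤ ENNReal.ofReal (Real.exp K) * (C * N * (ENNReal.ofReal (2 ^ |(m - 2) / p|) *
          polyWeight ((m - 2) / p) z)) := by
          gcongr
          exact h4.trans (by gcongr)
      _ = B := by rw [hB]; ring
  have h2 := enorm_deriv_mul_le hf (by positivity) h1
  rw [ENNReal.le_div_iff_mul_le (Or.inl hE0) (Or.inl hEt)] at h2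
  have e1 : 4 * polyWeight (m - 1) z * ENNReal.ofReal (1 / 4 * r) = 1 := by
    rw [show (4 : ℝ≥0∞) = ENNReal.ofReal 4 by simp, polyWeight,
      ← ENNReal.ofReal_mul (by norm_num), ← ENNReal.ofReal_mul (by positivity), hr,
      show 4 * (1 + ‖z‖) ^ (m - 1) * (1 / 4 * (1 + ‖z‖) ^ (1 - m))
        = (1 + ‖z‖) ^ (m - 1) * (1 + ‖z‖) ^ (1 - m) by ring, ← Real.rpow_add hz]
    simp
  calc fockDensity m (deriv f) z
      = fockDensity m (deriv f) z * (4 * polyWeight (m - 1) z * ENNReal.ofReal (1 / 4 * r)) := by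
        rw [e1, mul_one]
    _ = 4 * polyWeight (m - 1) z * (‖deriv f z‖ₑ * ENNReal.ofReal (1 / 4 * r) * E) := by
        rw [fockDensity]; ring
    _ ≤ 4 * polyWeight (m - 1) z * B := by gcongr
    _ = _ := by
      rw [hB, polyWeight_add]
      push_cast
      simp only [ENNReal.ofReal]
      ring

/-! ### Integrated estimates -/

/-- Averaging over the balls `B(z, (1 + |z|)^s / 4)` is bounded on `L¹`. -/
theorem exists_lintegral_average_le {s : ℝ} (hs : s ≤ 1) : ∃ C : ℝ≥0, ∀ G : ℂ → ℝ≥0∞,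
    Measurable G → ∫⁻ z, polyWeight (-2 * s) z *
      ∫⁻ w in Metric.ball z (1 / 4 * (1 + ‖z‖) ^ s), G w ≤ C * ∫⁻ w, G w := by
  refine ⟨(2 ^ |-2 * s| * ((2 ^ |s|) ^ 2 * Real.pi)).toNNReal, fun G hG => ?_⟩
  set S : Set (ℂ × ℂ) := {x | dist x.2 x.1 < 1 / 4 * (1 + ‖x.1‖) ^ s} with hS
  have hSm : MeasurableSet S := by
    refine measurableSet_lt (by fun_prop) (by fun_prop)
  have h1 : ∀ z, polyWeight (-2 * s) z * ∫⁻ w in Metric.ball z (1 / 4 * (1 + ‖z‖) ^ s), G w =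
      ∫⁻ w, S.indicator (fun x => polyWeight (-2 * s) x.1 * G x.2) (z, w) := by
    intro z
    rw [← lintegral_const_mul' _ _ (polyWeight_ne_top _ _), ← lintegral_indicator measurableSet_ball]
    rfl
  simp_rw [h1]
  rw [lintegral_lintegral_swap]
  · rw [← lintegral_const_mul' _ _ ENNReal.coe_ne_top]
    refine lintegral_mono fun w => ?_
    -- After Tonelli: nearness is symmetric up to constants because `s ≤ 1`, so the `z`-integral is
    -- at most the area of a ball about `w` times `(1+‖w‖)^{-2s}`, a constant.
    have h2 : ∀ z, S.indicator (fun x : ℂ × ℂ => polyWeight (-2 * s) x.1 * G x.2) (z, w) ≤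
        (Metric.ball w (2 ^ |s| * (1 + ‖w‖) ^ s)).indicator
          (fun _ => ENNReal.ofReal (2 ^ |-2 * s|) * polyWeight (-2 * s) w * G w) z := by
      intro z
      by_cases hz : (z, w) ∈ S
      · have hd : ‖w - z‖ < 1 / 4 * (1 + ‖z‖) ^ s := by
          rw [← dist_eq_norm]; exact hz
        have hd1 : ‖w - z‖ ≤ 1 / 4 * (1 + ‖z‖) :=
          hd.le.trans (by gcongr; exact one_add_norm_rpow_le hs z)
        have h4 : ‖z‖ ≤ ‖w - z‖ + ‖w‖ := by simpa [add_comm] using norm_sub_le w (w - z)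
        have h5 : ‖w‖ ≤ ‖w - z‖ + ‖z‖ := by simpa using norm_add_le (w - z) z
        have h3 : z ∈ Metric.ball w (2 ^ |s| * (1 + ‖w‖) ^ s) := by
          rw [Metric.mem_ball, dist_comm, dist_eq_norm]
          have h6 : (1 + ‖z‖) ^ s ≤ 2 ^ |s| * (1 + ‖w‖) ^ s :=
            rpow_le_rpow_abs_mul two_pos (one_add_norm_pos z) (by linarith [norm_nonneg z, norm_nonneg w])
              (by linarith [norm_nonneg z, norm_nonneg w]) s
          have h7 : 0 < (1 + ‖z‖) ^ s := Real.rpow_pos_of_pos (one_add_norm_pos z) _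
          linarith
        rw [Set.indicator_of_mem hz, Set.indicator_of_mem h3]
        gcongr
        exact (polyWeight_le_of_near hd1 _).2
      · rw [Set.indicator_of_notMem hz]; exact zero_le
    refine (lintegral_mono h2).trans ?_
    rw [lintegral_indicator_const measurableSet_ball, Complex.volume_ball]
    have hw := one_add_norm_pos w
    have e1 : polyWeight (-2 * s) w * ENNReal.ofReal (2 ^ |s| * (1 + ‖w‖) ^ s) ^ 2
        = ENNReal.ofReal ((2 ^ |s|) ^ 2) := by
      rw [← ENNReal.ofReal_pow (by positivity), polyWeight, ← ENNReal.ofReal_mul (by positivity),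
        mul_pow, ← Real.rpow_natCast ((1 + ‖w‖) ^ s), ← Real.rpow_mul hw.le, mul_left_comm,
        ← Real.rpow_add hw]
      congr 1
      rw [show -2 * s + s * (2 : ℕ) = 0 by push_cast; ring, Real.rpow_zero, mul_one]
    have e2 : ((2 ^ |-2 * s| * ((2 ^ |s|) ^ 2 * Real.pi)).toNNReal : ℝ≥0∞) =
        ENNReal.ofReal (2 ^ |-2 * s|) * (ENNReal.ofReal ((2 ^ |s|) ^ 2) * NNReal.pi) := by
      change ENNReal.ofReal _ = _
      rw [ENNReal.ofReal_mul (by positivity), ENNReal.ofReal_mul (by positivity)]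
      congr 2
      rw [← NNReal.coe_real_pi, ENNReal.ofReal_coe_nnreal]
    rw [e2, ← e1]
    apply le_of_eq; ring
  · refine ((Measurable.mul ?_ (hG.comp measurable_snd)).indicator hSm).aemeasurable
    exact (measurable_polyWeight _).comp measurable_fst

/-- The local Cauchy bound is averaged with `s = 1 - m`. This estimate drives both ranges of
exponents. -/
theorem exists_lintegral_fockDensity_deriv_le {m p : ℝ} (hm : 0 < m) (hp : 0 < p) :
    ∃ C : ℝ≥0, ∀ f : ℂ → ℂ, Differentiable ℂ f →
      ∫⁻ z, (fockDensity m (deriv f) z * polyWeight (1 - m) z) ^ p ≤ C * fockENorm m p f ^ p := by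
  obtain ⟨C, hC⟩ := exists_fockDensity_deriv_rpow_le hm hp
  obtain ⟨C', hC'⟩ := exists_lintegral_average_le (s := 1 - m) (by linarith)
  refine ⟨C * C', fun f hf => ?_⟩
  rw [fockENorm_rpow m hp]
  refine (lintegral_mono (hC f hf)).trans ?_
  rw [lintegral_const_mul' _ _ ENNReal.coe_ne_top]
  have := hC' _ ((measurable_fockDensity m hf.continuous).pow_const p)
  rw [show -2 * (1 - m) = 2 * (m - 1) by ring] at this
  rw [ENNReal.coe_mul, mul_assoc]
  gcongr

/-- The mass of `f'` in `F_(m,q)` off the disc of radius `R` is at most `O((1+R)^κ)` times the norm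
of `f` in `F_(m,p)`. -/
def DerivTailBound (m p q k : ℝ) : Prop :=
  ∃ C : ℝ≥0, ∀ f : ℂ → ℂ, Differentiable ℂ f → ∀ R : ℝ, 0 ≤ R →
    ∫⁻ z in {z : ℂ | R ≤ ‖z‖}, fockDensity m (deriv f) z ^ q ≤
      C * ENNReal.ofReal ((1 + R) ^ k) * fockENorm m p f ^ q

theorem measurableSet_le_norm (R : ℝ) : MeasurableSet {z : ℂ | R ≤ ‖z‖} :=
  measurableSet_le measurable_const measurable_norm

/-- Split `u^q = u^p u^(q-p)` with `u` the weighted modulus of `f'`: the first factor goes to the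
weighted `L^p` estimate, the second to the pointwise one. The leftover power of `1+‖z‖` is
nonpositive, hence largest at `‖z‖ = R`. -/
theorem derivTailBound_of_le {m p q : ℝ} (hm : 0 < m) (hp : 0 < p) (hpq : p ≤ q)
    (hk : (m - 1) + (q - p) * (m - 2) / (q * p) ≤ 0) :
    DerivTailBound m p q (q * ((m - 1) + (q - p) * (m - 2) / (q * p))) := by
  obtain ⟨C, hC⟩ := exists_lintegral_fockDensity_deriv_le hm hp
  obtain ⟨C', hC'⟩ := exists_fockDensity_deriv_le hm hp
  have hq : 0 < q := hp.trans_le hpq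
  set k := (m - 1) + (q - p) * (m - 2) / (q * p) with hkdef
  refine ⟨C * C' ^ (q - p), fun f hf R hR => ?_⟩
  set N := fockENorm m p f with hN
  have hpt : ∀ z ∈ {z : ℂ | R ≤ ‖z‖}, fockDensity m (deriv f) z ^ q ≤
      (C' : ℝ≥0∞) ^ (q - p) * N ^ (q - p) * ENNReal.ofReal ((1 + R) ^ (q * k)) *
        (fockDensity m (deriv f) z * polyWeight (1 - m) z) ^ p := by
    intro z hz
    set u := fockDensity m (deriv f) z
    have e1 : u ^ q = u ^ p * u ^ (q - p) := by
      rw [← ENNReal.rpow_add_of_nonneg _ _ hp.le (by linarith)]; congr 1; ring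
    have e2 : u ^ p = (u * polyWeight (1 - m) z) ^ p * polyWeight (p * (m - 1)) z := by
      rw [ENNReal.mul_rpow_of_nonneg _ _ hp.le, polyWeight_rpow, mul_assoc, ← polyWeight_add,
        show (1 - m) * p + p * (m - 1) = 0 by ring, polyWeight_zero, mul_one]
    have e3 : u ^ (q - p) ≤ (C' : ℝ≥0∞) ^ (q - p) *
        polyWeight (((m - 1) + (m - 2) / p) * (q - p)) z * N ^ (q - p) := by
      have := ENNReal.rpow_le_rpow (hC' f hf z) (by linarith : 0 ≤ q - p)
      rwa [ENNReal.mul_rpow_of_nonneg _ _ (by linarith),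
        ENNReal.mul_rpow_of_nonneg _ _ (by linarith), polyWeight_rpow] at this
    have e4 : polyWeight (p * (m - 1)) z * polyWeight (((m - 1) + (m - 2) / p) * (q - p)) z
        ≤ ENNReal.ofReal ((1 + R) ^ (q * k)) := by
      rw [← polyWeight_add, show p * (m - 1) + ((m - 1) + (m - 2) / p) * (q - p) = q * k by
        rw [hkdef]; field_simp; ring]
      exact polyWeight_le_of_nonpos (mul_nonpos_of_nonneg_of_nonpos hq.le hk) hR hz
    rw [e1, e2]
    calc _ ≤ (u * polyWeight (1 - m) z) ^ p * polyWeight (p * (m - 1)) z * ((C' : ℝ≥0∞) ^ (q - p) *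
        polyWeight (((m - 1) + (m - 2) / p) * (q - p)) z * N ^ (q - p)) := by gcongr
      _ = (C' : ℝ≥0∞) ^ (q - p) * N ^ (q - p) * (polyWeight (p * (m - 1)) z *
          polyWeight (((m - 1) + (m - 2) / p) * (q - p)) z) * (u * polyWeight (1 - m) z) ^ p := by
          ring
      _ ≤ _ := by gcongr
  refine (setLIntegral_mono' (measurableSet_le_norm R) hpt).trans ?_
  rw [lintegral_const_mul]
  · calc _ ≤ (C' : ℝ≥0∞) ^ (q - p) * N ^ (q - p) * ENNReal.ofReal ((1 + R) ^ (q * k)) *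
          (C * N ^ p) := by
          gcongr
          exact (setLIntegral_le_lintegral _ _).trans (hC f hf)
      _ = C * (C' : ℝ≥0∞) ^ (q - p) * ENNReal.ofReal ((1 + R) ^ (q * k)) *
          (N ^ (q - p) * N ^ p) := by ring
      _ = _ := by
        rw [← ENNReal.rpow_add_of_nonneg _ _ (by linarith) hp.le, sub_add_cancel, ENNReal.coe_mul,
          ENNReal.coe_rpow_of_nonneg _ (by linarith)]
  · exact ((measurable_fockDensity m (differentiable_deriv_of_entire hf).continuous).mul
      (measurable_polyWeight _)).pow_const _

theorem lintegral_polyWeight_lt_top {a : ℝ} (ha : a < -2) : ∫⁻ z, polyWeight a z < ∞ := by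
  have := finite_integral_one_add_norm (E := ℂ) (μ := volume) (r := -a)
    (by rw [Complex.finrank_real_complex]; push_cast; linarith)
  simpa [polyWeight] using this

/-- Hölder with exponents `p/q` and `t = p/(p-q)`. The condition on `m` says exactly that
`(1+‖z‖)^{q(m-1)t}` is integrable on the plane. -/
theorem derivTailBound_of_lt {m p q : ℝ} (hm : 0 < m) (hq : 0 < q) (hqp : q < p)
    (h : m < 1 - 2 * (1 / q - 1 / p)) : ∃ k < 0, DerivTailBound m p q k := by
  have hp : 0 < p := hq.trans hqp
  obtain ⟨C, hC⟩ := exists_lintegral_fockDensity_deriv_le hm hp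
  have hpq : 0 < p - q := by linarith
  set t := p / (p - q) with ht
  have ht0 : 0 < t := by positivity
  have hexp : q * (m - 1) * t < -2 := by
    have h1 : m - 1 < -(2 * (p - q) / (q * p)) := by
      have : 2 * (p - q) / (q * p) = 2 * (1 / q - 1 / p) := by field_simp
      rw [this]; linarith
    have h2 : q * t * (m - 1) < q * t * (-(2 * (p - q) / (q * p))) := by gcongr
    have h3 : q * t * (-(2 * (p - q) / (q * p))) = -2 := by rw [ht]; field_simp
    linarith
  set e := (-2 - q * (m - 1) * t) / 2 with he
  have he0 : 0 < e := by rw [he]; linarith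
  have hconj : (p / q).HolderConjugate t := by
    rw [Real.holderConjugate_iff]
    refine ⟨by rw [lt_div_iff₀ hq]; linarith, ?_⟩
    rw [ht, inv_div, inv_div]; field_simp; ring
  set A := ∫⁻ z, polyWeight (q * (m - 1) * t + e) z with hA
  have hAt : A ≠ ∞ := (lintegral_polyWeight_lt_top (by rw [he]; linarith)).ne
  refine ⟨-e * (1 / t), by rw [neg_mul]; exact neg_neg_of_pos (by positivity),
    C ^ (q / p) * A.toNNReal ^ (1 / t), fun f hf R hR => ?_⟩
  have hmeas : Measurable fun z => fockDensity m (deriv f) z * polyWeight (1 - m) z :=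
    (measurable_fockDensity m (differentiable_deriv_of_entire hf).continuous).mul
      (measurable_polyWeight _)
  have h1 : ∀ z, fockDensity m (deriv f) z ^ q =
      (fockDensity m (deriv f) z * polyWeight (1 - m) z) ^ q * polyWeight (q * (m - 1)) z := by
    intro z
    rw [ENNReal.mul_rpow_of_nonneg _ _ hq.le, polyWeight_rpow, mul_assoc, ← polyWeight_add,
        show (1 - m) * q + q * (m - 1) = 0 by ring, polyWeight_zero, mul_one]
  simp_rw [h1]
  have h2 := ENNReal.lintegral_mul_le_Lp_mul_Lq (volume.restrict {z : ℂ | R ≤ ‖z‖}) hconj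
    (hmeas.pow_const q).aemeasurable (measurable_polyWeight (q * (m - 1))).aemeasurable
  refine h2.trans ?_
  have h3 : (∫⁻ z in {z : ℂ | R ≤ ‖z‖}, ((fockDensity m (deriv f) z *
      polyWeight (1 - m) z) ^ q) ^ (p / q)) ≤ C * fockENorm m p f ^ p := by
    refine (setLIntegral_le_lintegral _ _).trans (le_trans (le_of_eq ?_) (hC f hf))
    refine lintegral_congr fun z => ?_
    rw [← ENNReal.rpow_mul, mul_div_cancel₀ _ hq.ne']
  have h4 : (∫⁻ z in {z : ℂ | R ≤ ‖z‖}, polyWeight (q * (m - 1)) z ^ t) ≤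
      ENNReal.ofReal ((1 + R) ^ (-e)) * A := by
    calc _ ≤ ∫⁻ z in {z : ℂ | R ≤ ‖z‖}, ENNReal.ofReal ((1 + R) ^ (-e)) *
          polyWeight (q * (m - 1) * t + e) z := by
          refine setLIntegral_mono' (measurableSet_le_norm R) fun z hz => ?_
          rw [polyWeight_rpow, show q * (m - 1) * t = -e + (q * (m - 1) * t + e) by ring,
            polyWeight_add, show -e + (q * (m - 1) * t + e) + e = q * (m - 1) * t + e by ring]
          gcongr
          exact polyWeight_le_of_nonpos (by linarith) hR hz
      _ ≤ _ := by
          rw [lintegral_const_mul' _ _ ENNReal.ofReal_ne_top]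
          gcongr
          exact setLIntegral_le_lintegral _ _
  calc _ ≤ (C * fockENorm m p f ^ p) ^ (1 / (p / q)) *
        (ENNReal.ofReal ((1 + R) ^ (-e)) * A) ^ (1 / t) := by gcongr
    _ = _ := by
      rw [ENNReal.mul_rpow_of_nonneg _ _ (by positivity),
        ENNReal.mul_rpow_of_nonneg _ _ (by positivity), ← ENNReal.rpow_mul, one_div_div,
        mul_div_cancel₀ _ hp.ne', ENNReal.ofReal_rpow_of_pos (by positivity),
        ← Real.rpow_mul (by positivity), ENNReal.coe_mul,
        ENNReal.coe_rpow_of_nonneg _ (by positivity), ENNReal.coe_rpow_of_nonneg _ (by positivity),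
        ENNReal.coe_toNNReal hAt]
      ring

/-! ### Normal families -/

open Filter Topology in
/-- **Montel's theorem** for sequences of entire functions. -/
theorem exists_subseq_tendstoLocallyUniformly {f : ℕ → ℂ → ℂ} (hf : ∀ n, Differentiable ℂ (f n))
    (hb : ∀ R : ℝ, 0 < R → ∃ M : ℝ, ∀ n z, ‖z‖ ≤ R → ‖f n z‖ ≤ M) :
    ∃ (φ : ℕ → ℕ) (g : ℂ → ℂ), StrictMono φ ∧ Differentiable ℂ g ∧
      TendstoLocallyUniformly (fun n => f (φ n)) g atTop := by
  choose! M hM using hb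
  set a : ℕ → ℕ → ℂ := fun n k => ((k.factorial : ℂ)⁻¹) * iteratedDeriv k (f n) 0 with ha
  have hacoef : ∀ R, 0 < R → ∀ n k, ‖a n k‖ ≤ M R / R ^ k := by
    intro R hR n k
    have h1 := Complex.norm_iteratedDeriv_le_of_forall_mem_sphere_norm_le (c := 0) (C := M R) k hR
      ((hf n).diffContOnCl) (fun z hz => hM R hR n z (by simpa using hz.le))
    have hk : (0 : ℝ) < k.factorial := by exact_mod_cast k.factorial_pos
    rw [ha]
    simp only [norm_mul, norm_inv, Complex.norm_natCast]
    rw [inv_mul_le_iff₀ hk]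
    calc _ ≤ _ := h1
      _ = _ := by ring
  -- Tychonoff replaces the diagonal argument: a subsequence makes every Taylor coefficient
  -- converge.
  have hcomp : IsCompact (Set.univ.pi fun k : ℕ => Metric.closedBall (0 : ℂ) (M 1)) :=
    isCompact_univ_pi fun k => isCompact_closedBall _ _
  obtain ⟨b, -, φ, hφ, hlim⟩ := hcomp.tendsto_subseq (x := a) (fun n k _ => by
    simpa using hacoef 1 one_pos n k)
  rw [tendsto_pi_nhds] at hlim
  have hbcoef : ∀ R, 0 < R → ∀ k, ‖b k‖ ≤ M R / R ^ k := fun R hR k =>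
    le_of_tendsto (hlim k).norm (Eventually.of_forall fun n => hacoef R hR (φ n) k)
  have hsum : ∀ n z, HasSum (fun k => a n k * z ^ k) (f n z) := by
    intro n z
    have := Complex.hasSum_taylorSeries_of_entire (hf n) 0 z
    simp only [sub_zero, smul_eq_mul] at this
    convert! this using 2 with k
    rw [ha]; ring
  have hgeo : ∀ R : ℝ, 0 < R → Summable fun k : ℕ => 2 * M (2 * R) * (1 / 2 : ℝ) ^ k := fun R _ =>
    (summable_geometric_of_lt_one (by norm_num) (by norm_num)).mul_left _
  have hterm : ∀ R : ℝ, 0 < R → ∀ k, M (2 * R) / (2 * R) ^ k * R ^ k = M (2 * R) * (1 / 2) ^ k := by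
    intro R hR k
    rw [mul_pow, one_div, inv_pow]; field_simp
  have hM0 : ∀ R : ℝ, 0 < R → 0 ≤ M R := fun R hR => 
    (norm_nonneg _).trans (hM R hR 0 0 (by simpa using hR.le))
  have hdiff : ∀ R : ℝ, 0 < R → ∀ n k, ‖a (φ n) k - b k‖ * R ^ k ≤ 2 * M (2 * R) * (1 / 2) ^ k := by
    intro R hR n k
    calc ‖a (φ n) k - b k‖ * R ^ k ≤ (M (2 * R) / (2 * R) ^ k + M (2 * R) / (2 * R) ^ k) * R ^ k := by
          gcongr
          exact (norm_sub_le _ _).trans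
            (add_le_add (hacoef _ (by positivity) _ _) (hbcoef _ (by positivity) _))
      _ = _ := by rw [add_mul, hterm R hR]; ring
  have hbsum : ∀ z, Summable fun k => b k * z ^ k := by
    intro z
    have hR : 0 < ‖z‖ + 1 := by positivity
    refine Summable.of_norm_bounded (hgeo (‖z‖ + 1) hR) fun k => ?_
    rw [norm_mul, norm_pow]
    calc ‖b k‖ * ‖z‖ ^ k ≤ M (2 * (‖z‖ + 1)) / (2 * (‖z‖ + 1)) ^ k * (‖z‖ + 1) ^ k := by
          gcongr
          · exact div_nonneg (hM0 _ (by positivity)) (by positivity)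
          · exact hbcoef _ (by positivity) _
          · linarith
      _ = M (2 * (‖z‖ + 1)) * (1 / 2) ^ k := hterm _ hR k
      _ ≤ _ := by
        have := hM0 (2 * (‖z‖ + 1)) (by positivity)
        gcongr
        linarith
  set g : ℂ → ℂ := fun z => ∑' k, b k * z ^ k with hg
  have hloc : TendstoLocallyUniformlyOn (fun n => f (φ n)) g atTop Set.univ := by
    rw [tendstoLocallyUniformlyOn_iff_forall_isCompact isOpen_univ]
    intro K _ hK
    obtain ⟨R', hR'⟩ := hK.isBounded.exists_norm_le
    set R := max R' 1
    have hR : 0 < R := lt_max_of_lt_right one_pos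
    -- Cauchy's estimates at radius `2R` supply a geometric majorant, so coefficientwise convergence
    -- becomes uniform on the disc of radius `R`.
    have hlim0 : Tendsto (fun n => ∑' k, ‖a (φ n) k - b k‖ * R ^ k) atTop (𝓝 0) := by
      have := tendsto_tsum_of_dominated_convergence (𝓕 := atTop)
        (f := fun n k => ‖a (φ n) k - b k‖ * R ^ k) (g := fun _ => (0 : ℝ)) (hgeo R hR)
        (fun k => by
          have h1 : Tendsto (fun n => ‖a (φ n) k - b k‖) atTop (𝓝 0) := by
            have := ((hlim k).sub_const (b k)).norm
            simpa using this
          simpa using h1.mul_const (R ^ k))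
        (Eventually.of_forall fun n k => by
          rw [Real.norm_of_nonneg (by positivity)]; exact hdiff R hR n k)
      simpa using this
    rw [Metric.tendstoUniformlyOn_iff]
    intro e he
    filter_upwards [hlim0.eventually_lt_const he] with n hn z hz
    have hzR : ‖z‖ ≤ R := (hR' z hz).trans (le_max_left _ _)
    have hs : Summable fun k => ‖a (φ n) k - b k‖ * R ^ k :=
      Summable.of_nonneg_of_le (fun k => by positivity) (hdiff R hR n) (hgeo R hR)
    rw [dist_comm, dist_eq_norm]
    refine lt_of_le_of_lt ?_ hn
    have h1 : HasSum (fun k => a (φ n) k * z ^ k - b k * z ^ k) (f (φ n) z - g z) :=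
      (hsum (φ n) z).sub (hbsum z).hasSum
    rw [← h1.tsum_eq]
    refine tsum_of_norm_bounded hs.hasSum fun k => ?_
    rw [← sub_mul, norm_mul, norm_pow]
    gcongr
  refine ⟨φ, g, hφ, ?_, tendstoLocallyUniformlyOn_univ.1 hloc⟩
  rw [← differentiableOn_univ]
  exact hloc.differentiableOn (Eventually.of_forall fun n => (hf _).differentiableOn) isOpen_univ

theorem ENNReal.le_one_of_rpow_le_one {x : ℝ≥0∞} {s : ℝ} (hs : 0 < s) (h : x ^ s ≤ 1) : x ≤ 1 := by
  rwa [← ENNReal.rpow_le_rpow_iff hs, ENNReal.one_rpow]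

/-! ### Boundedness and compactness from tail bounds -/

open Filter Topology in
theorem FockSpace.tendsto_iff {m p : ℝ} {hp : 0 < p} {ι : Type*} {l : Filter ι}
    {F : ι → FockSpace m p hp} {g : FockSpace m p hp} :
    Tendsto F l (𝓝 g) ↔ Tendsto (fun i => fockENorm m p (⇑(F i) - ⇑g)) l (𝓝 0) := by
  have h0 : 0 < min 1 p := lt_min one_pos hp
  rw [tendsto_iff_dist_tendsto_zero]
  change Tendsto (fun i => (fockENorm m p (⇑(F i) - ⇑g) ^ min 1 p).toReal) l (𝓝 0) ↔ _
  constructor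
  · intro h
    have h1 := (ENNReal.continuous_rpow_const (y := (min 1 p)⁻¹)).tendsto _ |>.comp
      ((ENNReal.continuous_ofReal.tendsto _).comp h)
    simp only [ENNReal.ofReal_zero, ENNReal.zero_rpow_of_pos (inv_pos.2 h0)] at h1
    refine h1.congr fun i => ?_
    simp only [Function.comp]
    rw [ENNReal.ofReal_toReal (FockSpace.dist_aux_ne_top _ _), ← ENNReal.rpow_mul,
      mul_inv_cancel₀ h0.ne', ENNReal.rpow_one]
  · intro h
    have h1 := ((ENNReal.continuous_rpow_const (y := min 1 p)).tendsto _).comp h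
    rw [ENNReal.zero_rpow_of_pos h0] at h1
    have h2 := (ENNReal.tendsto_toReal ENNReal.zero_ne_top).comp h1
    rwa [ENNReal.toReal_zero] at h2

/-- The tail beyond `R = 0` is the whole plane, where the factor `(1+R)^k` equals one. -/
theorem DerivTailBound.exists_fockENorm_deriv_le {m p q k : ℝ} (hq : 0 < q)
    (h : DerivTailBound m p q k) : ∃ C : ℝ≥0, ∀ f : ℂ → ℂ, Differentiable ℂ f →
      fockENorm m q (deriv f) ≤ C * fockENorm m p f := by
  obtain ⟨C, hC⟩ := h
  refine ⟨C ^ (1 / q), fun f hf => ?_⟩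
  have h1 := hC f hf 0 le_rfl
  have h2 : {z : ℂ | (0 : ℝ) ≤ ‖z‖} = Set.univ := by ext z; simp
  rw [h2, setLIntegral_univ, add_zero, Real.one_rpow, ENNReal.ofReal_one, mul_one,
    ← fockENorm_rpow m hq] at h1
  have h3 := ENNReal.rpow_le_rpow h1 (by positivity : 0 ≤ 1 / q)
  rwa [ENNReal.mul_rpow_of_nonneg _ _ (by positivity), ← ENNReal.rpow_mul, ← ENNReal.rpow_mul,
    mul_one_div_cancel hq.ne', ENNReal.rpow_one, ENNReal.rpow_one,
    ← ENNReal.coe_rpow_of_nonneg _ (by positivity)] at h3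

/-- Differentiation as a linear map between Fock spaces. -/
noncomputable def derivFock {m p q : ℝ} (hp : 0 < p) (hq : 0 < q)
    (h : ∀ f : FockSpace m p hp, fockENorm m q (deriv f) < ∞) :
    FockSpace m p hp →ₗ[ℂ] FockSpace m q hq where
  toFun f := ⟨deriv f, differentiable_deriv_of_entire f.2.1, h f⟩
  map_add' f g := Subtype.ext (funext fun z => deriv_add (f.2.1 z) (g.2.1 z))
  map_smul' c f := Subtype.ext (funext fun z => deriv_const_smul c (f.2.1 z))

theorem DerivTailBound.derivBounded {m p q k : ℝ} (hp : 0 < p) (hq : 0 < q)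
    (h : DerivTailBound m p q k) : DerivBounded m p q hp hq := by
  obtain ⟨C, hC⟩ := h.exists_fockENorm_deriv_le hq
  exact ⟨derivFock hp hq fun f => (hC f f.2.1).trans_lt (ENNReal.mul_lt_top (by simp) f.2.2),
    fun f z => rfl, C, fun f => hC f f.2.1⟩

open Filter Topology in
theorem tendsto_fockDensity (m : ℝ) {F : ℕ → ℂ → ℂ} {g : ℂ → ℂ} {z : ℂ}
    (h : Tendsto (fun n => F n z) atTop (𝓝 (g z))) :
    Tendsto (fun n => fockDensity m (F n) z) atTop (𝓝 (fockDensity m g z)) := by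
  unfold fockDensity
  refine ENNReal.Tendsto.mul_const h.enorm (Or.inr ENNReal.ofReal_ne_top)

-- Fatou's lemma.
open Filter Topology in
theorem fockENorm_le_of_tendsto (m : ℝ) {p : ℝ} (hp : 0 < p) {F : ℕ → ℂ → ℂ} {g : ℂ → ℂ}
    (hF : ∀ n, Differentiable ℂ (F n)) (hb : ∀ n, fockENorm m p (F n) ≤ 1)
    (h : ∀ z, Tendsto (fun n => F n z) atTop (𝓝 (g z))) : fockENorm m p g ≤ 1 := by
  have h1 : fockENorm m p g ^ p ≤ 1 := by
    rw [fockENorm_rpow m hp]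
    have h2 : ∀ z, fockDensity m g z ^ p = liminf (fun n => fockDensity m (F n) z ^ p) atTop :=
      fun z => ((ENNReal.continuous_rpow_const.tendsto _).comp
        (tendsto_fockDensity m (h z))).liminf_eq.symm
    simp_rw [h2]
    refine (lintegral_liminf_le fun n =>
      (measurable_fockDensity m (hF n).continuous).pow_const p).trans ?_
    refine (liminf_le_liminf (Eventually.of_forall fun n => ?_)).trans
      (liminf_const (1 : ℝ≥0∞) (f := (atTop : Filter ℕ))).le
    rw [← fockENorm_rpow m hp]
    exact ENNReal.rpow_le_one (hb n) hp.le
  exact ENNReal.le_one_of_rpow_le_one hp h1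

-- `R` is chosen first, making the tail of `(F n - g)'` small uniformly in `n`; on the disc of
-- radius `R` the derivatives converge uniformly.
open Filter Topology in
theorem DerivTailBound.tendsto_fockENorm_deriv {m p q k : ℝ} (hp : 0 < p) (hq : 0 < q) (hk : k < 0)
    (h : DerivTailBound m p q k) {F : ℕ → ℂ → ℂ} {g : ℂ → ℂ} (hF : ∀ n, Differentiable ℂ (F n))
    (hg : Differentiable ℂ g) (hb : ∀ n, fockENorm m p (F n) ≤ 1) (hb' : fockENorm m p g ≤ 1)
    (hlim : TendstoLocallyUniformly F g atTop) :
    Tendsto (fun n => fockENorm m q (deriv (F n) - deriv g)) atTop (𝓝 0) := by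
  have h0 : 0 < min 1 p := lt_min one_pos hp
  obtain ⟨C, hC⟩ := h
  have hd : ∀ n, deriv (F n) - deriv g = deriv (F n - g) := fun n => by
    ext z; exact (deriv_sub (hF n z) (hg z)).symm
  -- For `p < 1` only the power `min 1 p` is subadditive, hence this exponent of `2`.
  have hN : ∀ n, fockENorm m p (F n - g) ^ q ≤ 2 ^ (q / min 1 p) := by
    intro n
    have h1 := fockENorm_add_rpow_le m hp (hF n) hg.neg
    rw [fockENorm_neg, ← sub_eq_add_neg] at h1
    have h2 : fockENorm m p (F n - g) ^ min 1 p ≤ 2 := by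
      refine h1.trans ((add_le_add (ENNReal.rpow_le_one (hb n) h0.le)
        (ENNReal.rpow_le_one hb' h0.le)).trans (by norm_num))
    have h3 := ENNReal.rpow_le_rpow h2 (by positivity : 0 ≤ q / min 1 p)
    rwa [← ENNReal.rpow_mul, mul_div_cancel₀ _ h0.ne'] at h3
  have hlimd : TendstoLocallyUniformlyOn (fun n => deriv (F n)) (deriv g) atTop Set.univ :=
    (tendstoLocallyUniformlyOn_univ.2 hlim).deriv
      (Eventually.of_forall fun n => (hF n).differentiableOn) isOpen_univ
  rw [tendstoLocallyUniformlyOn_iff_forall_isCompact isOpen_univ] at hlimd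
  have key : Tendsto (fun n => fockENorm m q (deriv (F n) - deriv g) ^ q) atTop (𝓝 0) := by
    rw [ENNReal.tendsto_nhds_zero]
    intro e he
    have he2 : 0 < e / 2 := ENNReal.half_pos he.ne'
    obtain ⟨R, hR0, hR⟩ : ∃ R : ℝ, 0 ≤ R ∧
        C * ENNReal.ofReal ((1 + R) ^ k) * 2 ^ (q / min 1 p) ≤ e / 2 := by
      have t1 : Tendsto (fun R : ℝ => (1 + R) ^ k) atTop (𝓝 0) := by
        have := (tendsto_rpow_neg_atTop (neg_pos.2 hk)).comp (tendsto_atTop_add_const_left atTop 1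
          (tendsto_id (α := ℝ)))
        simpa [Function.comp_def] using this
      have t2 : Tendsto (fun R : ℝ => C * ENNReal.ofReal ((1 + R) ^ k) * 2 ^ (q / min 1 p)) atTop
          (𝓝 0) := by
        have t3 := ENNReal.tendsto_ofReal t1
        rw [ENNReal.ofReal_zero] at t3
        have t4 := ENNReal.Tendsto.const_mul t3 (a := (C : ℝ≥0∞)) (Or.inr ENNReal.coe_ne_top)
        have t5 := ENNReal.Tendsto.mul_const t4 (b := 2 ^ (q / min 1 p))
          (Or.inr (ENNReal.rpow_ne_top_of_nonneg (by positivity) (by norm_num)))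
        simpa using t5
      obtain ⟨R, h1, h2⟩ := ((eventually_ge_atTop 0).and
        (t2.eventually_le_const he2)).exists
      exact ⟨R, h1, h2⟩
    set V := volume (Metric.ball (0 : ℂ) R) with hV
    have hVt : V ≠ ∞ := measure_ball_lt_top.ne
    obtain ⟨d, hd0, hdV⟩ : ∃ d : ℝ, 0 < d ∧ ENNReal.ofReal d ^ q * V ≤ e / 2 := by
      have t1 : Tendsto (fun d : ℝ => ENNReal.ofReal d ^ q * V) (𝓝 0) (𝓝 0) := by
        have t2 := ((ENNReal.continuous_rpow_const (y := q)).comp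
          ENNReal.continuous_ofReal).tendsto 0
        simp only [Function.comp, ENNReal.ofReal_zero, ENNReal.zero_rpow_of_pos hq] at t2
        simpa using ENNReal.Tendsto.mul_const t2 (Or.inr hVt)
      obtain ⟨d, h1, h2⟩ := ((eventually_mem_nhdsWithin (a := (0 : ℝ)) (s := Set.Ioi 0)).and
        ((t1.mono_left nhdsWithin_le_nhds).eventually_le_const he2)).exists
      exact ⟨d, h1, h2⟩
    have hu := hlimd (Metric.closedBall 0 R) (Set.subset_univ _) (isCompact_closedBall _ _)
    rw [Metric.tendstoUniformlyOn_iff] at hu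
    filter_upwards [hu d hd0] with n hn
    rw [fockENorm_rpow m hq, ← lintegral_add_compl _ (measurableSet_le_norm R),
      ← ENNReal.add_halves e]
    refine add_le_add ?_ ?_
    · rw [hd]
      refine (hC _ ((hF n).sub hg) R hR0).trans (le_trans ?_ hR)
      gcongr
      exact hN n
    · have hset : {z : ℂ | R ≤ ‖z‖}ᶜ = Metric.ball 0 R := by ext z; simp
      rw [hset]
      refine (setLIntegral_mono' measurableSet_ball fun z hz => ?_).trans
        ((setLIntegral_const _ (ENNReal.ofReal d ^ q)).le.trans hdV)
      refine ENNReal.rpow_le_rpow ?_ hq.le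
      have h1 := (hn z (Metric.ball_subset_closedBall hz)).le
      rw [dist_comm, dist_eq_norm] at h1
      rw [fockDensity, Pi.sub_apply, ← mul_one (ENNReal.ofReal d)]
      refine mul_le_mul' ?_ ?_
      · rw [← ofReal_norm]; exact ENNReal.ofReal_le_ofReal h1
      · rw [← ENNReal.ofReal_one]
        refine ENNReal.ofReal_le_ofReal (Real.exp_le_one_iff.2 ?_)
        simp only [Left.neg_nonpos_iff]; positivity
  have h1 := ((ENNReal.continuous_rpow_const (y := q⁻¹)).tendsto _).comp key
  rw [ENNReal.zero_rpow_of_pos (inv_pos.2 hq)] at h1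
  refine h1.congr fun n => ?_
  simp only [Function.comp]
  rw [← ENNReal.rpow_mul, mul_inv_cancel₀ hq.ne', ENNReal.rpow_one]

theorem exists_norm_le_of_fockENorm_le_one {m p : ℝ} (hm : 0 < m) (hp : 0 < p) (R : ℝ) : ∃ M : ℝ, ∀ f : ℂ → ℂ, Differentiable ℂ f → fockENorm m p f ≤ 1 →
      ∀ z, ‖z‖ ≤ R → ‖f z‖ ≤ M := by
  obtain ⟨C, hC0, hC⟩ := exists_fockDensity_le_fockENorm hm hp
  obtain ⟨B, hB⟩ := (isCompact_closedBall (0 : ℂ) R).exists_bound_of_continuousOn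
    (f := fun z => (1 + ‖z‖) ^ (-((2 - m) / p)) * Real.exp (‖z‖ ^ m))
    (((continuous_const.add continuous_norm).rpow_const
      fun z => Or.inl (one_add_norm_pos z).ne').mul (Real.continuous_exp.comp
        (continuous_norm.rpow_const fun z => Or.inr hm.le))).continuousOn
  refine ⟨C * B, fun f hf h z hz => ?_⟩
  have h1 := (hC f hf z).trans (mul_le_mul' le_rfl h)
  rw [mul_one, fockDensity, polyWeight, ← ofReal_norm, ← ENNReal.ofReal_mul (norm_nonneg _),
    ← ENNReal.ofReal_mul (by positivity), ENNReal.ofReal_le_iff_le_toReal ENNReal.coe_ne_top,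
    ENNReal.coe_toReal] at h1
  have h2 := hB z (by simpa using hz)
  rw [Real.norm_of_nonneg (by positivity)] at h2
  have hz' := one_add_norm_pos z
  calc ‖f z‖ = ‖f z‖ * Real.exp (-‖z‖ ^ m) * (1 + ‖z‖) ^ ((2 - m) / p) *
        ((1 + ‖z‖) ^ (-((2 - m) / p)) * Real.exp (‖z‖ ^ m)) := by
        rw [Real.rpow_neg hz'.le, Real.exp_neg]
        field_simp
    _ ≤ C * B := by gcongr

-- The image of the closed unit ball is itself sequentially compact: by Fatou a locally uniform
-- limit of unit-ball elements stays in the unit ball.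
open Filter Topology in
theorem DerivTailBound.derivCompact {m p q k : ℝ} (hm : 0 < m) (hp : 0 < p) (hq : 0 < q)
    (hk : k < 0) (h : DerivTailBound m p q k) : DerivCompact m p q hp hq := by
  obtain ⟨T, hT, -⟩ := h.derivBounded hp hq
  have hTd : ∀ f : FockSpace m p hp, ⇑(T f) = deriv f := fun f => funext (hT f)
  have h0 : 0 < min 1 p := lt_min one_pos hp
  refine ⟨T, hT, T '' {f | fockENorm m p f ≤ 1}, ?_, ?_⟩
  · refine IsSeqCompact.isCompact fun y hy => ?_
    choose F hF1 hFy using hy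
    obtain ⟨φ, g, hφ, hg, hlim⟩ := exists_subseq_tendstoLocallyUniformly (f := fun n => ⇑(F n))
      (fun n => (F n).2.1) fun R _ => by
        obtain ⟨M, hM⟩ := exists_norm_le_of_fockENorm_le_one hm hp R
        exact ⟨M, fun n z hz => hM _ (F n).2.1 (hF1 n) z hz⟩
    have hg1 : fockENorm m p g ≤ 1 := fockENorm_le_of_tendsto m hp
      (fun n => (F (φ n)).2.1) (fun n => hF1 (φ n)) fun z =>
        (tendstoLocallyUniformlyOn_univ.2 hlim).tendsto_at (Set.mem_univ z)
    let G : FockSpace m p hp := ⟨g, hg, hg1.trans_lt ENNReal.one_lt_top⟩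
    refine ⟨T G, ⟨G, hg1, rfl⟩, φ, hφ, ?_⟩
    rw [FockSpace.tendsto_iff]
    have := h.tendsto_fockENorm_deriv hp hq hk (fun n => (F (φ n)).2.1) hg
      (fun n => hF1 (φ n)) hg1 hlim
    refine this.congr fun n => ?_
    rw [Function.comp, ← hFy, hTd, hTd]
  · refine Filter.mem_of_superset (Metric.ball_mem_nhds (0 : FockSpace m p hp) one_pos)
      fun f hf => ⟨f, ?_, rfl⟩
    rw [Metric.mem_ball] at hf
    change (fockENorm m p (⇑f - ⇑(0 : FockSpace m p hp)) ^ min 1 p).toReal < 1 at hf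
    have e : ⇑f - ⇑(0 : FockSpace m p hp) = ⇑f := sub_zero _
    have h1 := FockSpace.dist_aux_ne_top f 0
    rw [e] at hf h1
    have h2 := (ENNReal.toReal_lt_toReal h1 ENNReal.one_ne_top).1 (by rwa [ENNReal.toReal_one])
    exact ENNReal.le_one_of_rpow_le_one h0 h2.le

/-! ### Localized test functions -/

/-- The gauge `min (x^2) |x|` reflects that `e^x - 1 - x` is quadratic near `0` but only linear at
`-∞`. It measures the gain from the weight; the next two lemmas measure the losses by the same
gauge. -/
theorem min_sq_abs_le_exp_sub (x : ℝ) : min (x ^ 2) |x| / 4 ≤ Real.exp x - 1 - x := by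
  rcases le_total 0 x with h | h
  · have := Real.quadratic_le_exp_of_nonneg h
    have := min_le_left (x ^ 2) |x|
    nlinarith [sq_nonneg x]
  · rcases le_total (-2) x with h2 | h2
    · have h3 := Real.add_one_le_exp (x / 2)
      have h4 : Real.exp x = Real.exp (x / 2) ^ 2 := by
        rw [← Real.exp_nat_mul]; congr 1; push_cast; ring
      have h5 : (x / 2 + 1) ^ 2 ≤ Real.exp (x / 2) ^ 2 := by
        gcongr; linarith
      have := min_le_left (x ^ 2) |x|
      nlinarith
    · have := Real.exp_pos x
      have h3 := min_le_right (x ^ 2) |x|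
      rw [abs_of_nonpos h] at h3 ⊢
      linarith

theorem cosh_half_le_exp_min (u : ℝ) : Real.cosh (u / 2) ≤ Real.exp (min (u ^ 2) |u| / 2) := by
  rcases min_cases (u ^ 2) |u| with ⟨h, -⟩ | ⟨h, -⟩ <;> rw [h]
  · refine (Real.cosh_le_exp_half_sq _).trans (Real.exp_le_exp.2 ?_)
    nlinarith [sq_nonneg u]
  · rw [← Real.cosh_abs, Real.cosh_eq, abs_div, abs_of_pos (two_pos : (0 : ℝ) < 2)]
    have : Real.exp (-(|u| / 2)) ≤ Real.exp (|u| / 2) :=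
      Real.exp_le_exp.2 (by linarith [abs_nonneg u])
    linarith

theorem one_add_exp_sub_one_sq_le (u : ℝ) :
    1 + (Real.exp u - 1) ^ 2 ≤ Real.exp (9 * min (u ^ 2) |u|) := by
  have hlin : ∀ y : ℝ, 1 + y ≤ Real.exp y := fun y => by linarith [Real.add_one_le_exp y]
  have hsmall : ∀ y : ℝ, (Real.exp u - 1) ^ 2 ≤ y → 1 + (Real.exp u - 1) ^ 2 ≤ Real.exp y :=
    fun y hy => (hlin _).trans (Real.exp_le_exp.2 hy)
  rcases le_total u 0 with h | h
  · have h1 := Real.add_one_le_exp u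
    have h2 : Real.exp u ≤ 1 := Real.exp_le_one_iff.2 h
    have h3 := Real.exp_pos u
    refine hsmall _ ?_
    rcases min_cases (u ^ 2) |u| with ⟨hm, -⟩ | ⟨hm, -⟩ <;> rw [hm]
    · nlinarith [sq_nonneg u]
    · rw [abs_of_nonpos h]; nlinarith
  · have h1 : 1 + (Real.exp u - 1) ^ 2 ≤ Real.exp (2 * u) := by
      have h2 : 1 ≤ Real.exp u := Real.one_le_exp h
      have : Real.exp (2 * u) = Real.exp u ^ 2 := by
        rw [← Real.exp_nat_mul]; push_cast; rfl
      rw [this]; nlinarith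
    rcases le_total u 1 with h4 | h4
    · refine hsmall _ ?_
      have hle : Real.exp u - 1 ≤ 3 * u := by
        have h5 := Real.add_one_le_exp (-u)
        have h6 : Real.exp u * Real.exp (-u) = 1 := by rw [← Real.exp_add]; simp
        have h7 : Real.exp u ≤ 3 := (Real.exp_le_exp.2 h4).trans
          (by linarith [Real.exp_one_lt_d9])
        have h8 := Real.exp_pos u
        nlinarith
      have h0 : 0 ≤ Real.exp u - 1 := by linarith [Real.one_le_exp h]
      have h9 : u ^ 2 ≤ |u| := by rw [abs_of_nonneg h]; nlinarith
      rw [min_eq_left h9]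
      nlinarith
    · refine h1.trans (Real.exp_le_exp.2 ?_)
      have h9 : |u| ≤ u ^ 2 := by rw [abs_of_nonneg h]; nlinarith
      rw [min_eq_right h9, abs_of_nonneg h]
      linarith

/-- With `r = e^u`, `(1+r)/2 = e^{u/2} cosh (u/2)`, and `L + 1/2 = m/b` cancels the terms linear in
`u`. The cosh and the last factor cost `M/2` each, the exponent `1/18` being half of `1/9`, and the
bound on `b` makes the weight pay for `M`. -/
theorem radial_factor_le {m b : ℝ} (hm : 0 < m) (hb : 0 < b) (hbm : b ≤ min (m ^ 2) m / 4) {L : ℕ}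
    (hL : (L + 1 / 2 : ℝ) = m / b) {r : ℝ} (hr : 0 < r) :
    r ^ L * ((1 + r) / 2) * Real.exp (-(r ^ m - 1) / b) * (1 + (r - 1) ^ 2) ^ (1 / 18 : ℝ) ≤ 1 := by
  set u := Real.log r with hu
  have hru : r = Real.exp u := (Real.exp_log hr).symm
  set M := min (u ^ 2) |u| with hM
  have hM0 : 0 ≤ M := le_min (sq_nonneg _) (abs_nonneg _)
  have h1 : r ^ L = Real.exp (L * u) := by rw [hru, ← Real.exp_nat_mul]
  have h2 : (1 + r) / 2 ≤ Real.exp (u / 2 + M / 2) := by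
    have : (1 + r) / 2 = Real.exp (u / 2) * Real.cosh (u / 2) := by
      rw [Real.cosh_eq, hru, ← mul_div_assoc, mul_add, ← Real.exp_add, ← Real.exp_add]
      ring_nf; simp; ring
    rw [this, Real.exp_add]
    gcongr
    exact cosh_half_le_exp_min u
  have h3 : (1 + (r - 1) ^ 2) ^ (1 / 18 : ℝ) ≤ Real.exp (M / 2) := by
    have h4 := one_add_exp_sub_one_sq_le u
    rw [← hru] at h4
    calc (1 + (r - 1) ^ 2) ^ (1 / 18 : ℝ) ≤ Real.exp (9 * M) ^ (1 / 18 : ℝ) := by gcongr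
      _ = _ := by rw [← Real.exp_mul]; ring_nf
  have h4 : r ^ m = Real.exp (m * u) := by
    rw [hru, ← Real.exp_mul, mul_comm]
  have h5 : min (m ^ 2) m / 4 * M ≤ Real.exp (m * u) - 1 - m * u := by
    refine le_trans ?_ (min_sq_abs_le_exp_sub (m * u))
    rw [mul_pow, abs_mul, abs_of_pos hm]
    have h6 : min (m ^ 2) m * M ≤ min (m ^ 2 * u ^ 2) (m * |u|) := by
      refine le_min ?_ ?_
      · exact mul_le_mul (min_le_left _ _) (min_le_left _ _) hM0 (by positivity)
      · exact mul_le_mul (min_le_right _ _) (min_le_right _ _) hM0 (by positivity)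
    linarith
  calc _ ≤ Real.exp (L * u) * Real.exp (u / 2 + M / 2) * Real.exp (-(r ^ m - 1) / b) *
        Real.exp (M / 2) := by rw [h1]; gcongr
    _ = Real.exp ((L + 1 / 2) * u + M - (r ^ m - 1) / b) := by
        rw [← Real.exp_add, ← Real.exp_add, ← Real.exp_add]; ring_nf
    _ ≤ 1 := by
        rw [Real.exp_le_one_iff, hL, h4]
        have h7 : M ≤ (Real.exp (m * u) - 1 - m * u) / b := by
          rw [le_div_iff₀ hb]; nlinarith
        have h8 : m / b * u + M - (Real.exp (m * u) - 1) / b =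
          M - (Real.exp (m * u) - 1 - m * u) / b := by ring
        linarith

/-- The factor `z + 1` localizes in angle. By the parallelogram law the angular part of `‖z - 1‖^2`
is exactly what `‖z + 1‖^2` loses from `(1+r)^2`; `x` is the relative loss, and `(1-x)(1+5x)^{1/9} ≤
1`. -/
theorem localized_factor_le {m b : ℝ} (hm : 0 < m) (hb : 0 < b) (hbm : b ≤ min (m ^ 2) m / 4)
    {L : ℕ} (hL : (L + 1 / 2 : ℝ) = m / b) {z : ℂ} (hz : z ≠ 0) :
    ‖z‖ ^ L * (‖z + 1‖ / 2) * Real.exp (-(‖z‖ ^ m - 1) / b) *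
      (1 + ‖z - 1‖ ^ 2) ^ (1 / 18 : ℝ) ≤ 1 := by
  set r := ‖z‖ with hr
  have hr0 : 0 < r := norm_pos_iff.2 hz
  set D := ‖z - 1‖ ^ 2 with hD
  have hpar : ‖z + 1‖ ^ 2 = (1 + r) ^ 2 - (D - (r - 1) ^ 2) := by
    have := parallelogram_law_with_norm ℝ z 1
    rw [norm_one] at this
    rw [hD]; nlinarith
  have hy0 : 0 ≤ D - (r - 1) ^ 2 := by
    have := abs_norm_sub_norm_le z 1
    rw [norm_one] at this
    have h2 : |r - 1| ^ 2 ≤ ‖z - 1‖ ^ 2 := by gcongr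
    rw [sq_abs] at h2
    linarith
  have hy1 : D - (r - 1) ^ 2 ≤ (1 + r) ^ 2 := by linarith [sq_nonneg ‖z + 1‖]
  set y := D - (r - 1) ^ 2 with hy
  set x := y / (1 + r) ^ 2 with hx
  have hx0 : 0 ≤ x := by positivity
  have hx1 : x ≤ 1 := by rw [hx, div_le_one (by positivity)]; exact hy1
  have hyx : y = x * (1 + r) ^ 2 := by rw [hx, div_mul_cancel₀ _ (by positivity)]
  have h1 : ‖z + 1‖ / 2 = (1 + r) / 2 * (1 - x) ^ (1 / 2 : ℝ) := by
    have e1 : ‖z + 1‖ = √(‖z + 1‖ ^ 2) := (Real.sqrt_sq (norm_nonneg _)).symm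
    rw [e1, hpar, hyx, show (1 + r) ^ 2 - x * (1 + r) ^ 2 = (1 + r) ^ 2 * (1 - x) by ring,
      Real.sqrt_mul (by positivity), Real.sqrt_sq (by positivity), Real.sqrt_eq_rpow]
    ring
  have h2 : (1 + D) ^ (1 / 18 : ℝ) ≤ (1 + (r - 1) ^ 2) ^ (1 / 18 : ℝ) * (1 + 5 * x) ^ (1 / 18 : ℝ)
      := by
    rw [← Real.mul_rpow (by positivity) (by positivity)]
    refine Real.rpow_le_rpow (by positivity) ?_ (by norm_num)
    -- The difference of the two sides is `(2r-3)^2`.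
    have : (1 + r) ^ 2 ≤ 5 * (1 + (r - 1) ^ 2) := by nlinarith [sq_nonneg (2 * r - 3)]
    have e : 1 + D = 1 + (r - 1) ^ 2 + x * (1 + r) ^ 2 := by rw [← hyx, hy]; ring
    rw [e]; nlinarith
  have h3 : (1 - x) ^ (1 / 2 : ℝ) * (1 + 5 * x) ^ (1 / 18 : ℝ) ≤ 1 := by
    have e1 : (1 + 5 * x) ^ (1 / 18 : ℝ) = ((1 + 5 * x) ^ (1 / 9 : ℝ)) ^ (1 / 2 : ℝ) := by
      rw [← Real.rpow_mul (by positivity)]; norm_num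
    rw [e1, ← Real.mul_rpow (by linarith) (by positivity)]
    refine Real.rpow_le_one (mul_nonneg (by linarith) (by positivity)) ?_ (by norm_num)
    have h4 : (1 + 5 * x) ^ (1 / 9 : ℝ) ≤ 1 + 1 / 9 * (5 * x) :=
      rpow_one_add_le_one_add_mul_self (by linarith) (by norm_num) (by norm_num)
    nlinarith
  have h5 := radial_factor_le hm hb hbm hL hr0
  have hx1' : 0 ≤ (1 - x) ^ (1 / 2 : ℝ) := Real.rpow_nonneg (by linarith) _
  calc _ ≤ r ^ L * ((1 + r) / 2 * (1 - x) ^ (1 / 2 : ℝ)) * Real.exp (-(r ^ m - 1) / b) *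
        ((1 + (r - 1) ^ 2) ^ (1 / 18 : ℝ) * (1 + 5 * x) ^ (1 / 18 : ℝ)) := by
        rw [h1]; gcongr
    _ = (r ^ L * ((1 + r) / 2) * Real.exp (-(r ^ m - 1) / b) * (1 + (r - 1) ^ 2) ^ (1 / 18 : ℝ)) *
        ((1 - x) ^ (1 / 2 : ℝ) * (1 + 5 * x) ^ (1 / 18 : ℝ)) := by ring
    _ ≤ 1 * 1 := by gcongr
    _ = 1 := one_mul 1

theorem integral_Ioi_mul_one_add_sq_rpow {s : ℝ} (hs : 1 < s) :
    ∫ y in Set.Ioi (0 : ℝ), y * (1 + y ^ 2) ^ (-s) = 1 / (2 * (s - 1)) := by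
  have hpos : ∀ y : ℝ, 0 < 1 + y ^ 2 := fun y => by positivity
  have hd : ∀ y ∈ Set.Ici (0 : ℝ), HasDerivAt (fun y : ℝ => (1 + y ^ 2) ^ (1 - s) / (2 * (1 - s)))
      (y * (1 + y ^ 2) ^ (-s)) y := by
    intro y _
    have h1 : HasDerivAt (fun y : ℝ => 1 + y ^ 2) (2 * y) y := by
      simpa using (hasDerivAt_pow 2 y).const_add 1
    have h2 := (h1.rpow_const (p := 1 - s) (Or.inl (hpos y).ne')).div_const (2 * (1 - s))
    refine h2.congr_deriv ?_
    have : 1 - s ≠ 0 := by linarith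
    rw [show 1 - s - 1 = -s by ring]
    field_simp
  have ht : Filter.Tendsto (fun y : ℝ => (1 + y ^ 2) ^ (1 - s) / (2 * (1 - s))) Filter.atTop
      (nhds 0) := by
    have h1 : Filter.Tendsto (fun y : ℝ => 1 + y ^ 2) Filter.atTop Filter.atTop :=
      Filter.tendsto_atTop_add_const_left _ _ (Filter.tendsto_pow_atTop two_ne_zero)
    have h2 := (tendsto_rpow_neg_atTop (by linarith : 0 < s - 1)).comp h1
    have h3 := h2.div_const (2 * (1 - s))
    simpa [Function.comp_def] using h3
  rw [integral_Ioi_of_hasDerivAt_of_nonneg' hd (fun y hy => ?_) ht]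
  · have h1 : s - 1 ≠ 0 := by linarith
    rw [show (1 + (0 : ℝ) ^ 2) = 1 by norm_num, Real.one_rpow, show 1 - s = -(s - 1) by ring]
    field_simp
    norm_num
  · have := hpos y
    exact mul_nonneg (le_of_lt hy) (by positivity)

theorem lintegral_one_add_norm_sq_rpow {s : ℝ} (hs : 1 < s) {R : ℝ} (hR : 0 < R) :
    ∫⁻ z : ℂ, ENNReal.ofReal ((1 + ‖z / R - 1‖ ^ 2) ^ (-s)) =
      ENNReal.ofReal (R ^ 2 * (Real.pi / (s - 1))) := by
  have hint : Integrable (fun z : ℂ => (1 + ‖z‖ ^ 2) ^ (-s)) := by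
    have := integrable_rpow_neg_one_add_norm_sq (E := ℂ) (μ := volume) (r := 2 * s)
      (by rw [Complex.finrank_real_complex]; push_cast; linarith)
    simpa [neg_div] using this
  have hval : ∫ z : ℂ, (1 + ‖z‖ ^ 2) ^ (-s) = Real.pi / (s - 1) := by
    have := integral_fun_norm_addHaar (volume : Measure ℂ) (fun y : ℝ => (1 + y ^ 2) ^ (-s))
    rw [this, Complex.finrank_real_complex]
    simp only [Nat.add_one_sub_one, pow_one, smul_eq_mul]
    rw [integral_Ioi_mul_one_add_sq_rpow hs]
    have hb : volume.real (Metric.ball (0 : ℂ) 1) = Real.pi := by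
      rw [Measure.real, Complex.volume_ball]; simp
    rw [hb]
    have : s - 1 ≠ 0 := by linarith
    simp; field_simp
  have e : ∀ z : ℂ, z / R - 1 = (R⁻¹ : ℝ) • z - 1 := fun z => by
    rw [Complex.real_smul, Complex.ofReal_inv, div_eq_inv_mul]
  simp_rw [e]
  have hint2 : Integrable (fun z : ℂ => (1 + ‖z - 1‖ ^ 2) ^ (-s)) := hint.comp_sub_right 1
  rw [← ofReal_integral_eq_lintegral_ofReal]
  · rw [Measure.integral_comp_inv_smul volume (fun z : ℂ => (1 + ‖z - 1‖ ^ 2) ^ (-s)),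
      integral_sub_right_eq_self (fun z : ℂ => (1 + ‖z‖ ^ 2) ^ (-s)), hval,
      Complex.finrank_real_complex, smul_eq_mul, abs_of_pos (by positivity)]
  · exact hint2.comp_smul (inv_ne_zero hR.ne')
  · exact Filter.Eventually.of_forall fun z => by positivity

/-- `b` is tuned so that `m/b` is a half-integer: the integer part is a power of `z`, and the half
comes from `z + 1`. -/
theorem exists_nat_add_half_eq_div {m e : ℝ} (hm : 0 < m) (he : 0 < e) :
    ∃ (L : ℕ) (b : ℝ), 0 < b ∧ b ≤ e ∧ (L + 1 / 2 : ℝ) = m / b ∧ 0 < L := by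
  obtain ⟨L, hL⟩ := exists_nat_ge (m / e + 1)
  have hme : 0 < m / e := by positivity
  have hL0 : 0 < (L : ℝ) := by linarith
  refine ⟨L, m / (L + 1 / 2), by positivity, ?_, ?_, by exact_mod_cast hL0⟩
  · rw [div_le_iff₀ (by positivity)]
    have : m ≤ (L : ℝ) * e := by
      rw [← div_le_iff₀ he]; linarith
    nlinarith
  · field_simp

/-- The `k`-th power of the preceding bound at `w = z/R`. The relation `R^m = k/b` turns `k(‖w‖^m -
1)/b` into `‖z‖^m - R^m`. -/
theorem localized_power_le {m b : ℝ} (hm : 0 < m) (hb : 0 < b) (hbm : b ≤ min (m ^ 2) m / 4)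
    {L : ℕ} (hL : (L + 1 / 2 : ℝ) = m / b) (hL0 : 0 < L) {k : ℕ} (hk : 0 < k) {R : ℝ} (hR : 0 < R)
    (hRk : R ^ m = k / b) (z : ℂ) :
    ‖z‖ ^ (L * k) * ‖z + R‖ ^ k * Real.exp (-‖z‖ ^ m) ≤
      R ^ (L * k) * (2 * R) ^ k * Real.exp (-R ^ m) * (1 + ‖z / R - 1‖ ^ 2) ^ (-(k / 18 : ℝ)) := by
  rcases eq_or_ne z 0 with rfl | hz
  · rw [norm_zero, zero_pow (by positivity), zero_mul, zero_mul]
    positivity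
  have hRc : (R : ℂ) ≠ 0 := by exact_mod_cast hR.ne'
  set w := z / R with hw
  have hzw : z = R * w := by rw [hw, mul_div_cancel₀ _ hRc]
  have hw0 : w ≠ 0 := div_ne_zero hz hRc
  have h1 := pow_le_one₀ (n := k) (by positivity) (localized_factor_le hm hb hbm hL hw0)
  have hnz : ‖z‖ = R * ‖w‖ := by
    rw [hzw, norm_mul, Complex.norm_real, Real.norm_of_nonneg hR.le]
  have hnz1 : ‖z + R‖ = R * ‖w + 1‖ := by
    rw [hzw, ← mul_add_one, norm_mul, Complex.norm_real, Real.norm_of_nonneg hR.le]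
  have hpos : 0 < 1 + ‖w - 1‖ ^ 2 := by positivity
  have e1 : ((1 + ‖w - 1‖ ^ 2) ^ (1 / 18 : ℝ)) ^ k = (1 + ‖w - 1‖ ^ 2) ^ (k / 18 : ℝ) := by
    rw [← Real.rpow_natCast, ← Real.rpow_mul hpos.le]; ring_nf
  have e2 : Real.exp (-(‖w‖ ^ m - 1) / b) ^ k = Real.exp (-‖z‖ ^ m) * Real.exp (R ^ m) := by
    rw [← Real.exp_nat_mul, ← Real.exp_add, hnz, Real.mul_rpow hR.le (norm_nonneg _), hRk]
    congr 1; field_simp; ring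
  rw [mul_pow, mul_pow, mul_pow, e1, e2, ← pow_mul, div_pow] at h1
  rw [Real.rpow_neg hpos.le, ← div_eq_mul_inv, le_div_iff₀ (by positivity), hnz1, mul_pow, hnz,
    mul_pow, mul_pow, ← hnz]
  rw [Real.exp_neg (R ^ m)]
  have h2 : 0 < Real.exp (R ^ m) := Real.exp_pos _
  calc _ = (R ^ (L * k) * (2 ^ k * R ^ k) * (Real.exp (R ^ m))⁻¹) *
        (‖w‖ ^ (L * k) * (‖w + 1‖ ^ k / 2 ^ k) * (Real.exp (-‖z‖ ^ m) * Real.exp (R ^ m)) *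
          (1 + ‖w - 1‖ ^ 2) ^ (k / 18 : ℝ)) := by
        field_simp
    _ ≤ (R ^ (L * k) * (2 ^ k * R ^ k) * (Real.exp (R ^ m))⁻¹) * 1 := by gcongr
    _ = _ := mul_one _

theorem deriv_pow_mul_add_pow {a k : ℕ} (ha : 0 < a) (hk : 0 < k) {R : ℝ} (hR : 0 < R) :
    deriv (fun z : ℂ => z ^ a * (z + R) ^ k) R =
      ((R ^ a * (2 * R) ^ k * ((a + k / 2) / R) : ℝ) : ℂ) := by
  have hRc : (R : ℂ) ≠ 0 := by exact_mod_cast hR.ne'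
  have h1 : HasDerivAt (fun z : ℂ => z ^ a) (a * (R : ℂ) ^ (a - 1)) R := hasDerivAt_pow a _
  have h2 : HasDerivAt (fun z : ℂ => (z + R) ^ k) (k * ((R : ℂ) + R) ^ (k - 1) * 1) R :=
    ((hasDerivAt_id (R : ℂ)).add_const (R : ℂ)).fun_pow k
  rw [(h1.fun_mul h2).deriv]
  obtain ⟨a', rfl⟩ := Nat.exists_eq_succ_of_ne_zero ha.ne'
  obtain ⟨k', rfl⟩ := Nat.exists_eq_succ_of_ne_zero hk.ne'
  push_cast
  simp only [Nat.succ_eq_add_one, pow_succ]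
  rw [← two_mul]
  field_simp

/-- `P n` is the weighted modulus of the polynomial at its peak `R n`. Concentration on an area of
order `R^2/k ~ R^{2-m}` permits peak height `M n ~ R^{(m-2)/p}`. The logarithmic derivative at `R`
is `(L+1/2)k/R = m R^{m-1}`. -/
theorem exists_test_functions {m p : ℝ} (hm : 0 < m) (hp : 0 < p) :
    ∃ (c : ℝ≥0) (f : ℕ → ℂ → ℂ) (z : ℕ → ℂ), 0 < c ∧
      Filter.Tendsto (fun n => ‖z n‖) Filter.atTop Filter.atTop ∧
      ∀ n, Differentiable ℂ (f n) ∧ fockENorm m p (f n) ≤ 1 ∧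
        c * polyWeight ((m - 1) + (m - 2) / p) (z n) ≤ fockDensity m (deriv (f n)) (z n) := by
  obtain ⟨L, b, hb, hbm, hL, hL0⟩ := exists_nat_add_half_eq_div hm
    (show 0 < min (m ^ 2) m / 4 by positivity)
  -- The term `36/p` gives `p k/18 ≥ 2`, hence convergence with `p k/18 - 1 ≥ p k/36`; the term `b`
  -- gives `R n ≥ 1`.
  obtain ⟨k0, hk0⟩ := exists_nat_ge (36 / p + b)
  have hk0' : (0 : ℝ) < k0 := lt_of_lt_of_le (by positivity) hk0
  set k : ℕ → ℕ := fun n => n + k0 with hk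
  have hkpos : ∀ n, 0 < k n := fun n => by
    have : 0 < k0 := by exact_mod_cast hk0'
    simp only [hk]; omega
  have hkge : ∀ n, 36 / p + b ≤ k n := fun n => hk0.trans (by simp [hk])
  set R : ℕ → ℝ := fun n => (k n / b) ^ (1 / m) with hRdef
  have hk' : ∀ n, (0 : ℝ) < k n := fun n => by exact_mod_cast hkpos n
  have hR : ∀ n, 0 < R n := fun n => Real.rpow_pos_of_pos (div_pos (hk' n) hb) _
  have hRm : ∀ n, R n ^ m = k n / b := fun n => by
    simp only [hRdef]
    rw [← Real.rpow_mul (div_pos (hk' n) hb).le, one_div_mul_cancel hm.ne', Real.rpow_one]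
  have hR1 : ∀ n, 1 ≤ R n := fun n => by
    refine Real.one_le_rpow ?_ (by positivity)
    rw [one_le_div hb]
    have : 0 < 36 / p := by positivity
    linarith [hkge n]
  set C1 := Real.pi * 36 / (p * b) with hC1
  have hC1pos : 0 < C1 := by positivity
  set M : ℕ → ℝ := fun n => (C1⁻¹ * R n ^ (m - 2)) ^ (1 / p) with hM
  have hMpos : ∀ n, 0 < M n := fun n => by have := hR n; simp only [hM]; positivity
  set P : ℕ → ℝ := fun n => R n ^ (L * k n) * (2 * R n) ^ k n * Real.exp (-R n ^ m) with hP
  have hPpos : ∀ n, 0 < P n := fun n => by have := hR n; simp only [hP]; positivity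
  set g : ℕ → ℂ → ℂ := fun n z => z ^ (L * k n) * (z + R n) ^ k n with hg
  have hgd : ∀ n, Differentiable ℂ (g n) := fun n => by simp only [hg]; fun_prop
  set f : ℕ → ℂ → ℂ := fun n => ((M n / P n : ℝ) : ℂ) • g n with hf
  refine ⟨((C1⁻¹) ^ (1 / p) * m * (2 ^ |(m - 1) + (m - 2) / p|)⁻¹).toNNReal, f, fun n => (R n : ℂ),
    ?_, ?_, fun n => ⟨(hgd n).const_smul _, ?_, ?_⟩⟩
  · rw [Real.toNNReal_pos]; positivity
  · have h1 : Filter.Tendsto R Filter.atTop Filter.atTop := by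
      refine (tendsto_rpow_atTop (by positivity)).comp ?_
      refine Filter.Tendsto.atTop_div_const hb ?_
      refine tendsto_natCast_atTop_atTop.comp ?_
      exact Filter.tendsto_add_atTop_nat k0
    refine h1.congr fun n => ?_
    rw [Complex.norm_real, Real.norm_of_nonneg (hR n).le]
  · refine ENNReal.le_one_of_rpow_le_one hp ?_
    rw [fockENorm_rpow m hp]
    have hs : 1 < p * (k n / 18) := by
      have h1 : 36 / p ≤ k n := by linarith [hkge n]
      rw [div_le_iff₀ hp] at h1
      linarith
    have hpt : ∀ z, fockDensity m (f n) z ^ p ≤ ENNReal.ofReal (M n ^ p) *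
        ENNReal.ofReal ((1 + ‖z / R n - 1‖ ^ 2) ^ (-(p * (k n / 18)))) := by
      intro z
      have h1 := localized_power_le hm hb hbm hL hL0 (hkpos n) (hR n) (hRm n) z
      have h2 : fockDensity m (f n) z ≤
          ENNReal.ofReal (M n * (1 + ‖z / R n - 1‖ ^ 2) ^ (-(k n / 18 : ℝ))) := by
        rw [fockDensity, ← ofReal_norm, ← ENNReal.ofReal_mul (norm_nonneg _)]
        refine ENNReal.ofReal_le_ofReal ?_
        have hfz : f n z = ((M n / P n : ℝ) : ℂ) * (z ^ (L * k n) * (z + R n) ^ k n) := rfl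
        rw [hfz, norm_mul, Complex.norm_real,
          Real.norm_of_nonneg (div_pos (hMpos n) (hPpos n)).le, norm_mul, norm_pow, norm_pow]
        calc _ = M n / P n * (‖z‖ ^ (L * k n) * ‖z + R n‖ ^ k n * Real.exp (-‖z‖ ^ m)) := by ring
          _ ≤ M n / P n * (P n * (1 + ‖z / R n - 1‖ ^ 2) ^ (-(k n / 18 : ℝ))) := by
              have := (div_pos (hMpos n) (hPpos n)).le
              gcongr
          _ = _ := by
              have := (hPpos n).ne'
              field_simp
      refine (ENNReal.rpow_le_rpow h2 hp.le).trans (le_of_eq ?_)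
      have := hMpos n
      rw [ENNReal.ofReal_rpow_of_nonneg (by positivity) hp.le,
        Real.mul_rpow (by positivity) (by positivity), ENNReal.ofReal_mul (by positivity),
        ← Real.rpow_mul (show 0 ≤ 1 + ‖z / R n - 1‖ ^ 2 by positivity)]
      ring_nf
    refine (lintegral_mono hpt).trans ?_
    rw [lintegral_const_mul' _ _ ENNReal.ofReal_ne_top, lintegral_one_add_norm_sq_rpow hs (hR n),
      ← ENNReal.ofReal_mul (Real.rpow_nonneg (hMpos n).le _), ENNReal.ofReal_le_one]
    have e1 : M n ^ p = C1⁻¹ * R n ^ (m - 2) := by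
      have := hR n
      simp only [hM]
      rw [← Real.rpow_mul (by positivity), one_div_mul_cancel hp.ne', Real.rpow_one]
    have e2 : R n ^ (m - 2) * R n ^ 2 = k n / b := by
      rw [← hRm n, ← Real.rpow_natCast, ← Real.rpow_add (hR n)]; norm_num
    have e3 : p * (k n / 18) - 1 ≥ p * k n / 36 := by
      have h1 : 36 / p ≤ k n := by linarith [hkge n]
      rw [div_le_iff₀ hp] at h1
      linarith
    have hk'' := hk' n
    calc _ = C1⁻¹ * (R n ^ (m - 2) * R n ^ 2) * (Real.pi / (p * (k n / 18) - 1)) := by rw [e1]; ring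
      _ ≤ C1⁻¹ * (k n / b) * (Real.pi / (p * k n / 36)) := by rw [e2]; gcongr
      _ = 1 := by rw [hC1]; field_simp
  · have hd : deriv (f n) (R n) = ((M n / P n : ℝ) : ℂ) *
        ((R n ^ (L * k n) * (2 * R n) ^ k n * (((L * k n : ℕ) + k n / 2) / R n) : ℝ) : ℂ) := by
      rw [← deriv_pow_mul_add_pow (Nat.mul_pos hL0 (hkpos n)) (hkpos n) (hR n), ← smul_eq_mul]
      exact deriv_const_smul _ (hgd n _)
    have hval : fockDensity m (deriv (f n)) (R n) = ENNReal.ofReal (M n * m * R n ^ (m - 1)) := by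
      have hRn := hR n
      have hMn := hMpos n
      have hPn := hPpos n
      have hkn := hk' n
      rw [fockDensity, hd, ← Complex.ofReal_mul, ← ofReal_norm, Complex.norm_real,
        Real.norm_of_nonneg (by positivity), ← ENNReal.ofReal_mul (by positivity),
        Complex.norm_real, Real.norm_of_nonneg hRn.le]
      congr 1
      have e1 : ((L * k n : ℕ) + k n / 2 : ℝ) = m * R n ^ m := by
        rw [hRm n]; push_cast
        rw [show (L * k n + k n / 2 : ℝ) = (L + 1 / 2) * k n by ring, hL]
        ring
      rw [e1, Real.rpow_sub_one hRn.ne']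
      have hPe : R n ^ (L * k n) * (2 * R n) ^ k n * Real.exp (-R n ^ m) = P n := rfl
      calc _ = M n / P n * (R n ^ (L * k n) * (2 * R n) ^ k n * Real.exp (-R n ^ m)) *
            (m * R n ^ m / R n) := by ring
        _ = _ := by rw [hPe, div_mul_cancel₀ _ hPn.ne']; ring
    rw [hval]
    change ENNReal.ofReal _ * ENNReal.ofReal _ ≤ _
    rw [← ENNReal.ofReal_mul (by positivity)]
    refine ENNReal.ofReal_le_ofReal ?_
    have hRn := hR n
    have e1 : M n * m * R n ^ (m - 1) =
        (C1⁻¹) ^ (1 / p) * m * R n ^ ((m - 1) + (m - 2) / p) := by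
      simp only [hM]
      rw [Real.mul_rpow (by positivity) (by positivity), ← Real.rpow_mul hRn.le,
        Real.rpow_add hRn, mul_one_div]
      ring
    rw [e1, Complex.norm_real, Real.norm_of_nonneg hRn.le, mul_assoc (_ * m)]
    gcongr
    rw [inv_mul_le_iff₀ (by positivity)]
    exact rpow_le_rpow_abs_mul two_pos (by positivity) (by linarith [hR1 n]) (by linarith [hR1 n]) _

/-! ### Neighbourhoods, bounded sets, and compact operators -/

theorem FockSpace.exists_mem_of_fockENorm_le {m p : ℝ} {hp : 0 < p} {U : Set (FockSpace m p hp)}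
    (hU : U ∈ nhds 0) : ∃ e : ℝ≥0, 0 < e ∧ ∀ f : FockSpace m p hp, fockENorm m p f ≤ e → f ∈ U := by
  obtain ⟨d, hd, hdU⟩ := Metric.mem_nhds_iff.1 hU
  have h0 : 0 < min 1 p := lt_min one_pos hp
  refine ⟨((d / 2) ^ (min 1 p)⁻¹).toNNReal, by simp; positivity, fun f hf => hdU ?_⟩
  rw [Metric.mem_ball]
  change (fockENorm m p (⇑f - ⇑(0 : FockSpace m p hp)) ^ min 1 p).toReal < d
  have e : ⇑f - ⇑(0 : FockSpace m p hp) = ⇑f := sub_zero _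
  rw [e]
  have h1 := ENNReal.rpow_le_rpow hf h0.le
  change _ ≤ (ENNReal.ofReal _) ^ _ at h1
  rw [ENNReal.ofReal_rpow_of_nonneg (by positivity) h0.le, ← Real.rpow_mul (by positivity),
    inv_mul_cancel₀ h0.ne', Real.rpow_one] at h1
  have h2 := ENNReal.toReal_le_of_le_ofReal (by positivity) h1
  linarith

theorem FockSpace.exists_fockENorm_le_of_isCompact {m p : ℝ} {hp : 0 < p}
    {K : Set (FockSpace m p hp)} (hK : IsCompact K) :
    ∃ M : ℝ≥0, ∀ f ∈ K, fockENorm m p f ≤ M := by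
  obtain ⟨d, hd⟩ := hK.isBounded.subset_closedBall 0
  have h0 : 0 < min 1 p := lt_min one_pos hp
  refine ⟨(d.toNNReal) ^ (min 1 p)⁻¹, fun f hf => ?_⟩
  have h1 := hd hf
  rw [Metric.mem_closedBall] at h1
  change (fockENorm m p (⇑f - ⇑(0 : FockSpace m p hp)) ^ min 1 p).toReal ≤ d at h1
  have h2 := FockSpace.dist_aux_ne_top f 0
  have e : ⇑f - ⇑(0 : FockSpace m p hp) = ⇑f := sub_zero _
  rw [e] at h1 h2
  have h3 := ENNReal.ofReal_le_ofReal h1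
  rw [ENNReal.ofReal_toReal h2] at h3
  rw [ENNReal.coe_rpow_of_nonneg _ (by positivity), ENNReal.le_rpow_inv_iff h0]
  exact h3

theorem enorm_ofReal_nnreal (c : ℝ≥0) : ‖((c : ℝ) : ℂ)‖ₑ = c := by
  rw [← ofReal_norm, Complex.norm_real, Real.norm_of_nonneg c.coe_nonneg,
    ENNReal.ofReal_coe_nnreal]

theorem FockSpace.fockENorm_smul_of_nonneg {m p : ℝ} {hp : 0 < p} (c : ℝ≥0)
    (f : FockSpace m p hp) : fockENorm m p ⇑(((c : ℝ) : ℂ) • f) = c * fockENorm m p f := by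
  have : ⇑(((c : ℝ) : ℂ) • f) = ((c : ℝ) : ℂ) • ⇑f := rfl
  rw [this, fockENorm_smul m hp]
  congr 1
  exact enorm_ofReal_nnreal c

/-- A neighbourhood of zero contains a quasi-norm ball and a compact set is bounded in quasi-norm;
scaling by positive reals turns this into a linear bound. -/
theorem DerivCompact.derivBounded {m p q : ℝ} {hp : 0 < p} {hq : 0 < q}
    (h : DerivCompact m p q hp hq) : DerivBounded m p q hp hq := by
  obtain ⟨T, hT, K, hK, hKT⟩ := h
  obtain ⟨e, he0, he⟩ := FockSpace.exists_mem_of_fockENorm_le hKT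
  obtain ⟨M, hM⟩ := FockSpace.exists_fockENorm_le_of_isCompact hK
  refine ⟨T, hT, M / e, fun f => ?_⟩
  have hlin : ∀ s : ℝ≥0, s * fockENorm m p f ≤ e → s * fockENorm m q (T f) ≤ M := fun s hs => by
    rw [← FockSpace.fockENorm_smul_of_nonneg] at hs ⊢
    rw [← map_smul]
    exact hM _ (he _ hs)
  have hNt : fockENorm m p f ≠ ∞ := f.2.2.ne
  have hNt' : fockENorm m q (T f) ≠ ∞ := (T f).2.2.ne
  lift fockENorm m p f to ℝ≥0 using hNt with N
  lift fockENorm m q (T f) to ℝ≥0 using hNt' with N'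
  norm_cast at hlin ⊢
  rcases eq_or_ne N 0 with rfl | hN
  · rw [mul_zero]
    by_contra hne
    rw [not_le] at hne
    -- If the source norm is zero every scalar is allowed; this one would give image norm `M + 1`.
    have := hlin ((M + 1) / N') (by simp)
    rw [div_mul_cancel₀ _ hne.ne'] at this
    exact absurd this (by simp)
  · have := hlin (e / N) (by rw [div_mul_cancel₀ _ hN])
    rw [div_mul_eq_mul_div, div_le_iff₀ (pos_iff_ne_zero.2 hN)] at this
    rw [div_mul_eq_mul_div, le_div_iff₀ he0, mul_comm]
    exact this

theorem DerivBounded.derivOpNorm_lt_top {m p q : ℝ} {hp : 0 < p} {hq : 0 < q}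
    (h : DerivBounded m p q hp hq) : derivOpNorm m p q hp < ∞ := by
  obtain ⟨T, hT, C, hC⟩ := h
  refine lt_of_le_of_lt (iSup₂_le fun f hf => ?_) (ENNReal.coe_lt_top (r := C))
  have h1 := hC f
  rw [show ⇑(T f) = deriv f from funext (hT f)] at h1
  calc _ ≤ C * fockENorm m p f := h1
    _ ≤ C * 1 := by gcongr
    _ = C := mul_one _

/-! ### The case `p ≤ q` -/

/-- The growth exponent of the derivative of unit vectors of `F_(m,p)` localized near `w`, as
`w → ∞`, measured in `F_(m,q)`. -/
noncomputable def derivExponent (m p q : ℝ) : ℝ := (m - 1) + (q - p) * (m - 2) / (q * p)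

/-- The extra weight `(2-m)/q` is that of the pointwise estimate in the target space, and it
completes the exponent to `derivExponent`. -/
theorem exists_test_functions_deriv {m p q : ℝ} (hm : 0 < m) (hp : 0 < p) (hq : 0 < q) :
    ∃ (c : ℝ≥0) (f : ℕ → FockSpace m p hp) (z : ℕ → ℂ), 0 < c ∧
      Filter.Tendsto (fun n => ‖z n‖) Filter.atTop Filter.atTop ∧
      ∀ n, fockENorm m p (f n) ≤ 1 ∧ c * polyWeight (derivExponent m p q) (z n) ≤
        fockDensity m (deriv (f n)) (z n) * polyWeight ((2 - m) / q) (z n) := by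
  obtain ⟨c, f, z, hc, hz, hf⟩ := exists_test_functions hm hp
  refine ⟨c, fun n => ⟨f n, (hf n).1, (hf n).2.1.trans_lt ENNReal.one_lt_top⟩, z, hc, hz,
    fun n => ⟨(hf n).2.1, ?_⟩⟩
  have : derivExponent m p q = (m - 1) + (m - 2) / p + (2 - m) / q := by
    rw [derivExponent]; field_simp; ring
  rw [this, polyWeight_add, ← mul_assoc]
  exact mul_le_mul' (hf n).2.2 le_rfl

theorem exists_polyWeight_le_derivOpNorm {m p q : ℝ} (hm : 0 < m) (hp : 0 < p) (hq : 0 < q) :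
    ∃ (C : ℝ≥0) (z : ℕ → ℂ), Filter.Tendsto (fun n => ‖z n‖) Filter.atTop Filter.atTop ∧
      ∀ n, polyWeight (derivExponent m p q) (z n) ≤ C * derivOpNorm m p q hp := by
  obtain ⟨c, f, z, hc, hz, hf⟩ := exists_test_functions_deriv hm hp hq
  obtain ⟨C, hC0, hC⟩ := exists_fockDensity_le_fockENorm hm hq
  refine ⟨c⁻¹ * C, z, hz, fun n => ?_⟩
  have h1 := (hf n).2.trans (hC _ (differentiable_deriv_of_entire (f n).2.1) (z n))
  have h2 : fockENorm m q (deriv (f n)) ≤ derivOpNorm m p q hp :=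
    le_iSup₂_of_le (f n) (hf n).1 le_rfl
  rw [ENNReal.coe_mul, ENNReal.coe_inv hc.ne', mul_assoc]
  rw [← ENNReal.div_eq_inv_mul, ENNReal.le_div_iff_mul_le (by left; simpa using hc.ne') (by simp),
    mul_comm]
  exact h1.trans (by gcongr)

theorem derivOpNorm_pos {m p q : ℝ} (hm : 0 < m) (hp : 0 < p) (hq : 0 < q) :
    0 < derivOpNorm m p q hp := by
  obtain ⟨C, z, -, h⟩ := exists_polyWeight_le_derivOpNorm hm hp hq
  refine pos_iff_ne_zero.2 fun h0 => polyWeight_ne_zero (derivExponent m p q) (z 0) ?_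
  simpa [h0] using h 0

theorem derivExponent_nonpos_of_derivOpNorm_lt_top {m p q : ℝ} (hm : 0 < m) (hp : 0 < p)
    (hq : 0 < q) (h : derivOpNorm m p q hp < ∞) : derivExponent m p q ≤ 0 := by
  obtain ⟨C, z, hz, hC⟩ := exists_polyWeight_le_derivOpNorm hm hp hq
  by_contra! hk
  have h1 : Filter.Tendsto (fun n => (1 + ‖z n‖) ^ derivExponent m p q) Filter.atTop
      Filter.atTop :=
    (tendsto_rpow_atTop hk).comp (Filter.tendsto_atTop_add_const_left _ _ hz)
  set B := (C * derivOpNorm m p q hp).toReal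
  obtain ⟨n, hn⟩ := (h1.eventually_gt_atTop B).exists
  have h2 := ENNReal.toReal_mono (ENNReal.mul_ne_top ENNReal.coe_ne_top h.ne) (hC n)
  rw [polyWeight, ENNReal.toReal_ofReal (by positivity)] at h2
  exact absurd hn (not_lt.2 h2)

-- The local form of the pointwise bound improves to `o(1)` by dominated convergence: the balls
-- about `z n` have radius at most `(1+‖z n‖)/4` and eventually leave every fixed point.
open Filter Topology in
theorem tendsto_fockDensity_mul_polyWeight {m p : ℝ} (hm : 0 < m) (hp : 0 < p) {g : ℂ → ℂ}
    (hg : Differentiable ℂ g) (hgt : fockENorm m p g < ∞) {z : ℕ → ℂ}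
    (hz : Tendsto (fun n => ‖z n‖) atTop atTop) :
    Tendsto (fun n => fockDensity m g (z n) * polyWeight ((2 - m) / p) (z n)) atTop (𝓝 0) := by
  obtain ⟨C, -, hC⟩ := exists_fockDensity_le hm hp
  set I : ℕ → ℝ≥0∞ := fun n => ∫⁻ w,
    (Metric.ball (z n) (1 / 4 * (1 + ‖z n‖) ^ (1 - m / 2))).indicator
      (fun w => fockDensity m g w ^ p) w with hI
  have hmeas := (measurable_fockDensity m hg.continuous).pow_const p
  have h1 : Tendsto I atTop (𝓝 (∫⁻ _ : ℂ, 0)) := by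
    refine tendsto_lintegral_of_dominated_convergence (fun w => fockDensity m g w ^ p)
      (fun n => hmeas.indicator measurableSet_ball)
      (fun n => Eventually.of_forall fun w => Set.indicator_le_self _ _ w) ?_ ?_
    · rw [← fockENorm_rpow m hp]
      exact (ENNReal.rpow_lt_top_of_nonneg hp.le hgt.ne).ne
    · refine Eventually.of_forall fun w => tendsto_const_nhds.congr' ?_
      filter_upwards [hz.eventually_gt_atTop (1 + 2 * ‖w‖)] with n hn
      rw [Set.indicator_of_notMem]
      intro hw
      rw [Metric.mem_ball, dist_eq_norm] at hw
      have h2 := one_add_norm_rpow_le (by linarith : 1 - m / 2 ≤ 1) (z n)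
      have h3 : ‖z n‖ ≤ ‖w - z n‖ + ‖w‖ := by simpa [add_comm] using norm_sub_le w (w - z n)
      linarith [norm_nonneg w]
  rw [lintegral_zero] at h1
  have h2 : Tendsto (fun n => C * I n ^ (1 / p)) atTop (𝓝 0) := by
    have h3 := ((ENNReal.continuous_rpow_const (y := 1 / p)).tendsto _).comp h1
    rw [ENNReal.zero_rpow_of_pos (by positivity)] at h3
    simpa using ENNReal.Tendsto.const_mul h3 (Or.inr (ENNReal.coe_ne_top (r := C)))
  refine tendsto_of_tendsto_of_tendsto_of_le_of_le tendsto_const_nhds h2 (fun n => zero_le)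
    fun n => ?_
  refine (hC g hg (z n)).trans (le_of_eq ?_)
  simp only [hI]
  rw [lintegral_indicator measurableSet_ball]

-- If the exponent were nonnegative, the weighted derivatives of the test functions would stay
-- bounded below at `z n`, whereas along a convergent subsequence of images they are at most a
-- multiple of the distance to the limit `g` plus the vanishing contribution of `g`.
open Filter Topology in
theorem derivExponent_neg_of_derivCompact {m p q : ℝ} (hm : 0 < m) {hp : 0 < p} {hq : 0 < q}
    (h : DerivCompact m p q hp hq) : derivExponent m p q < 0 := by
  obtain ⟨T, hT, K, hK, hKT⟩ := h
  obtain ⟨e, he0, he⟩ := FockSpace.exists_mem_of_fockENorm_le hKT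
  obtain ⟨c, f, z, hc, hz, hf⟩ := exists_test_functions_deriv hm hp hq
  obtain ⟨C, hC0, hC⟩ := exists_fockDensity_le_fockENorm hm hq
  by_contra! hk
  obtain ⟨g, -, φ, hφ, hlim⟩ := hK.tendsto_subseq (x := fun n => T (((e : ℝ) : ℂ) • f n)) fun n => by
    refine he _ ?_
    rw [FockSpace.fockENorm_smul_of_nonneg]
    calc _ ≤ (e : ℝ≥0∞) * 1 := by gcongr; exact (hf n).1
      _ = e := mul_one _
  rw [FockSpace.tendsto_iff] at hlim
  have hzφ : Tendsto (fun n => ‖z (φ n)‖) atTop atTop := hz.comp hφ.tendsto_atTop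
  have h1 := tendsto_fockDensity_mul_polyWeight hm hq g.2.1 g.2.2 hzφ
  have h2 : Tendsto (fun n => C * fockENorm m q (⇑(T (((e : ℝ) : ℂ) • f (φ n))) - ⇑g) +
      fockDensity m g (z (φ n)) * polyWeight ((2 - m) / q) (z (φ n))) atTop (𝓝 0) := by
    have := (ENNReal.Tendsto.const_mul hlim (Or.inr (ENNReal.coe_ne_top (r := C)))).add h1
    simpa using this
  have hec : (0 : ℝ≥0∞) < e * c := by
    exact_mod_cast mul_pos he0 hc
  obtain ⟨n, hn⟩ := (h2.eventually_lt_const hec).exists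
  refine absurd hn (not_lt.2 ?_)
  set n' := φ n
  have hTn : ⇑(T (((e : ℝ) : ℂ) • f n')) = ((e : ℝ) : ℂ) • deriv (f n') := by
    rw [map_smul]
    funext w
    exact congrArg (((e : ℝ) : ℂ) * ·) (hT (f n') w)
  have h3 : (e : ℝ≥0∞) * c ≤ fockDensity m (T (((e : ℝ) : ℂ) • f n')) (z n') *
      polyWeight ((2 - m) / q) (z n') := by
    have h4 : fockDensity m (T (((e : ℝ) : ℂ) • f n')) (z n') =
        e * fockDensity m (deriv (f n')) (z n') := by
      rw [hTn, fockDensity, fockDensity, Pi.smul_apply, smul_eq_mul, enorm_mul, mul_assoc]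
      congr 1
      exact enorm_ofReal_nnreal e
    rw [h4, mul_assoc]
    refine mul_le_mul' le_rfl (le_trans ?_ (hf n').2)
    have h5 : 1 ≤ polyWeight (derivExponent m p q) (z n') := by
      rw [polyWeight, ENNReal.one_le_ofReal]
      exact Real.one_le_rpow (by linarith [norm_nonneg (z n')]) hk
    calc (c : ℝ≥0∞) = c * 1 := (mul_one _).symm
      _ ≤ _ := by gcongr
  refine h3.trans ?_
  calc _ ≤ (fockDensity m (⇑(T (((e : ℝ) : ℂ) • f n')) - ⇑g) (z n') + fockDensity m g (z n')) *
        polyWeight ((2 - m) / q) (z n') := by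
        gcongr
        exact fockDensity_sub_le _ _ _ _
    _ ≤ _ := by
      rw [add_mul]
      refine add_le_add ?_ le_rfl
      exact hC _ ((T (((e : ℝ) : ℂ) • f n')).2.1.sub g.2.1) _

/-- The exponent is affine in `m`, with positive slope `(pq+q-p)/(pq)` and its zero at the stated
threshold. -/
theorem derivExponent_nonpos_iff {m p q : ℝ} (hp : 0 < p) (hpq : p ≤ q) :
    (derivExponent m p q ≤ 0 ↔ m ≤ 2 - p * q / (p * q + q - p)) ∧
      (derivExponent m p q < 0 ↔ m < 2 - p * q / (p * q + q - p)) := by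
  have hq : 0 < q := hp.trans_le hpq
  have hpq0 : 0 < p * q := by positivity
  have hD : 0 < p * q + q - p := by linarith
  have h1 : derivExponent m p q =
      (m - (2 - p * q / (p * q + q - p))) * ((p * q + q - p) / (p * q)) := by
    have hD' := hD.ne'
    rw [derivExponent, ← mul_div_assoc, sub_sub_eq_add_sub, add_sub_right_comm, add_mul,
      div_mul_cancel₀ _ hD']
    field_simp
    ring
  have h2 : 0 < (p * q + q - p) / (p * q) := by positivity
  rw [h1]
  constructor
  · rw [← sub_nonpos (a := m)]
    exact ⟨fun h => nonpos_of_mul_nonpos_left h h2, fun h => mul_nonpos_of_nonpos_of_nonneg h h2.le⟩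
  · rw [← sub_neg (a := m)]
    exact ⟨fun h => by by_contra! h'; exact absurd h (not_lt.2 (mul_nonneg h' h2.le)),
      fun h => mul_neg_of_neg_of_pos h h2⟩

theorem derivBounded_iff_of_le {m p q : ℝ} (hm : 0 < m) (hp : 0 < p) (hq : 0 < q) (hpq : p ≤ q) :
    DerivBounded m p q hp hq ↔ derivExponent m p q ≤ 0 :=
  ⟨fun h => derivExponent_nonpos_of_derivOpNorm_lt_top hm hp hq h.derivOpNorm_lt_top,
    fun h => (derivTailBound_of_le hm hp hpq h).derivBounded hp hq⟩

theorem derivCompact_iff_of_le {m p q : ℝ} (hm : 0 < m) (hp : 0 < p) (hq : 0 < q) (hpq : p ≤ q) :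
    DerivCompact m p q hp hq ↔ derivExponent m p q < 0 :=
  ⟨fun h => derivExponent_neg_of_derivCompact hm h,
    fun h => (derivTailBound_of_le hm hp hpq h.le).derivCompact hm hp hq
      (mul_neg_of_pos_of_neg hq h)⟩

/-! ### Comparison of the operator norm with its bound. -/

theorem derivNormBound_pos_of_le {m p q : ℝ} (hm : 0 < m) : 0 < derivNormBound m p q := by
  rw [derivNormBound]
  split_ifs with h
  · exact one_pos
  · refine ENNReal.mul_pos ?_ ?_
    · rw [Ne, ENNReal.ofReal_eq_zero, not_le]
      refine Real.rpow_pos_of_pos (abs_pos.2 ?_) _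
      rw [show 2 + p = (1 + p) + 1 by ring, Real.rpow_add_one hm.ne', ← mul_sub_one]
      exact mul_ne_zero (by positivity) (sub_ne_zero.2 h)
    · refine (lt_of_lt_of_le ?_ (le_iSup _ (0 : ℂ))).ne'
      simp

theorem derivNormBound_lt_top {m p q : ℝ} (h : derivExponent m p q ≤ 0) :
    derivNormBound m p q < ∞ := by
  rw [derivNormBound]
  split_ifs with h1
  · exact ENNReal.one_lt_top
  · refine ENNReal.mul_lt_top ENNReal.ofReal_lt_top
      (lt_of_le_of_lt (iSup_le fun w => ?_) ENNReal.one_lt_top)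
    rw [ENNReal.ofReal_le_one]
    exact Real.rpow_le_one_of_one_le_of_nonpos (by linarith [norm_nonneg w]) h

/-- A positive exponent excludes `m = 1`, where the exponent is `-(q-p)/(qp)`; so the prefactor is
positive and the supremum infinite. -/
theorem derivNormBound_eq_top {m p q : ℝ} (hm : 0 < m) (hp : 0 < p) (hpq : p ≤ q)
    (h : 0 < derivExponent m p q) : derivNormBound m p q = ∞ := by
  have hq : 0 < q := hp.trans_le hpq
  have hm1 : m ≠ 1 := by
    rintro rfl
    rw [derivExponent] at h
    have : 0 ≤ (q - p) / (q * p) := div_nonneg (by linarith) (by positivity)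
    have e : (1 : ℝ) - 1 + (q - p) * (1 - 2) / (q * p) = -((q - p) / (q * p)) := by ring
    linarith
  rw [derivNormBound, if_neg hm1]
  refine ENNReal.mul_eq_top.2 (Or.inl ⟨?_, ?_⟩)
  · rw [Ne, ENNReal.ofReal_eq_zero, not_le]
    refine Real.rpow_pos_of_pos (abs_pos.2 ?_) _
    rw [show 2 + p = (1 + p) + 1 by ring, Real.rpow_add_one hm.ne', ← mul_sub_one]
    exact mul_ne_zero (by positivity) (sub_ne_zero.2 hm1)
  · refine ENNReal.eq_top_of_forall_nnreal_le fun r => ?_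
    have h1 : Filter.Tendsto (fun n : ℕ => (1 + (n : ℝ)) ^ derivExponent m p q) Filter.atTop
        Filter.atTop := (tendsto_rpow_atTop h).comp
          (Filter.tendsto_atTop_add_const_left _ _ tendsto_natCast_atTop_atTop)
    obtain ⟨n, hn⟩ := (h1.eventually_ge_atTop (r : ℝ)).exists
    refine le_trans ?_ (le_iSup _ (n : ℂ))
    rw [Complex.norm_natCast, ← ENNReal.ofReal_coe_nnreal]
    exact ENNReal.ofReal_le_ofReal hn

/-- The constants may depend on `m, p, q`, so when both quantities are finite and positive their
quotient serves as both constants; otherwise both are infinite. -/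
theorem exists_derivOpNorm_comparable {m p q : ℝ} (hm : 0 < m) (hp : 0 < p) (hq : 0 < q)
    (hpq : p ≤ q) : ∃ c C : ℝ≥0, 0 < c ∧ 0 < C ∧
      c * derivNormBound m p q ≤ derivOpNorm m p q hp ∧
      derivOpNorm m p q hp ≤ C * derivNormBound m p q := by
  rcases le_or_gt (derivExponent m p q) 0 with h | h
  · have hN := ((derivBounded_iff_of_le hm hp hq hpq).2 h).derivOpNorm_lt_top
    have hN0 := derivOpNorm_pos hm hp hq
    have hB := derivNormBound_lt_top h
    have hB0 : 0 < derivNormBound m p q := derivNormBound_pos_of_le hm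
    have hr : derivOpNorm m p q hp / derivNormBound m p q ≠ ∞ := ENNReal.div_ne_top hN.ne hB0.ne'
    have h1 : 0 < (derivOpNorm m p q hp / derivNormBound m p q).toNNReal :=
      ENNReal.toNNReal_pos (ENNReal.div_pos hN0.ne' hB.ne).ne' hr
    refine ⟨_, _, h1, h1, ?_, ?_⟩ <;>
      rw [ENNReal.coe_toNNReal hr, ENNReal.div_mul_cancel hB0.ne' hB.ne]
  · have hN : derivOpNorm m p q hp = ∞ := by
      by_contra hne
      exact absurd (derivExponent_nonpos_of_derivOpNorm_lt_top hm hp hq (lt_top_iff_ne_top.2 hne))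
        (not_le.2 h)
    refine ⟨1, 1, one_pos, one_pos, ?_, ?_⟩ <;> rw [hN, derivNormBound_eq_top hm hp hpq h] <;> simp

/-! ### Lacunary polynomials -/

/-- The coefficient that gives `z ^ (k ^ 2)` weighted maximum modulus one. -/
noncomputable def lacunaryCoeff (m : ℝ) (k : ℕ) : ℝ :=
  (√m / k) ^ (2 * (k ^ 2 / m)) * Real.exp (k ^ 2 / m)

theorem lacunaryCoeff_pos {m : ℝ} (hm : 0 < m) {k : ℕ} (hk : 0 < k) : 0 < lacunaryCoeff m k := by
  have : (0 : ℝ) < k := by exact_mod_cast hk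
  unfold lacunaryCoeff
  positivity

/-- In the coordinate `y = √m r^(m/2)` the peak is at `y = k`. The degrees `k^2` are chosen so that
consecutive peaks are at unit distance. -/
theorem lacunaryCoeff_mul_pow {m : ℝ} (hm : 0 < m) {k : ℕ} (hk : 0 < k) {r : ℝ} (hr : 0 ≤ r) :
    lacunaryCoeff m k * r ^ (k ^ 2) * Real.exp (-r ^ m) =
      (√m * r ^ (m / 2) / k) ^ (2 * (k ^ 2 / m)) *
        Real.exp (k ^ 2 / m - k ^ 2 / m * (√m * r ^ (m / 2) / k) ^ 2) := by
  have hk0 : (0 : ℝ) < k := by exact_mod_cast hk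
  have e1 : r ^ (k ^ 2) = (r ^ (m / 2)) ^ (2 * ((k : ℝ) ^ 2 / m)) := by
    rw [← Real.rpow_mul hr, ← Real.rpow_natCast]
    congr 1; push_cast; field_simp
  have e2 : r ^ m = (k : ℝ) ^ 2 / m * (√m * r ^ (m / 2) / k) ^ 2 := by
    rw [div_pow, mul_pow, Real.sq_sqrt hm.le, ← Real.rpow_natCast (r ^ (m / 2)),
      ← Real.rpow_mul hr]
    field_simp; norm_num
  rw [lacunaryCoeff, e1, sub_eq_add_neg, Real.exp_add, ← e2, mul_div_right_comm √m,
    Real.mul_rpow (by positivity) (by positivity)]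
  ring

/-- With `g = y/k`, the inequality `g ≤ e^{g-1}` leaves the exponent `-(k^2/m)(g-1)^2`. -/
theorem lacunaryCoeff_mul_pow_le {m : ℝ} (hm : 0 < m) {k : ℕ} (hk : 0 < k) {r : ℝ} (hr : 0 ≤ r) :
    lacunaryCoeff m k * r ^ (k ^ 2) * Real.exp (-r ^ m) ≤
      Real.exp (-(√m * r ^ (m / 2) - k) ^ 2 / m) := by
  have hk0 : (0 : ℝ) < k := by exact_mod_cast hk
  rw [lacunaryCoeff_mul_pow hm hk hr]
  set y := √m * r ^ (m / 2)
  have hy : 0 ≤ y := by positivity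
  set g := y / k with hg
  have hyg : y = g * k := by rw [hg, div_mul_cancel₀ _ hk0.ne']
  have h1 : g ≤ Real.exp (g - 1) := by linarith [Real.add_one_le_exp (g - 1)]
  calc _ ≤ Real.exp (g - 1) ^ (2 * ((k : ℝ) ^ 2 / m)) *
        Real.exp (k ^ 2 / m - k ^ 2 / m * g ^ 2) := by gcongr
    _ = _ := by
      rw [← Real.exp_mul, ← Real.exp_add, hyg]
      congr 1; ring

/-- From `log g ≥ 1 - 1/g` the exponent is at least `-(k(g-1))^2 (g+2)/(g m)`, where `k(g-1) = y - k
≤ 1` and `(g+2)/g ≤ 3`. -/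
theorem le_lacunaryCoeff_mul_pow {m : ℝ} (hm : 0 < m) {k : ℕ} (hk : 0 < k) {r : ℝ} (hr : 0 ≤ r)
    (h1 : k ≤ √m * r ^ (m / 2)) (h2 : √m * r ^ (m / 2) ≤ k + 1) :
    Real.exp (-3 / m) ≤ lacunaryCoeff m k * r ^ (k ^ 2) * Real.exp (-r ^ m) := by
  have hk0 : (0 : ℝ) < k := by exact_mod_cast hk
  rw [lacunaryCoeff_mul_pow hm hk hr]
  set y := √m * r ^ (m / 2)
  set g := y / k with hg
  have hyg : y = g * k := by rw [hg, div_mul_cancel₀ _ hk0.ne']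
  have hg1 : 1 ≤ g := by rw [hg, one_le_div hk0]; exact h1
  have hg0 : 0 < g := by linarith
  have h3 : Real.exp (1 - g⁻¹) ≤ g := by
    rw [← Real.le_log_iff_exp_le hg0]
    exact Real.one_sub_inv_le_log_of_pos hg0
  have h4 : (k : ℝ) ^ 2 * (g - 1) ^ 2 ≤ 1 := by
    rw [← mul_pow]
    have : (k : ℝ) * (g - 1) ≤ 1 := by linarith
    have h0 : 0 ≤ (k : ℝ) * (g - 1) := mul_nonneg hk0.le (by linarith)
    exact pow_le_one₀ h0 this
  calc Real.exp (-3 / m) ≤ Real.exp ((1 - g⁻¹) * (2 * ((k : ℝ) ^ 2 / m)) +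
        (k ^ 2 / m - k ^ 2 / m * g ^ 2)) := by
        apply Real.exp_le_exp.2
        have e : (1 - g⁻¹) * (2 * ((k : ℝ) ^ 2 / m)) + (k ^ 2 / m - k ^ 2 / m * g ^ 2) =
            -(k ^ 2 * (g - 1) ^ 2) * ((g + 2) / g) / m := by
          field_simp; ring
        rw [e]
        gcongr
        have h5 : (g + 2) / g ≤ 3 := by rw [div_le_iff₀ hg0]; linarith
        have h6 : 0 ≤ (g + 2) / g := by positivity
        nlinarith
    _ = Real.exp (1 - g⁻¹) ^ (2 * ((k : ℝ) ^ 2 / m)) *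
        Real.exp (k ^ 2 / m - k ^ 2 / m * g ^ 2) := by rw [← Real.exp_mul, ← Real.exp_add]
    _ ≤ _ := by gcongr

theorem exists_sum_exp_neg_abs_le : ∃ S : ℝ, 0 < S ∧ ∀ (y : ℝ) (s : Finset ℕ), 0 ≤ y →
    ∑ k ∈ s, Real.exp (-|y - k|) ≤ S := by
  have hsum : Summable fun i : ℤ => Real.exp (-|(i : ℝ)|) := by
    have h1 : Summable fun n : ℕ => Real.exp (-(n : ℝ)) := by
      have := Real.summable_exp_neg_nat
      exact this
    rw [summable_int_iff_summable_nat_and_neg]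
    constructor <;> refine h1.congr fun n => ?_ <;> simp
  refine ⟨Real.exp 1 * ∑' i : ℤ, Real.exp (-|(i : ℝ)|), ?_, fun y s hy => ?_⟩
  · have := hsum.tsum_pos (fun i => (Real.exp_pos _).le) 0 (Real.exp_pos _)
    positivity
  · set j := ⌊y⌋
    have h1 : ∀ k : ℕ, Real.exp (-|y - k|) ≤
        Real.exp 1 * Real.exp (-|(((k : ℤ) - j : ℤ) : ℝ)|) := by
      intro k
      rw [← Real.exp_add]
      apply Real.exp_le_exp.2
      push_cast
      have h2 : |(k : ℝ) - j| ≤ |y - k| + |y - j| := by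
        have := abs_sub_le (k : ℝ) y j
        rwa [abs_sub_comm (k : ℝ) y] at this
      have h3 : |y - j| ≤ 1 := by
        rw [abs_of_nonneg (by linarith [Int.floor_le y])]
        linarith [Int.lt_floor_add_one y]
      linarith
    have hinj : Function.Injective fun k : ℕ => (k : ℤ) - j := fun a b h => by
      simpa using h
    calc _ ≤ ∑ k ∈ s, Real.exp 1 * Real.exp (-|(((k : ℤ) - j : ℤ) : ℝ)|) :=
          Finset.sum_le_sum fun k _ => h1 k
      _ = Real.exp 1 * ∑ k ∈ s, Real.exp (-|(((k : ℤ) - j : ℤ) : ℝ)|) := by rw [Finset.mul_sum]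
      _ ≤ _ := by
        gcongr
        exact ((hsum.comp_injective hinj).sum_le_tsum s fun k _ => (Real.exp_pos _).le).trans
          (tsum_comp_le_tsum_of_inj hsum (fun i => (Real.exp_pos _).le) hinj)

theorem exists_one_add_rpow_le {m : ℝ} (hm : 0 < m) : ∃ C : ℝ, 1 ≤ C ∧ ∀ r : ℝ, 0 ≤ r →
    (1 + r) ^ (m / 2) ≤ C * (1 + √m * r ^ (m / 2)) := by
  have hs : 0 < √m := Real.sqrt_pos.2 hm
  refine ⟨2 ^ (m / 2) * (1 + (√m)⁻¹), ?_, fun r hr => ?_⟩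
  · have h1 : (1 : ℝ) ≤ 2 ^ (m / 2) := Real.one_le_rpow (by norm_num) (by positivity)
    have h2 : 0 < (√m)⁻¹ := by positivity
    nlinarith
  · have h3 : (1 + r) ^ (m / 2) ≤ 2 ^ (m / 2) * (1 + r ^ (m / 2)) := by
      rcases le_total r 1 with h | h
      · calc (1 + r) ^ (m / 2) ≤ 2 ^ (m / 2) := by gcongr; linarith
          _ ≤ _ := le_mul_of_one_le_right (by positivity) (by linarith [Real.rpow_nonneg hr (m / 2)])
      · calc (1 + r) ^ (m / 2) ≤ (2 * r) ^ (m / 2) := by gcongr; linarith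
          _ = 2 ^ (m / 2) * r ^ (m / 2) := Real.mul_rpow (by norm_num) hr
          _ ≤ _ := by gcongr; linarith
    refine h3.trans ?_
    rw [mul_assoc]
    gcongr
    have h4 : 0 ≤ r ^ (m / 2) := by positivity
    have h5 : (√m)⁻¹ * (√m * r ^ (m / 2)) = r ^ (m / 2) := by field_simp
    have h6 : 0 < (√m)⁻¹ := by positivity
    nlinarith [mul_nonneg hs.le h4]

/-- Replacing `k^{-a}` by `(1+r)^{-am/2}` costs at most a constant times `e^{A|y-k|}`, which the
Gaussian absorbs. Uniformity in `a` matters because `a` later varies with `ε`. -/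
theorem exists_sum_lacunary_le {m : ℝ} (hm : 0 < m) (A : ℝ) : ∃ C : ℝ, 0 < C ∧
    ∀ a : ℝ, 0 ≤ a → a ≤ A → ∀ (s : Finset ℕ), (∀ k ∈ s, 0 < k) → ∀ r : ℝ, 0 ≤ r →
      ∑ k ∈ s, (k : ℝ) ^ (-a) * (lacunaryCoeff m k * r ^ (k ^ 2) * Real.exp (-r ^ m)) ≤
        C * (1 + r) ^ (-(a * (m / 2))) := by
  obtain ⟨S, hS, hsum⟩ := exists_sum_exp_neg_abs_le
  obtain ⟨C0, hC0, hC⟩ := exists_one_add_rpow_le hm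
  have hC00 : 0 < C0 := by linarith
  refine ⟨(2 * C0) ^ A * Real.exp ((A + 1) ^ 2 * m / 4) * S, by positivity,
    fun a ha haA s hs r hr => ?_⟩
  set y := √m * r ^ (m / 2) with hy
  have hy0 : 0 ≤ y := by positivity
  have hterm : ∀ k ∈ s, (k : ℝ) ^ (-a) * (lacunaryCoeff m k * r ^ (k ^ 2) * Real.exp (-r ^ m)) ≤
      (2 * C0) ^ A * (1 + r) ^ (-(a * (m / 2))) * Real.exp ((A + 1) ^ 2 * m / 4) *
        Real.exp (-|y - k|) := by
    intro k hk
    have hk1 : (1 : ℝ) ≤ k := by exact_mod_cast hs k hk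
    have hk0 : (0 : ℝ) < k := by linarith
    set x := |y - k| with hx
    have hx0 : 0 ≤ x := abs_nonneg _
    have h1 : (1 + r) ^ (m / 2) ≤ 2 * C0 * (k * (1 + x)) := by
      refine (hC r hr).trans ?_
      have h2 : y ≤ k + x := by linarith [le_abs_self (y - k)]
      have h3 : 1 + y ≤ 2 * (k * (1 + x)) := by nlinarith
      nlinarith
    have h2 : (k : ℝ) ^ (-a) ≤ (2 * C0) ^ A * (1 + r) ^ (-(a * (m / 2))) * Real.exp (A * x) := by
      have h3 : ((1 + r) ^ (m / 2)) ^ a ≤ (2 * C0 * (k * (1 + x))) ^ a := by gcongr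
      rw [← Real.rpow_mul (by positivity), Real.mul_rpow (show 0 ≤ 2 * C0 by positivity) (by positivity),
        Real.mul_rpow hk0.le (by positivity)] at h3
      have h4 : (2 * C0) ^ a ≤ (2 * C0) ^ A := Real.rpow_le_rpow_of_exponent_le (by linarith) haA
      have h5 : (1 + x) ^ a ≤ Real.exp (A * x) := by
        calc (1 + x) ^ a ≤ Real.exp x ^ a := by
              gcongr; linarith [Real.add_one_le_exp x]
          _ = Real.exp (x * a) := by rw [Real.exp_mul]
          _ ≤ _ := Real.exp_le_exp.2 (by rw [mul_comm]; gcongr)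
      have hr1 : 0 < (1 + r) ^ (a * (m / 2)) := Real.rpow_pos_of_pos (by linarith) _
      have hk2 : 0 < (k : ℝ) ^ a := Real.rpow_pos_of_pos hk0 _
      rw [Real.rpow_neg hk0.le, Real.rpow_neg (by linarith), mul_assoc, inv_mul_eq_div,
        ← mul_div_assoc, le_div_iff₀ hr1, inv_mul_le_iff₀ hk2]
      rw [mul_comm (m / 2) a] at h3
      calc _ ≤ _ := h3
        _ ≤ (2 * C0) ^ A * (k ^ a * Real.exp (A * x)) := by gcongr
        _ = _ := by ring
    have h3 := lacunaryCoeff_mul_pow_le hm (hs k hk) hr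
    rw [← hy, ← sq_abs, ← hx] at h3
    -- Completing the square, keeping one factor `e^{-x}` to make the sum over `k` converge.
    have h4 : Real.exp (A * x) * Real.exp (-x ^ 2 / m) ≤
        Real.exp ((A + 1) ^ 2 * m / 4) * Real.exp (-x) := by
      rw [← Real.exp_add, ← Real.exp_add]
      apply Real.exp_le_exp.2
      have h5 : (A + 1) ^ 2 * m / 4 + -x - (A * x + -x ^ 2 / m) =
          (x - (A + 1) * m / 2) ^ 2 / m := by field_simp; ring
      have h6 : 0 ≤ (x - (A + 1) * m / 2) ^ 2 / m := by positivity
      linarith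
    calc _ ≤ ((2 * C0) ^ A * (1 + r) ^ (-(a * (m / 2))) * Real.exp (A * x)) *
          Real.exp (-x ^ 2 / m) := by
          have := (lacunaryCoeff_pos hm (hs k hk)).le
          gcongr
      _ = (2 * C0) ^ A * (1 + r) ^ (-(a * (m / 2))) *
          (Real.exp (A * x) * Real.exp (-x ^ 2 / m)) := by ring
      _ ≤ (2 * C0) ^ A * (1 + r) ^ (-(a * (m / 2))) *
          (Real.exp ((A + 1) ^ 2 * m / 4) * Real.exp (-x)) := by gcongr
      _ = _ := by ring
  refine (Finset.sum_le_sum hterm).trans ?_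
  rw [← Finset.mul_sum]
  calc _ ≤ (2 * C0) ^ A * (1 + r) ^ (-(a * (m / 2))) * Real.exp ((A + 1) ^ 2 * m / 4) * S := by
        gcongr
        exact hsum y s hy0
    _ = _ := by ring

/-- Differentiation multiplies the monomial by `k^2/r`, and `y ≤ k + 1 ≤ 2k` gives `k^2/r ≥ (m/4)
r^{m-1}`. The constant `B` allows `r` to be replaced by `1 + r`, since `y ≥ 1` keeps `r` away from
zero; `D` compares `k` with `(1+r)^{m/2}`. -/
theorem exists_le_lacunary_deriv {m : ℝ} (hm : 0 < m) (A : ℝ) : ∃ c : ℝ, 0 < c ∧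
    ∀ a : ℝ, 0 ≤ a → a ≤ A → ∀ k : ℕ, 0 < k → ∀ r : ℝ, 0 ≤ r →
      k ≤ √m * r ^ (m / 2) → √m * r ^ (m / 2) ≤ k + 1 →
      c * (1 + r) ^ ((m - 1) - a * (m / 2)) ≤
        (k : ℝ) ^ (-a) * (lacunaryCoeff m k * (k ^ 2 * r ^ (k ^ 2 - 1)) * Real.exp (-r ^ m)) := by
  have hs : 0 < √m := Real.sqrt_pos.2 hm
  set B := 1 + (√m) ^ (2 / m) with hB
  have hB0 : 0 < B := by positivity
  set D := 1 + √m with hD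
  refine ⟨(B ^ |m - 1|)⁻¹ * (D ^ A)⁻¹ * (m / 4) * Real.exp (-3 / m), by positivity,
    fun a ha haA k hk r hr h1 h2 => ?_⟩
  have hk1 : (1 : ℝ) ≤ k := by exact_mod_cast hk
  have hk0 : (0 : ℝ) < k := by linarith
  set y := √m * r ^ (m / 2) with hy
  have hr0 : 0 < r := by
    rcases hr.eq_or_lt with h | h
    · rw [← h, Real.zero_rpow (by positivity), mul_zero] at hy
      linarith
    · exact h
  have h3 := le_lacunaryCoeff_mul_pow hm hk hr h1 h2
  have hpow : r ^ (k ^ 2 - 1) = r ^ (k ^ 2) / r := by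
    rw [eq_div_iff hr0.ne', ← pow_succ, Nat.sub_add_cancel (Nat.pow_pos hk)]
  have hr1 : 1 + r ≤ B * r := by
    have h4 : 1 ≤ (√m) ^ (2 / m) * r := by
      have h5 : (1 : ℝ) ≤ y ^ (2 / m) := Real.one_le_rpow (by linarith) (by positivity)
      rw [hy, Real.mul_rpow hs.le (by positivity), ← Real.rpow_mul hr,
        show m / 2 * (2 / m) = 1 by field_simp, Real.rpow_one] at h5
      exact h5
    rw [hB]; linarith
  have h4 : (1 + r) ^ (m - 1) ≤ B ^ |m - 1| * r ^ (m - 1) := by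
    refine rpow_le_rpow_abs_mul hB0 (by linarith) hr1 ?_ _
    have : 1 ≤ B := by rw [hB]; linarith [Real.rpow_nonneg hs.le (2 / m)]
    nlinarith
  have h5 : (1 + r) ^ (-(a * (m / 2))) ≤ D ^ A * (k : ℝ) ^ (-a) := by
    have h6 : (k : ℝ) ≤ D * (1 + r) ^ (m / 2) := by
      refine h1.trans ?_
      rw [hy]
      have : r ^ (m / 2) ≤ (1 + r) ^ (m / 2) := by gcongr; linarith
      gcongr
      linarith
    have h7 : (k : ℝ) ^ a ≤ (D * (1 + r) ^ (m / 2)) ^ a := by gcongr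
    rw [Real.mul_rpow (by positivity) (by positivity), ← Real.rpow_mul (by positivity)] at h7
    have h8 : D ^ a ≤ D ^ A := Real.rpow_le_rpow_of_exponent_le (by linarith) haA
    have hr2 : 0 < (1 + r) ^ (a * (m / 2)) := Real.rpow_pos_of_pos (by linarith) _
    have hk2 : 0 < (k : ℝ) ^ a := Real.rpow_pos_of_pos hk0 _
    rw [Real.rpow_neg (by linarith), Real.rpow_neg hk0.le, ← div_eq_mul_inv, le_div_iff₀ hk2,
      inv_mul_le_iff₀ hr2, mul_comm]
    rw [mul_comm (m / 2) a] at h7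
    exact h7.trans (by gcongr)
  have h6 : m / 4 * r ^ (m - 1) ≤ (k : ℝ) ^ 2 / r := by
    rw [le_div_iff₀ hr0, mul_assoc, ← Real.rpow_add_one hr0.ne', sub_add_cancel]
    have h7 : y ^ 2 = m * r ^ m := by
      rw [hy, mul_pow, Real.sq_sqrt hm.le, ← Real.rpow_natCast, ← Real.rpow_mul hr]
      norm_num
    have h8 : y ^ 2 ≤ (2 * k) ^ 2 := by
      have : 0 ≤ y := by positivity
      gcongr; linarith
    nlinarith
  have hB1 : 0 < B ^ |m - 1| := by positivity
  have hD1 : 0 < D ^ A := by positivity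
  have hsub : (1 + r) ^ ((m - 1) - a * (m / 2)) =
      (1 + r) ^ (m - 1) * (1 + r) ^ (-(a * (m / 2))) := by
    rw [← Real.rpow_add (by linarith)]; ring_nf
  rw [hsub, hpow]
  calc _ = ((B ^ |m - 1|)⁻¹ * (1 + r) ^ (m - 1)) * ((D ^ A)⁻¹ * (1 + r) ^ (-(a * (m / 2)))) *
        (m / 4) * Real.exp (-3 / m) := by ring
    _ ≤ r ^ (m - 1) * (k : ℝ) ^ (-a) * (m / 4) *
        (lacunaryCoeff m k * r ^ (k ^ 2) * Real.exp (-r ^ m)) := by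
        have e1 : (B ^ |m - 1|)⁻¹ * (1 + r) ^ (m - 1) ≤ r ^ (m - 1) := by
          rwa [inv_mul_le_iff₀ hB1]
        have e2 : (D ^ A)⁻¹ * (1 + r) ^ (-(a * (m / 2))) ≤ (k : ℝ) ^ (-a) := by
          rwa [inv_mul_le_iff₀ hD1]
        gcongr
    _ = (m / 4 * r ^ (m - 1)) * ((k : ℝ) ^ (-a) *
        (lacunaryCoeff m k * r ^ (k ^ 2) * Real.exp (-r ^ m))) := by ring
    _ ≤ (k : ℝ) ^ 2 / r * ((k : ℝ) ^ (-a) *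
        (lacunaryCoeff m k * r ^ (k ^ 2) * Real.exp (-r ^ m))) := by
        have := (lacunaryCoeff_pos hm hk).le
        gcongr
    _ = _ := by ring

theorem integral_Ioi_mul_one_add_rpow {e : ℝ} (he : 0 < e) :
    ∫ y in Set.Ioi (0 : ℝ), y * (1 + y) ^ (-2 - e) = 1 / (e * (1 + e)) := by
  have hd : ∀ y ∈ Set.Ici (0 : ℝ), HasDerivAt
      (fun y : ℝ => (1 + y) ^ (-e) / (-e) - (1 + y) ^ (-1 - e) / (-1 - e))
      (y * (1 + y) ^ (-2 - e)) y := by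
    intro y hy
    have hy0 : 0 < 1 + y := by have : (0 : ℝ) ≤ y := hy; linarith
    have h1 : HasDerivAt (fun y : ℝ => 1 + y) 1 y := (hasDerivAt_id y).const_add 1
    have h2 := (h1.rpow_const (p := -e) (Or.inl hy0.ne')).div_const (-e)
    have h3 := (h1.rpow_const (p := -1 - e) (Or.inl hy0.ne')).div_const (-1 - e)
    refine (h2.fun_sub h3).congr_deriv ?_
    have h4 : -1 - e ≠ 0 := by linarith
    rw [show -e - 1 = (-2 - e) + 1 by ring, show -1 - e - 1 = -2 - e by ring,
      Real.rpow_add_one hy0.ne']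
    field_simp
    ring
  have h1 : Filter.Tendsto (fun y : ℝ => 1 + y) Filter.atTop Filter.atTop :=
    Filter.tendsto_atTop_add_const_left _ _ Filter.tendsto_id
  have ht : Filter.Tendsto (fun y : ℝ => (1 + y) ^ (-e) / (-e) - (1 + y) ^ (-1 - e) / (-1 - e))
      Filter.atTop (nhds 0) := by
    have h2 := ((tendsto_rpow_neg_atTop he).comp h1).div_const (-e)
    have h3 := ((tendsto_rpow_neg_atTop (by linarith : 0 < 1 + e)).comp h1).div_const (-1 - e)
    have h4 := h2.sub h3
    simp only [zero_div, sub_zero] at h4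
    refine h4.congr fun y => ?_
    simp only [Function.comp]
    rw [show -(1 + e) = -1 - e by ring]
  rw [integral_Ioi_of_hasDerivAt_of_nonneg' hd (fun y hy => ?_) ht]
  · have h4 : 1 + e ≠ 0 := by linarith
    rw [add_zero, Real.one_rpow, Real.one_rpow, show -1 - e = -(1 + e) by ring]
    field_simp
    ring
  · have : (0 : ℝ) < y := hy
    positivity

/-- Only the blow-up rate `1/e` as `e → 0` matters. -/
theorem lintegral_polyWeight {e : ℝ} (he : 0 < e) :
    ∫⁻ z, polyWeight (-2 - e) z = ENNReal.ofReal (2 * Real.pi / (e * (1 + e))) := by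
  have hint : Integrable (fun z : ℂ => (1 + ‖z‖) ^ (-2 - e)) := by
    have := integrable_one_add_norm (E := ℂ) (μ := volume) (r := 2 + e)
      (by rw [Complex.finrank_real_complex]; push_cast; linarith)
    rwa [show -(2 + e) = -2 - e by ring] at this
  have hval : ∫ z : ℂ, (1 + ‖z‖) ^ (-2 - e) = 2 * Real.pi / (e * (1 + e)) := by
    have := integral_fun_norm_addHaar (volume : Measure ℂ) (fun y : ℝ => (1 + y) ^ (-2 - e))
    rw [this, Complex.finrank_real_complex]
    simp only [Nat.add_one_sub_one, pow_one, smul_eq_mul]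
    rw [integral_Ioi_mul_one_add_rpow he]
    have hb : volume.real (Metric.ball (0 : ℂ) 1) = Real.pi := by
      rw [Measure.real, Complex.volume_ball]; simp
    rw [hb, nsmul_eq_mul]
    push_cast
    ring
  unfold polyWeight
  rw [← ofReal_integral_eq_lintegral_ofReal hint, hval]
  exact Filter.Eventually.of_forall fun z => by positivity

/-! ### Averaging over signs -/

/-- Flipping the `i`-th sign changes the sum by `±2 x i`, so one sum of each such pair has modulus
at least `‖x i‖`. This weak form of Khinchine's inequality suffices because a single term carries
the lower bound. -/
theorem card_mul_enorm_rpow_le_sum_signs {N : ℕ} (x : Fin N → ℂ) {q : ℝ} (hq : 0 ≤ q) (i : Fin N) :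
    (Fintype.card (Fin N → ℤˣ) : ℝ≥0∞) * ‖x i‖ₑ ^ q ≤
      2 * ∑ s : Fin N → ℤˣ, ‖∑ j, ((s j : ℤ) : ℂ) * x j‖ₑ ^ q := by
  set Φ : (Fin N → ℤˣ) → ℂ := fun s => ∑ j, ((s j : ℤ) : ℂ) * x j with hΦ
  set d : Fin N → ℤˣ := Pi.mulSingle i (-1) with hd
  have h1 : ∑ s, ‖Φ (s * d)‖ₑ ^ q = ∑ s, ‖Φ s‖ₑ ^ q :=
    Equiv.sum_comp (Equiv.mulRight d) fun s => ‖Φ s‖ₑ ^ q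
  have h2 : ∀ s, Φ s - Φ (s * d) = 2 * (((s i : ℤ) : ℂ) * x i) := by
    intro s
    rw [hΦ]
    simp only [Pi.mul_apply]
    rw [← Finset.sum_sub_distrib, Finset.sum_eq_single i]
    · rw [hd, Pi.mulSingle_eq_same]
      push_cast; ring
    · intro j _ hj
      rw [hd, Pi.mulSingle_eq_of_ne hj, mul_one, sub_self]
    · intro h; exact absurd (Finset.mem_univ i) h
  have h3 : ∀ s, ‖x i‖ₑ ^ q ≤ ‖Φ s‖ₑ ^ q + ‖Φ (s * d)‖ₑ ^ q := by
    intro s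
    have h4 : 2 * ‖x i‖ ≤ ‖Φ s‖ + ‖Φ (s * d)‖ := by
      refine le_trans (le_of_eq ?_) (norm_sub_le _ _)
      rw [h2, norm_mul, norm_mul]
      rcases Int.units_eq_one_or (s i) with h | h <;> simp [h]
    have hmono : ∀ y : ℂ, ‖x i‖ ≤ ‖y‖ → ‖x i‖ₑ ^ q ≤ ‖y‖ₑ ^ q := fun y hy =>
      ENNReal.rpow_le_rpow (by
        rw [← ofReal_norm, ← ofReal_norm]; exact ENNReal.ofReal_le_ofReal hy) hq
    rcases le_total ‖Φ s‖ ‖Φ (s * d)‖ with h | h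
    · exact (hmono _ (by linarith)).trans le_add_self
    · exact (hmono _ (by linarith)).trans le_self_add
  calc _ = ∑ s : Fin N → ℤˣ, ‖x i‖ₑ ^ q := by
        rw [Finset.sum_const, nsmul_eq_mul, Finset.card_univ]
    _ ≤ ∑ s, (‖Φ s‖ₑ ^ q + ‖Φ (s * d)‖ₑ ^ q) := Finset.sum_le_sum fun s _ => h3 s
    _ = 2 * ∑ s, ‖Φ s‖ₑ ^ q := by rw [Finset.sum_add_distrib, h1, two_mul]

/-- The lacunary polynomial with signs `s`. -/
noncomputable def lacunaryPoly (m a : ℝ) {N : ℕ} (s : Fin N → ℤˣ) (z : ℂ) : ℂ :=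
  ∑ j : Fin N, ((s j : ℤ) : ℂ) *
    ((((j + 1 : ℕ) : ℝ) ^ (-a) * lacunaryCoeff m (j + 1) : ℝ) * z ^ ((j + 1 : ℕ) ^ 2))

theorem differentiable_lacunaryPoly (m a : ℝ) {N : ℕ} (s : Fin N → ℤˣ) :
    Differentiable ℂ (lacunaryPoly m a s) := by
  unfold lacunaryPoly
  fun_prop

theorem deriv_lacunaryPoly (m a : ℝ) {N : ℕ} (s : Fin N → ℤˣ) (z : ℂ) :
    deriv (lacunaryPoly m a s) z = ∑ j : Fin N, ((s j : ℤ) : ℂ) *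
      ((((j + 1 : ℕ) : ℝ) ^ (-a) * lacunaryCoeff m (j + 1) : ℝ) *
        (((j + 1 : ℕ) ^ 2 : ℕ) * z ^ ((j + 1 : ℕ) ^ 2 - 1))) := by
  refine HasDerivAt.deriv ?_
  unfold lacunaryPoly
  exact HasDerivAt.fun_sum fun j _ => ((hasDerivAt_pow _ z).const_mul _).const_mul _

theorem norm_units_int (u : ℤˣ) : ‖((u : ℤ) : ℂ)‖ = 1 := by
  rcases Int.units_eq_one_or u with h | h <;> simp [h]

theorem exists_fockDensity_lacunaryPoly_le {m : ℝ} (hm : 0 < m) (A : ℝ) : ∃ C : ℝ≥0, ∀ a : ℝ,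
    0 ≤ a → a ≤ A → ∀ (N : ℕ) (s : Fin N → ℤˣ) (z : ℂ),
      fockDensity m (lacunaryPoly m a s) z ≤ C * polyWeight (-(a * (m / 2))) z := by
  obtain ⟨C, hC, h⟩ := exists_sum_lacunary_le hm A
  refine ⟨C.toNNReal, fun a ha haA N s z => ?_⟩
  have h1 := h a ha haA (Finset.univ.map (Fin.valEmbedding.trans (addRightEmbedding 1) : Fin N ↪ ℕ))
    (fun k hk => by obtain ⟨j, -, rfl⟩ := Finset.mem_map.1 hk; exact Nat.succ_pos _)
    ‖z‖ (norm_nonneg z)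
  rw [Finset.sum_map] at h1
  change _ ≤ ENNReal.ofReal C * ENNReal.ofReal _
  rw [fockDensity, ← ofReal_norm, ← ENNReal.ofReal_mul (norm_nonneg _), ← ENNReal.ofReal_mul hC.le]
  refine ENNReal.ofReal_le_ofReal (le_trans ?_ h1)
  rw [lacunaryPoly]
  refine (mul_le_mul_of_nonneg_right (norm_sum_le _ _) (Real.exp_pos _).le).trans ?_
  rw [Finset.sum_mul]
  refine Finset.sum_le_sum fun j _ => le_of_eq ?_
  have := lacunaryCoeff_pos hm (Nat.succ_pos j)
  rw [norm_mul, norm_units_int, one_mul, norm_mul, Complex.norm_real,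
    Real.norm_of_nonneg (by positivity), norm_pow]
  simp only [Function.Embedding.trans_apply, Fin.valEmbedding_apply, addRightEmbedding_apply]
  ring

/-- The parameter `a = 2(2+e)/(mp)` makes the `p`-th power of the weighted modulus
`O((1+‖z‖)^{-2-e})`, just integrable. -/
theorem fockENorm_lacunaryPoly_rpow_le {m p : ℝ} (hm : 0 < m) (hp : 0 < p) : ∃ C : ℝ≥0,
    ∀ e : ℝ, 0 < e → e ≤ 1 → ∀ (N : ℕ) (s : Fin N → ℤˣ),
      fockENorm m p (lacunaryPoly m (2 * (2 + e) / (m * p)) s) ^ p ≤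
        C * ENNReal.ofReal (2 * Real.pi / (e * (1 + e))) := by
  obtain ⟨C, hC⟩ := exists_fockDensity_lacunaryPoly_le hm (6 / (m * p))
  refine ⟨C ^ p, fun e he he1 N s => ?_⟩
  rw [fockENorm_rpow m hp, ← lintegral_polyWeight he, ENNReal.coe_rpow_of_nonneg _ hp.le,
    ← lintegral_const_mul' _ _ (ENNReal.rpow_ne_top_of_nonneg hp.le ENNReal.coe_ne_top)]
  refine lintegral_mono fun z => ?_
  have h1 := ENNReal.rpow_le_rpow (hC (2 * (2 + e) / (m * p)) (by positivity)
    (by gcongr; linarith) N s z) hp.le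
  rw [ENNReal.mul_rpow_of_nonneg _ _ hp.le, polyWeight_rpow] at h1
  convert! h1 using 3
  field_simp
  ring

/-- On the region the dominant index `⌊y⌋` lies between `1` and `N`, so the sign average of the
derivative is bounded below by that term; integration and division by the number of sign patterns
follow. -/
theorem exists_lintegral_region_le {m p q : ℝ} (hm : 0 < m) (hp : 0 < p) (hq : 0 < q) :
    ∃ c : ℝ≥0, 0 < c ∧ ∀ e : ℝ, 0 < e → e ≤ 1 → ∀ (N : ℕ) (M : ℝ≥0∞),
      (∀ s : Fin N → ℤˣ,
        fockENorm m q (deriv (lacunaryPoly m (2 * (2 + e) / (m * p)) s)) ^ q ≤ M) →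
      c * ∫⁻ z in {z : ℂ | 1 ≤ √m * ‖z‖ ^ (m / 2) ∧ √m * ‖z‖ ^ (m / 2) < N + 1},
        polyWeight (q * ((m - 1) - (2 + e) / p)) z ≤ M := by
  obtain ⟨c, hc, h⟩ := exists_le_lacunary_deriv hm (6 / (m * p))
  refine ⟨2⁻¹ * c.toNNReal ^ q, mul_pos (by norm_num) (NNReal.rpow_pos (by simpa using hc)),
    fun e he he1 N M hM => ?_⟩
  set a := 2 * (2 + e) / (m * p) with ha
  have ha0 : 0 ≤ a := by positivity
  have haA : a ≤ 6 / (m * p) := by rw [ha]; gcongr; linarith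
  set S : Set ℂ := {z : ℂ | 1 ≤ √m * ‖z‖ ^ (m / 2) ∧ √m * ‖z‖ ^ (m / 2) < N + 1} with hS
  have hym : Measurable fun z : ℂ => √m * ‖z‖ ^ (m / 2) := by fun_prop
  have hSm : MeasurableSet S :=
    (measurableSet_le measurable_const hym).inter (measurableSet_lt hym measurable_const)
  set n : ℝ≥0∞ := (Fintype.card (Fin N → ℤˣ) : ℝ≥0∞) with hn
  have hn0 : n ≠ 0 := by rw [hn]; exact_mod_cast Fintype.card_ne_zero
  have hnt : n ≠ ∞ := ENNReal.natCast_ne_top _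
  set cq : ℝ≥0∞ := ENNReal.ofReal c ^ q with hcq
  have hcqt : cq ≠ ∞ := ENNReal.rpow_ne_top_of_nonneg hq.le ENNReal.ofReal_ne_top
  have hpt : ∀ z ∈ S, n * (cq * polyWeight (q * ((m - 1) - (2 + e) / p)) z) ≤
      2 * ∑ s : Fin N → ℤˣ, fockDensity m (deriv (lacunaryPoly m a s)) z ^ q := by
    intro z hz
    set y := √m * ‖z‖ ^ (m / 2) with hy
    have hy0 : 0 ≤ y := by positivity
    set k := ⌊y⌋₊ with hk
    have hk1 : 1 ≤ k := by rw [hk, Nat.one_le_floor_iff]; exact hz.1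
    have hkN : k < N + 1 := by
      rw [hk, Nat.floor_lt hy0]; exact_mod_cast hz.2
    -- The summand with index `j` has frequency `(j+1)^2`, hence the shift.
    set i : Fin N := ⟨k - 1, by omega⟩ with hi
    have hik : (i : ℕ) + 1 = k := by rw [hi]; simp only; omega
    have h1 := h a ha0 haA k hk1 ‖z‖ (norm_nonneg z) (Nat.floor_le hy0) (Nat.lt_floor_add_one y).le
    set E := ENNReal.ofReal (Real.exp (-‖z‖ ^ m)) with hE
    set x : Fin N → ℂ := fun j => ((((j + 1 : ℕ) : ℝ) ^ (-a) * lacunaryCoeff m (j + 1) : ℝ) *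
        (((j + 1 : ℕ) ^ 2 : ℕ) * z ^ ((j + 1 : ℕ) ^ 2 - 1))) with hx
    have h2 := card_mul_enorm_rpow_le_sum_signs x hq.le i
    have h3 : ENNReal.ofReal c * polyWeight ((m - 1) - (2 + e) / p) z ≤ ‖x i‖ₑ * E := by
      rw [polyWeight, ← ENNReal.ofReal_mul hc.le, hE, ← ofReal_norm,
        ← ENNReal.ofReal_mul (norm_nonneg _)]
      refine ENNReal.ofReal_le_ofReal ?_
      have e1 : a * (m / 2) = (2 + e) / p := by rw [ha]; field_simp
      rw [e1] at h1
      refine h1.trans (le_of_eq ?_)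
      have hkpos := lacunaryCoeff_pos hm hk1
      rw [hx]
      simp only [hik]
      rw [norm_mul, Complex.norm_real, Real.norm_of_nonneg (by positivity), norm_mul, norm_pow,
        Complex.norm_natCast]
      push_cast
      ring
    have h4 : ∀ s : Fin N → ℤˣ, fockDensity m (deriv (lacunaryPoly m a s)) z ^ q =
        ‖∑ j, ((s j : ℤ) : ℂ) * x j‖ₑ ^ q * E ^ q := by
      intro s
      rw [fockDensity, deriv_lacunaryPoly, ENNReal.mul_rpow_of_nonneg _ _ hq.le]
    simp_rw [h4]
    rw [← Finset.sum_mul, ← mul_assoc 2]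
    calc _ ≤ n * (‖x i‖ₑ * E) ^ q := by
          refine mul_le_mul' le_rfl ?_
          refine le_trans (le_of_eq ?_) (ENNReal.rpow_le_rpow h3 hq.le)
          rw [ENNReal.mul_rpow_of_nonneg _ _ hq.le, polyWeight_rpow, mul_comm q]
      _ = n * ‖x i‖ₑ ^ q * E ^ q := by rw [ENNReal.mul_rpow_of_nonneg _ _ hq.le, mul_assoc]
      _ ≤ _ := mul_le_mul' h2 le_rfl
  have hmeas : ∀ s : Fin N → ℤˣ,
      Measurable fun z => fockDensity m (deriv (lacunaryPoly m a s)) z ^ q := fun s =>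
    (measurable_fockDensity m (differentiable_deriv_of_entire
      (differentiable_lacunaryPoly m a s)).continuous).pow_const q
  have hint : n * (cq * ∫⁻ z in S, polyWeight (q * ((m - 1) - (2 + e) / p)) z) ≤ 2 * (n * M) := by
    rw [← lintegral_const_mul' _ _ hcqt, ← lintegral_const_mul' _ _ hnt]
    refine (setLIntegral_mono' hSm hpt).trans ?_
    rw [lintegral_const_mul' _ _ ENNReal.ofNat_ne_top, lintegral_finsetSum _ fun s _ => hmeas s]
    gcongr
    calc _ ≤ ∑ s : Fin N → ℤˣ, M := Finset.sum_le_sum fun s _ => by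
            refine (setLIntegral_le_lintegral _ _).trans ?_
            rw [← fockENorm_rpow m hq]
            exact hM s
      _ = n * M := by rw [Finset.sum_const, nsmul_eq_mul, Finset.card_univ]
  rw [mul_left_comm 2 n M, ENNReal.mul_le_mul_iff_right hn0 hnt] at hint
  rw [ENNReal.coe_mul, ENNReal.coe_rpow_of_nonneg _ hq.le, mul_assoc]
  have e2 : ((2⁻¹ : ℝ≥0) : ℝ≥0∞) = 2⁻¹ := by rw [ENNReal.coe_inv two_ne_zero]; rfl
  rw [e2, ← ENNReal.div_eq_inv_mul]
  exact ENNReal.div_le_of_le_mul' hint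

/-! ### Necessity of the condition on `m` when `q < p`. -/

/-- The regions exhaust `y ≥ 1` as `N → ∞`, with bounds independent of `N`. The remaining disc
contributes the constant `L`, uniform in `e` because the exponent decreases with `e`. -/
theorem exists_lintegral_polyWeight_le_of_derivBounded {m p q : ℝ} (hm : 0 < m) {hp : 0 < p}
    {hq : 0 < q} (h : DerivBounded m p q hp hq) : ∃ K L : ℝ≥0, ∀ e : ℝ, 0 < e → e ≤ 1 →
      ∫⁻ z, polyWeight (q * ((m - 1) - (2 + e) / p)) z ≤
        K * ENNReal.ofReal (2 * Real.pi / (e * (1 + e))) ^ (q / p) + L := by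
  obtain ⟨T, hT, C, hC⟩ := h
  obtain ⟨c, hc, hreg⟩ := exists_lintegral_region_le hm hp hq
  obtain ⟨C', hC'⟩ := fockENorm_lacunaryPoly_rpow_le hm hp
  have hs : 0 < √m := Real.sqrt_pos.2 hm
  set B : ℝ := (√m)⁻¹ ^ (2 / m) with hB
  obtain ⟨D, hD⟩ := (isCompact_closedBall (0 : ℂ) B).exists_bound_of_continuousOn
    (f := fun z => (1 + ‖z‖) ^ |q * ((m - 1) - 2 / p)|)
    ((continuous_const.add continuous_norm).rpow_const
      fun z => Or.inl (one_add_norm_pos z).ne').continuousOn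
  have hvol : volume (Metric.closedBall (0 : ℂ) B) ≠ ∞ := measure_closedBall_lt_top.ne
  refine ⟨c⁻¹ * (C ^ q * C' ^ (q / p)), D.toNNReal * (volume (Metric.closedBall (0 : ℂ) B)).toNNReal,
    fun e he he1 => ?_⟩
  set J := ENNReal.ofReal (2 * Real.pi / (e * (1 + e))) with hJ
  set w := q * ((m - 1) - (2 + e) / p) with hw
  set S : ℕ → Set ℂ := fun N => {z : ℂ | 1 ≤ √m * ‖z‖ ^ (m / 2) ∧ √m * ‖z‖ ^ (m / 2) < N + 1}
    with hS
  have hM : ∀ N, c * ∫⁻ z in S N, polyWeight w z ≤ C ^ q * C' ^ (q / p) * J ^ (q / p) := by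
    intro N
    refine hreg e he he1 N _ fun s => ?_
    set F := lacunaryPoly m (2 * (2 + e) / (m * p)) s
    have h1 : fockENorm m p F ^ p ≤ C' * J := hC' e he he1 N s
    have hFt : fockENorm m p F < ∞ := by
      rw [← ENNReal.rpow_lt_top_iff_of_pos hp]
      exact h1.trans_lt (ENNReal.mul_lt_top ENNReal.coe_lt_top ENNReal.ofReal_lt_top)
    let F' : FockSpace m p hp := ⟨F, differentiable_lacunaryPoly m _ s, hFt⟩
    have h2 := hC F'
    rw [show ⇑(T F') = deriv F from funext (hT F')] at h2
    have h3 := ENNReal.rpow_le_rpow h2 hq.le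
    have h4 := ENNReal.rpow_le_rpow h1 (by positivity : 0 ≤ q / p)
    rw [← ENNReal.rpow_mul, mul_div_cancel₀ _ hp.ne',
      ENNReal.mul_rpow_of_nonneg _ _ (by positivity)] at h4
    rw [ENNReal.mul_rpow_of_nonneg _ _ hq.le] at h3
    rw [mul_assoc]
    exact h3.trans (mul_le_mul' le_rfl h4)
  have hun : ∫⁻ z in ⋃ N, S N, polyWeight w z ≤ (c : ℝ≥0∞)⁻¹ * (C ^ q * C' ^ (q / p)) *
      J ^ (q / p) := by
    rw [setLIntegral_iUnion_of_directed]
    · refine iSup_le fun N => ?_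
      rw [mul_assoc, ← ENNReal.div_eq_inv_mul,
        ENNReal.le_div_iff_mul_le (by left; simpa using hc.ne') (by left; simp), mul_comm]
      exact hM N
    · refine directed_of_isDirected_le fun N N' hNN z hz => ⟨hz.1, hz.2.trans_le ?_⟩
      have : (N : ℝ) ≤ N' := by exact_mod_cast hNN
      linarith
  have hcover : (Set.univ : Set ℂ) ⊆ (⋃ N, S N) ∪ Metric.closedBall 0 B := by
    intro z _
    by_cases hz : 1 ≤ √m * ‖z‖ ^ (m / 2)
    · left
      obtain ⟨N, hN⟩ := exists_nat_gt (√m * ‖z‖ ^ (m / 2))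
      exact Set.mem_iUnion.2 ⟨N, hz, by linarith⟩
    · right
      rw [mem_closedBall_zero_iff]
      push Not at hz
      have h1 : ‖z‖ ^ (m / 2) ≤ (√m)⁻¹ := by
        rw [← one_div, le_div_iff₀ hs]; linarith
      have h2 : (‖z‖ ^ (m / 2)) ^ (2 / m) ≤ B := by rw [hB]; gcongr
      rwa [← Real.rpow_mul (norm_nonneg _), show m / 2 * (2 / m) = 1 by field_simp,
        Real.rpow_one] at h2
  have hball : ∫⁻ z in Metric.closedBall 0 B, polyWeight w z ≤
      ENNReal.ofReal D * volume (Metric.closedBall (0 : ℂ) B) := by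
    rw [← setLIntegral_const]
    refine setLIntegral_mono' measurableSet_closedBall fun z hz => ENNReal.ofReal_le_ofReal ?_
    refine le_trans ?_ ((le_abs_self _).trans (hD z hz))
    refine Real.rpow_le_rpow_of_exponent_le (by linarith [norm_nonneg z]) (le_trans ?_ (le_abs_self _))
    rw [hw]
    gcongr
    linarith
  calc ∫⁻ z, polyWeight w z = ∫⁻ z in Set.univ, polyWeight w z := by rw [setLIntegral_univ]
    _ ≤ ∫⁻ z in (⋃ N, S N) ∪ Metric.closedBall 0 B, polyWeight w z := lintegral_mono_set hcover
    _ ≤ _ := lintegral_union_le _ _ _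
    _ ≤ _ := add_le_add hun hball
    _ = _ := by
      rw [ENNReal.coe_mul, ENNReal.coe_mul, ENNReal.coe_mul, ENNReal.coe_inv hc.ne',
        ENNReal.coe_rpow_of_nonneg _ hq.le, ENNReal.coe_rpow_of_nonneg _ (by positivity),
        ENNReal.coe_toNNReal hvol]
      rfl

-- If the inequality fails, the exponent on the left of the preceding estimate is at least `-2 -
-- qe/p`, so the left side is at least `πp/(qe)`, while the right side is `O(e^{-q/p})`. Multiplying
-- by `e` and letting `e → 0` gives a contradiction since `q < p`.
open Filter Topology in
theorem lt_of_derivBounded {m p q : ℝ} (hm : 0 < m) {hp : 0 < p} {hq : 0 < q} (hqp : q < p)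
    (h : DerivBounded m p q hp hq) : m < 1 - 2 * (1 / q - 1 / p) := by
  obtain ⟨K, L, hKL⟩ := exists_lintegral_polyWeight_le_of_derivBounded hm h
  by_contra! hge
  have hreal : ∀ e : ℝ, 0 < e → e ≤ 1 →
      Real.pi * p / q ≤ K * (2 * Real.pi) ^ (q / p) * e ^ (1 - q / p) + L * e := by
    intro e he he1
    set d := q * e / p with hd
    have hd0 : 0 < d := by positivity
    have hd1 : d ≤ 1 := by rw [hd, div_le_one hp]; nlinarith
    have h1 : ∫⁻ z, polyWeight (-2 - d) z ≤ ∫⁻ z, polyWeight (q * ((m - 1) - (2 + e) / p)) z := by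
      refine lintegral_mono fun z => ENNReal.ofReal_le_ofReal
        (Real.rpow_le_rpow_of_exponent_le (by linarith [norm_nonneg z]) ?_)
      have h2 : q * (-(2 * (1 / q - 1 / p)) - (2 + e) / p) ≤ q * ((m - 1) - (2 + e) / p) := by
        gcongr; linarith
      refine le_trans (le_of_eq ?_) h2
      rw [hd]; field_simp; ring
    rw [lintegral_polyWeight hd0] at h1
    have h2 := h1.trans (hKL e he he1)
    rw [ENNReal.ofReal_rpow_of_nonneg (by positivity) (by positivity), ← ENNReal.ofReal_coe_nnreal,
      ← ENNReal.ofReal_coe_nnreal (p := L), ← ENNReal.ofReal_mul K.coe_nonneg,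
      ← ENNReal.ofReal_add (by positivity) L.coe_nonneg,
      ENNReal.ofReal_le_ofReal_iff (by positivity)] at h2
    have h3 : Real.pi / d ≤ 2 * Real.pi / (d * (1 + d)) := by
      rw [div_le_div_iff₀ hd0 (by positivity)]
      nlinarith [mul_pos Real.pi_pos hd0]
    have h4 : (2 * Real.pi / (e * (1 + e))) ^ (q / p) ≤ (2 * Real.pi) ^ (q / p) * e ^ (-(q / p)) := by
      rw [Real.rpow_neg he.le, ← div_eq_mul_inv, ← Real.div_rpow (by positivity) he.le]
      gcongr
      nlinarith
    have h5 : Real.pi / d ≤ K * ((2 * Real.pi) ^ (q / p) * e ^ (-(q / p))) + L :=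
      h3.trans (h2.trans (by gcongr))
    have h6 := mul_le_mul_of_nonneg_right h5 he.le
    calc Real.pi * p / q = Real.pi / d * e := by rw [hd]; field_simp
      _ ≤ _ := h6
      _ = _ := by
        rw [show 1 - q / p = -(q / p) + 1 by ring, Real.rpow_add_one he.ne']
        ring
  have hpos : 0 < 1 - q / p := by rw [sub_pos, div_lt_one hp]; exact hqp
  have hlim : Tendsto (fun e : ℝ => K * (2 * Real.pi) ^ (q / p) * e ^ (1 - q / p) + L * e)
      (𝓝[>] 0) (𝓝 0) := by
    have h1 : Tendsto (fun e : ℝ => e ^ (1 - q / p)) (𝓝 0) (𝓝 0) := by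
      have := (Real.continuous_rpow_const hpos.le).tendsto (0 : ℝ)
      rwa [Real.zero_rpow hpos.ne'] at this
    have h2 := (h1.const_mul ((K : ℝ) * (2 * Real.pi) ^ (q / p))).add
      ((tendsto_id (α := ℝ) (x := 𝓝 0)).const_mul (L : ℝ))
    simp only [mul_zero, add_zero, id] at h2
    exact h2.mono_left nhdsWithin_le_nhds
  have hfin : Real.pi * p / q ≤ 0 := by
    refine ge_of_tendsto hlim ?_
    filter_upwards [Ioc_mem_nhdsGT (zero_lt_one' ℝ)] with e he
    exact hreal e he.1 he.2
  have : 0 < Real.pi * p / q := by positivity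
  linarith

theorem theorem1 (m p q : ℝ) (hm : 0 < m) (hp : 0 < p) (hq : 0 < q) :
    (p ≤ q →
      (DerivBounded m p q hp hq ↔ m ≤ 2 - p * q / (p * q + q - p)) ∧
      (DerivCompact m p q hp hq ↔ m < 2 - p * q / (p * q + q - p)) ∧
      (∃ c C : ℝ≥0, 0 < c ∧ 0 < C ∧
        c * derivNormBound m p q ≤ derivOpNorm m p q hp ∧
        derivOpNorm m p q hp ≤ C * derivNormBound m p q)) ∧
    (q < p →
      List.TFAE [DerivBounded m p q hp hq, DerivCompact m p q hp hq,
        m < 1 - 2 * (1 / q - 1 / p)]) := by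
  refine ⟨fun hpq => ⟨?_, ?_, exists_derivOpNorm_comparable hm hp hq hpq⟩, fun hqp => ?_⟩
  · rw [derivBounded_iff_of_le hm hp hq hpq, (derivExponent_nonpos_iff hp hpq).1]
  · rw [derivCompact_iff_of_le hm hp hq hpq, (derivExponent_nonpos_iff hp hpq).2]
  · tfae_have 1 → 3 := lt_of_derivBounded hm hqp
    tfae_have 3 → 2 := fun h => by
      obtain ⟨k, hk, hT⟩ := derivTailBound_of_lt hm hq hqp h
      exact hT.derivCompact hm hp hq hk
    tfae_have 2 → 1 := fun h => h.derivBounded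
    tfae_finish
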